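/- Theorem 1.1. Functions on the unit circle $S^1\subset\mathbb C$ are real-valued, $'$ denotes the tangential (angular) derivative, integrals over $S^1$ are with respect to arc length, and $$(-\Delta)^{1/2}u(z)=\frac1\pi\,\mathrm{p.v.}\!\int_{S^1}\frac{u(z)-u(w)}{|z-w|^2}\,dw .$$ Let $\alpha>0$, $h\in C^{2,\alpha}(S^1)$ and $k\in C^1(S^1)$ with $k(1)=0$, such that the principal value defining $(-\Delta)^{1/2}k(1)$ exists, and set $h_\varepsilon=h+\varepsilon k$. Let $$Q(h)=\int_{S^1\times S^1}\log\frac1{|z-w|}\,\frac{h(z)-h(1)}{|z-1|^2}\,\frac{h(w)-h(1)}{|w-1|^2}\,dw\,dz .$$ Assume that $h(1)>0$, $h'(1)=(-\Delta)^{1/2}h(1)=0$, $$\Big(h''(1)-\frac{2}{\pi^2}\frac{Q(h)}{h(1)}\Big)h''(1)+\big((-\Delta)^{1/2}h'(1)\big)^2\neq0,$$ $$h''(1)\,(-\Delta)^{1/2}k(1)-k'(1)\,(-\Delta)^{1/2}h'(1)\neq0 .$$ Then there is $\varepsilon_0>0$ such that, for $I=(0,\varepsilon_0)$ or for $I=(-\varepsilon_0,0)$,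 there exist for every $\varepsilon\in I$ a (classical, $C^1$) solution $u_\varepsilon$ of $$(-\Delta)^{1/2}u=h_\varepsilon e^u-1\quad\text{on }S^1,$$ and $\delta_\varepsilon\in(0,1)$, $\xi_\varepsilon\in S^1$, with the following properties as $\varepsilon\to0$ in $I$. (i) $u_\varepsilon$ blows up at $1$: for every neighbourhood $U$ of $1$, $\sup_U u_\varepsilon\to+\infty$ and $u_\varepsilon\to-\infty$ uniformly on $S^1\setminus U$. (ii) $\delta_\varepsilon=O(\varepsilon)$, $\xi_\varepsilon=1+O(\varepsilon)$, and for every $p\in[1,\infty)$ $$\big\|u_\varepsilon\circ f_{\delta_\varepsilon,\xi_\varepsilon}+\log|f'_{\delta_\varepsilon,\xi_\varepsilon}|+\log h(1)\big\|_{L^p(S^1)}=O(\varepsilon),\qquad f_{\delta,\xi}(z)=\frac{z+(1-\delta)\xi}{1+(1-\delta)\overline\xi z},$$ where the constant in the last $O(\varepsilon)$ may depend on $p$. -/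

import Mathlib

open MeasureTheory Filter Topology Set Asymptotics
open scoped NNReal ENNReal Real ComplexConjugate

noncomputable section

namespace HalfLiouville

instance : MeasurableSpace Circle := borel Circle

instance : BorelSpace Circle := ⟨rfl⟩

/-- Arc-length measure on the unit circle (total mass `2π`). -/
def arc : Measure Circle :=
  (volume.restrict (Ioc (-π) π)).map Circle.exp

/-- The tangential (angular, counterclockwise) derivative of a function on the circle. -/
def tder (g : Circle → ℝ) (z : Circle) : ℝ :=
  deriv (fun t : ℝ => g (z * Circle.exp t)) 0

/-- `g` is of class `C^n` on the circle. -/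
def IsC (n : ℕ) (g : Circle → ℝ) : Prop :=
  ContDiff ℝ n (fun t : ℝ => g (Circle.exp t))

/-- `g` is of class `C^{2,α}` on the circle. -/
def IsC2Holder (α : ℝ≥0) (g : Circle → ℝ) : Prop :=
  IsC 2 g ∧ ∃ C : ℝ≥0, HolderWith C α (tder (tder g))

/-- The integral over `{w : |z - w| > r}` in the definition of the half-Laplacian. -/
def truncHalfLap (g : Circle → ℝ) (z : Circle) (r : ℝ) : ℝ :=
  (1 / π) * ∫ w in {w : Circle | r < ‖(z : ℂ) - (w : ℂ)‖},
    (g z - g w) / ‖(z : ℂ) - (w : ℂ)‖ ^ 2 ∂arc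

/-- `(-Δ)^{1/2} g (z)` exists, as a principal value, and equals `L`. -/
def HasHalfLap (g : Circle → ℝ) (z : Circle) (L : ℝ) : Prop :=
  Tendsto (truncHalfLap g z) (𝓝[>] 0) (𝓝 L)

/-- Classical solutions of `(-Δ)^{1/2} u = κ e^u - 1` on the circle. -/
def IsSolution (κ u : Circle → ℝ) : Prop :=
  IsC 1 u ∧ ∀ z, HasHalfLap u z (κ z * Real.exp (u z) - 1)

/-- The quadratic form `Q(h)`. -/
def Q (h : Circle → ℝ) : ℝ :=
  ∫ x : Circle × Circle,
    Real.log (1 / ‖(x.1 : ℂ) - (x.2 : ℂ)‖)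
      * ((h x.1 - h 1) / ‖(x.1 : ℂ) - 1‖ ^ 2)
      * ((h x.2 - h 1) / ‖(x.2 : ℂ) - 1‖ ^ 2) ∂(arc.prod arc)

/-- The Möbius map `f_{δ,ξ}(z) = (z + (1-δ)ξ) / (1 + (1-δ) ξ̄ z)` on the complex plane. -/
def mobius (δ : ℝ) (ξ : Circle) (z : ℂ) : ℂ :=
  (z + (1 - δ) * ξ) / (1 + (1 - δ) * conj (ξ : ℂ) * z)

lemma mobius_denom_ne_zero {δ : ℝ} (h0 : 0 < δ) (h1 : δ < 1) (ξ z : Circle) :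
    (1 + (1 - δ) * conj (ξ : ℂ) * z : ℂ) ≠ 0 := by
  intro h
  have e : ((1 - δ) * conj (ξ : ℂ) * z : ℂ) = -1 := by linear_combination h
  have e2 := congrArg norm e
  have e3 : (1 - δ : ℂ) = ((1 - δ : ℝ) : ℂ) := by push_cast; ring
  rw [norm_mul, norm_mul, e3, Complex.norm_real, RCLike.norm_conj, Circle.norm_coe,
    Circle.norm_coe, norm_neg, norm_one, Real.norm_eq_abs, abs_of_pos (by linarith)] at e2
  linarith

lemma norm_mobius {δ : ℝ} (h0 : 0 < δ) (h1 : δ < 1) (ξ z : Circle) :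
    ‖mobius δ ξ z‖ = 1 := by
  have hd := mobius_denom_ne_zero h0 h1 ξ z
  have hz : (z : ℂ) * conj (z : ℂ) = 1 := by
    rw [Complex.mul_conj, Circle.normSq_coe]; simp
  have key : (z + (1 - δ) * ξ : ℂ) = z * conj (1 + (1 - δ) * conj (ξ : ℂ) * z : ℂ) := by
    simp only [map_add, map_mul, map_sub, map_one, Complex.conj_conj, Complex.conj_ofReal]
    linear_combination (-(1 - (δ : ℂ)) * ξ) * hz
  rw [mobius, norm_div, key, norm_mul, RCLike.norm_conj, Circle.norm_coe, one_mul]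
  exact div_self (norm_ne_zero_iff.mpr hd)

/-- A complex number of modulus one, as a point of the circle. -/
def toCircle (w : ℂ) (hw : ‖w‖ = 1) : Circle :=
  ⟨w, mem_sphere_zero_iff_norm.mpr hw⟩

/-- The restriction of `f_{δ,ξ}` to the circle, as a self-map of the circle
(for `0 < δ < 1`; the value `1` is a dummy for degenerate parameters). -/
def circleMobius (δ : ℝ) (ξ z : Circle) : Circle :=
  if hz : ‖mobius δ ξ z‖ = 1 then toCircle (mobius δ ξ z) hz else 1

lemma coe_circleMobius {δ : ℝ} (h0 : 0 < δ) (h1 : δ < 1) (ξ z : Circle) :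
    (circleMobius δ ξ z : ℂ) = mobius δ ξ z := by
  rw [circleMobius, dif_pos (norm_mobius h0 h1 ξ z)]
  rfl

/-- The family `u ε` blows up at the point `p`, and only there, along the filter `l`:
its supremum on every neighbourhood `U` of `p` tends to `+∞`, and `u ε` tends to `-∞`
uniformly outside `U`. -/
def BlowsUpAt (l : Filter ℝ) (u : ℝ → Circle → ℝ) (p : Circle) : Prop :=
  ∀ U ∈ 𝓝 p, ∀ M : ℝ,
    (∀ᶠ ε in l, ∃ z ∈ U, M < u ε z) ∧ (∀ᶠ ε in l, ∀ z ∉ U, u ε z < M)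

end HalfLiouville

end

/-!
# Blowing-up solutions of the half-Liouville equation on the circle

The argument is a Lyapunov–Schmidt reduction in the frame of the conformal map `f = f_{δ,ξ}`. Since
the equation is conformally covariant, `u` solves `(-Δ)^{1/2} u = (h + εk) e^u - 1` if and only if
`φ = u ∘ f + log |f'| + log h(1)` solves

  `(-Δ)^{1/2} φ = (1 + η) e^φ - 1`,  where `η = ((h + εk) ∘ f - h(1)) / h(1)`.

For small `δ` the map `f` sends everything but a small neighbourhood of `-ξ` close to the
point `1`, where `h` is flat. Hence the density `η` is bounded and concentrated at `-ξ`, and its mass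
is `O(δ)`. Because `(-Δ)^{1/2} h(1) = 0` means `∫ (h(w) - h(1)) / |w - 1|² dw = 0`, the mean of `η` is even
`O(δ^{3/2})` (`Flat.exists_concentrated`).

The linearised operator `(-Δ)^{1/2} - 1` has the first harmonics as its kernel, and is inverted on
the other harmonics by convolution with `resolventKer`, which is the logarithmic Green kernel plus a
continuous function. Convolution with this kernel turns the equation, up to the first harmonics, into
a fixed-point problem, which is solved by contraction (`exists_aux_solution`). The solution `φ` is
small, of order `δ` in every `L^p` with `p < ∞` (`exists_eLpNorm_le`). It gives a solution `u` as soon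
as the first Fourier coefficient of `(1 + η) e^φ - 1` vanishes (`isSolution_pullBack`); the solution is
classical because its Fourier coefficients satisfy `Σ |n| |û(n)| < ∞` (`isSolution_of_rfour`).

What remains are two real equations for `(δ, τ)`, where `ξ = exp (iτ)`. The part of the first
coefficient that is linear in `η` is the Cauchy-type integral `∫ (h + εk)(w) w / (w - a)² dw` at
`a = (1 - δ) ξ`. Its nontangential boundary values at `1` consist of the half-Laplacian and the
tangential derivative (`tendsto_cauchyD`), and at a zero of these it has a first-order expansion with
coefficients `(-Δ)^{1/2} h'(1)` and `h''(1)` (`cauchyD_isLittleO`). The quadratic part is the Green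
energy of `η`, which by conformal covariance of the Green kernel tends to a multiple of `Q(h)`
(`Flat.energy_isLittleO`); the conformal factors do not contribute because the mean of `η` is small.
With `A = (-Δ)^{1/2} h'(1)`, `B = (-Δ)^{1/2} k(1)` and `q = 2 Q(h) / (π² h(1))`, the reduced equation is

  `(h''(1) + iA) (δ - iτ) + ε (B - i k'(1)) - q δ = o(δ)`

in the region `|ε| + |τ| = O(δ)` (`Flat.redMap_isLittleO`). The nondegeneracy condition says that its
linear part is invertible in `(δ, τ)`, and the transversality condition that `δ` is a nonzero multiple
of `ε` to first order, which determines the sign of `ε`. Since the error is merely continuous, the zero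
is found by a planar degree argument (`exists_zero_of_expansion`, `exists_zero_of_near_id`).
-/

noncomputable section

namespace HalfLiouville

/-! ### Arc-length measure on the circle -/

instance fact_two_pi_pos : Fact (0 < 2 * π) := ⟨Real.two_pi_pos⟩

lemma arc_eq_map_volume :
    arc = (volume : Measure (AddCircle (2 * π))).map AddCircle.homeomorphCircle' := by
  have h := (AddCircle.measurePreserving_mk (2 * π) (-π)).map_eq
  rw [show -π + 2 * π = π by ring] at h
  rw [← h, Measure.map_map AddCircle.homeomorphCircle'.continuous.measurable
    AddCircle.measurable_mk']
  rfl

/-- The angle parametrisation of the circle by `AddCircle (2π)` preserves arc length. -/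
lemma measurePreserving_homeomorphCircle :
    MeasurePreserving AddCircle.homeomorphCircle' (volume : Measure (AddCircle (2 * π))) arc :=
  ⟨AddCircle.homeomorphCircle'.continuous.measurable, arc_eq_map_volume.symm⟩

lemma integral_arc_eq_addCircle {E : Type*} [NormedAddCommGroup E] [NormedSpace ℝ E]
    (g : Circle → E) :
    ∫ w, g w ∂arc = ∫ t : AddCircle (2 * π), g (AddCircle.homeomorphCircle' t) :=
  (measurePreserving_homeomorphCircle.integral_comp
    AddCircle.homeomorphCircle'.measurableEmbedding g).symm

lemma integral_arc {E : Type*} [NormedAddCommGroup E] [NormedSpace ℝ E] (g : Circle → E) :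
    ∫ w, g w ∂arc = ∫ t in (0 : ℝ)..2 * π, g (Circle.exp t) := by
  rw [integral_arc_eq_addCircle, ← AddCircle.intervalIntegral_preimage (2 * π) 0, zero_add]
  rfl

instance : IsFiniteMeasure arc := by
  rw [arc_eq_map_volume]; infer_instance

instance : arc.IsMulLeftInvariant := by
  refine ⟨fun g => ?_⟩
  rw [arc_eq_map_volume, Measure.map_map (by fun_prop)
    AddCircle.homeomorphCircle'.continuous.measurable]
  obtain ⟨s, rfl⟩ := AddCircle.homeomorphCircle'.surjective g
  have : (fun x => AddCircle.homeomorphCircle' s * x) ∘ AddCircle.homeomorphCircle'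
      = AddCircle.homeomorphCircle' ∘ (fun x => s + x) := by
    ext1 x
    exact (Real.Angle.toCircle_add s x).symm
  rw [this, ← Measure.map_map AddCircle.homeomorphCircle'.continuous.measurable
    (by fun_prop), map_add_left_eq_self]

instance : arc.IsInvInvariant := by
  refine ⟨?_⟩
  rw [Measure.inv, arc_eq_map_volume, Measure.map_map (by fun_prop)
    AddCircle.homeomorphCircle'.continuous.measurable]
  have : Inv.inv ∘ AddCircle.homeomorphCircle'
      = AddCircle.homeomorphCircle' ∘ (fun x => -x) := by
    ext1 x
    exact (Real.Angle.toCircle_neg x).symm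
  rw [this, ← Measure.map_map AddCircle.homeomorphCircle'.continuous.measurable
    (by fun_prop)]
  congr 1
  exact Measure.map_neg_eq_self volume

instance : NullSingletonClass arc := by
  refine ⟨fun z => ?_⟩
  rw [arc, Measure.map_apply (by fun_prop) (measurableSet_singleton z)]
  refine measure_mono_null (t := ⋃ n : ℤ, {Complex.arg z + n * (2 * π)}) ?_ ?_
  · intro t ht
    have h : Circle.exp t = Circle.exp (Complex.arg z) := by simpa using ht
    obtain ⟨m, hm⟩ := Circle.exp_eq_exp.mp h
    exact mem_iUnion.2 ⟨m, by simpa using hm⟩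
  · exact (countable_iUnion fun n => countable_singleton _).measure_zero _

lemma integral_arc_coe (g : ℂ → ℂ) :
    ∫ w : Circle, g w ∂arc = (2 * π : ℝ) • Real.circleAverage g 0 1 := by
  rw [integral_arc, Real.circleAverage_def, smul_smul, mul_inv_cancel₀ (by positivity), one_smul]
  simp [circleMap]

lemma integral_arc_const {E : Type*} [NormedAddCommGroup E] [NormedSpace ℝ E] [CompleteSpace E]
    (c : E) : ∫ _ : Circle, c ∂arc = (2 * π) • c := by
  rw [integral_arc]; simp

lemma arc_real_univ : arc.real univ = 2 * π := by
  have := integral_arc_const (1 : ℝ)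
  simpa using this

lemma _root_.Continuous.integrable_arc {E : Type*} [NormedAddCommGroup E] {g : Circle → E}
    (hg : Continuous g) : Integrable g arc :=
  hg.integrable_of_hasCompactSupport (HasCompactSupport.of_compactSpace g)

lemma integral_arc_mul_left {E : Type*} [NormedAddCommGroup E] [NormedSpace ℝ E]
    (g : Circle → E) (z : Circle) : ∫ w, g (z * w) ∂arc = ∫ w, g w ∂arc :=
  integral_mul_left_eq_self g z

lemma integral_arc_mul_inv {E : Type*} [NormedAddCommGroup E] [NormedSpace ℝ E]
    (g : Circle → E) (z : Circle) : ∫ w, g (z * w⁻¹) ∂arc = ∫ w, g w ∂arc := by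
  rw [integral_inv_eq_self (fun w => g (z * w)) arc, integral_arc_mul_left]

lemma norm_one_sub_exp (t : ℝ) : ‖(1 : ℂ) - Circle.exp t‖ = 2 * |Real.sin (t / 2)| := by
  rw [norm_sub_rev, Circle.coe_exp, mul_comm, Complex.norm_exp_I_mul_ofReal_sub_one,
    norm_mul, Real.norm_eq_abs, Real.norm_eq_abs, abs_two]

lemma two_div_pi_mul_le_norm {t : ℝ} (ht : |t| ≤ π) :
    2 / π * |t| ≤ ‖(1 : ℂ) - Circle.exp t‖ := by
  rw [norm_one_sub_exp]
  have h1 : |t / 2| ≤ π / 2 := by rw [abs_div, abs_two]; linarith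
  have := Real.mul_abs_le_abs_sin h1
  calc 2 / π * |t| = 2 * (2 / π * |t / 2|) := by rw [abs_div, abs_two]; ring
    _ ≤ _ := by gcongr

lemma integrable_arc_iff {E : Type*} [NormedAddCommGroup E] {g : Circle → E}
    (hg : AEStronglyMeasurable g arc) :
    Integrable g arc ↔ IntegrableOn (fun t => g (Circle.exp t)) (Ioc (-π) π) := by
  rw [arc, integrable_map_measure hg (by fun_prop)]
  rfl

/-- The singularity `|1-w|^{-1/2}` is integrable on the circle. -/
lemma integrable_norm_one_sub_rpow :
    Integrable (fun w : Circle => ‖(1 : ℂ) - w‖ ^ (-(1 / 2) : ℝ)) arc := by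
  rw [integrable_arc_iff
    ((Continuous.measurable (by fun_prop)).pow_const _).aestronglyMeasurable]
  have h0 : IntegrableOn (fun t : ℝ => |t| ^ (-(1 / 2) : ℝ)) (Ioc (-π) π) := by
    have h1 : IntervalIntegrable (fun t : ℝ => |t| ^ (-(1 / 2) : ℝ)) volume 0 π := by
      refine (intervalIntegral.intervalIntegrable_rpow' (by norm_num)
        (r := -(1 / 2))).congr_uIoo ?_
      intro t ht
      rw [uIoo_of_le Real.pi_pos.le] at ht
      simp only
      rw [abs_of_pos ht.1]
    have h2 : IntervalIntegrable (fun t : ℝ => |t| ^ (-(1 / 2) : ℝ)) volume (-π) 0 := by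
      have := (IntervalIntegrable.iff_comp_neg).1 h1
      simpa using this.symm
    exact (intervalIntegrable_iff_integrableOn_Ioc_of_le (by linarith [Real.pi_pos])).1
      (h2.trans h1)
  refine (h0.const_mul ((2 / π) ^ (-(1 / 2) : ℝ))).mono'
    ((Continuous.measurable (by fun_prop)).pow_const _).aestronglyMeasurable ?_
  refine (ae_restrict_iff' measurableSet_Ioc).2 ?_
  have : ∀ᵐ t : ℝ, t ≠ 0 := by simp [ae_iff]
  filter_upwards [this] with t ht0 ht
  have hp := Real.pi_pos
  have ht' : |t| ≤ π := abs_le.2 ⟨ht.1.le, ht.2⟩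
  rw [Real.norm_eq_abs, abs_of_nonneg (by positivity), ← Real.mul_rpow (by positivity) (by positivity)]
  exact Real.rpow_le_rpow_of_nonpos (by positivity) (two_div_pi_mul_le_norm ht') (by norm_num)

/-! ### Fourier analysis on the circle -/

/-- The (unnormalised) Fourier coefficient `∫ g(w) w^{-n} dw` with respect to arc length. -/
def four (g : Circle → ℂ) (n : ℤ) : ℂ := ∫ w : Circle, g w * (w : ℂ) ^ (-n) ∂arc

/-- The Fourier coefficients of a real-valued function. -/
abbrev rfour (g : Circle → ℝ) (n : ℤ) : ℂ := four (fun w => (g w : ℂ)) n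

lemma continuous_coe_zpow (n : ℤ) : Continuous fun w : Circle => (w : ℂ) ^ n :=
  (by fun_prop : Continuous fun w : Circle => (w : ℂ)).zpow₀ n fun w => Or.inl w.coe_ne_zero

lemma norm_coe_zpow (n : ℤ) (w : Circle) : ‖(w : ℂ) ^ n‖ = 1 := by
  rw [norm_zpow, Circle.norm_coe, one_zpow]

lemma conj_coe_zpow (n : ℤ) (w : Circle) : conj ((w : ℂ) ^ n) = (w : ℂ) ^ (-n) := by
  rw [map_zpow₀, zpow_neg, ← inv_zpow, ← Circle.coe_inv_eq_conj, Circle.coe_inv]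

lemma fourier_eq_coe_zpow (n : ℤ) (t : AddCircle (2 * π)) :
    fourier n t = (AddCircle.homeomorphCircle' t : ℂ) ^ n := by
  rw [fourier_apply, AddCircle.toCircle_zsmul, Circle.coe_zpow]
  congr 2
  induction t using QuotientAddGroup.induction_on with
  | H x =>
    have : AddCircle.homeomorphCircle' (x : AddCircle (2 * π)) = Circle.exp x := rfl
    rw [this, AddCircle.toCircle_apply_mk, div_self (by positivity), one_mul]

lemma fourierCoeff_comp_homeomorphCircle (g : Circle → ℂ) (n : ℤ) :
    fourierCoeff (g ∘ AddCircle.homeomorphCircle') n = ((2 * π : ℝ)⁻¹ : ℝ) • four g n := by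
  rw [fourierCoeff, AddCircle.integral_haarAddCircle, four, integral_arc_eq_addCircle]
  simp only [fourier_eq_coe_zpow, smul_eq_mul, Function.comp, mul_comm]

/-- Transport of a continuous function on the circle to `AddCircle (2π)`. -/
def toAddCircleMap (f : C(Circle, ℂ)) : C(AddCircle (2 * π), ℂ) :=
  f.comp ⟨AddCircle.homeomorphCircle', AddCircle.homeomorphCircle'.continuous⟩

/-- Parseval's identity, in polarised form. -/
lemma hasSum_parseval (f g : C(Circle, ℂ)) :
    HasSum (fun n => four f n * conj (four g n)) (2 * π * ∫ w, f w * conj (g w) ∂arc) := by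
  set F := ContinuousMap.toLp 2 (AddCircle.haarAddCircle (T := 2 * π)) ℂ (toAddCircleMap f)
  set G := ContinuousMap.toLp 2 (AddCircle.haarAddCircle (T := 2 * π)) ℂ (toAddCircleMap g)
  have key := fourierBasis.hasSum_inner_mul_inner G F
  have hpi : (π : ℂ) ≠ 0 := by exact_mod_cast Real.pi_ne_zero
  rw [ContinuousMap.inner_toLp, AddCircle.integral_haarAddCircle] at key
  have e1 : ∫ t : AddCircle (2 * π), toAddCircleMap f t * conj (toAddCircleMap g t)
      = ∫ w, f w * conj (g w) ∂arc :=
    (integral_arc_eq_addCircle fun w => f w * conj (g w)).symm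
  rw [e1] at key
  have e2 : ∀ (h : C(Circle, ℂ)) n, inner ℂ (fourierBasis n)
      (ContinuousMap.toLp 2 (AddCircle.haarAddCircle (T := 2 * π)) ℂ (toAddCircleMap h))
      = (2 * π : ℂ)⁻¹ * four h n := by
    intro h n
    rw [← HilbertBasis.repr_apply_apply, fourierBasis_repr, fourierCoeff_toLp]
    have := fourierCoeff_comp_homeomorphCircle h n
    rw [toAddCircleMap]
    simp only [ContinuousMap.coe_comp, ContinuousMap.coe_mk]
    rw [this, Complex.real_smul]
    push_cast; ring
  have key2 := key.mul_left ((2 * π : ℂ) ^ 2)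
  convert! key2 using 1
  · ext n
    rw [← inner_conj_symm, e2, e2, map_mul, map_inv₀]
    simp only [map_mul, Complex.conj_ofReal, map_ofNat]
    field_simp
  · rw [Complex.real_smul]; push_cast; field_simp

lemma hasSum_parseval_sq (f : C(Circle, ℂ)) :
    HasSum (fun n => ‖four f n‖ ^ 2) (2 * π * ∫ w, ‖f w‖ ^ 2 ∂arc) := by
  have h := hasSum_parseval f f
  rw [← Complex.hasSum_ofReal]
  convert! h using 1
  · ext n; rw [Complex.mul_conj']; push_cast; rfl
  · push_cast
    rw [← integral_complex_ofReal]
    congr 2; ext w; rw [Complex.mul_conj']; push_cast; rfl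

lemma hasSum_parseval_real {f : Circle → ℝ} (hf : Continuous f) :
    HasSum (fun n => ‖rfour f n‖ ^ 2) (2 * π * ∫ w, f w ^ 2 ∂arc) := by
  have := hasSum_parseval_sq ⟨fun w => (f w : ℂ), by fun_prop⟩
  simpa using this

/-- Absolutely convergent Fourier series converge to the function. -/
lemma hasSum_fourier_inversion {f : Circle → ℂ} (hf : Continuous f) (hs : Summable (four f))
    (z : Circle) : HasSum (fun n => (2 * π : ℂ)⁻¹ * four f n * (z : ℂ) ^ n) (f z) := by
  obtain ⟨t, rfl⟩ := AddCircle.homeomorphCircle'.surjective z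
  have e : fourierCoeff (toAddCircleMap ⟨f, hf⟩) = fun n => (2 * π : ℂ)⁻¹ * four f n := by
    ext n
    have := fourierCoeff_comp_homeomorphCircle f n
    simp only [toAddCircleMap, ContinuousMap.coe_comp, ContinuousMap.coe_mk]
    rw [this, Complex.real_smul]; push_cast; ring
  have := has_pointwise_sum_fourier_series_of_summable (f := toAddCircleMap ⟨f, hf⟩)
    (by rw [e]; exact hs.mul_left _) t
  rw [e] at this
  simp only [smul_eq_mul, fourier_eq_coe_zpow] at this
  exact this

lemma integral_coe_zpow (n : ℤ) : ∫ w : Circle, (w : ℂ) ^ n ∂arc = if n = 0 then (2 * π : ℂ) else 0 := by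
  have h := fourierCoeff_fourier (T := 2 * π) n
  have e : (fourier n : AddCircle (2 * π) → ℂ)
      = (fun w : Circle => (w : ℂ) ^ n) ∘ AddCircle.homeomorphCircle' := by
    ext t; exact fourier_eq_coe_zpow n t
  have h2 := congrFun h 0
  rw [e, fourierCoeff_comp_homeomorphCircle, Complex.real_smul] at h2
  have hpi : (π : ℂ) ≠ 0 := by exact_mod_cast Real.pi_ne_zero
  simp only [four, neg_zero, zpow_zero, mul_one] at h2
  have h3 : ∫ w : Circle, (w : ℂ) ^ n ∂arc = 2 * π * (Pi.single n 1 : ℤ → ℂ) 0 := by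
    rw [← h2]; push_cast; field_simp
  rw [h3]
  split_ifs with h0
  · subst h0; simp
  · rw [Pi.single_eq_of_ne (Ne.symm h0)]; simp

/-- The coefficients of an absolutely convergent trigonometric series. -/
lemma four_tsum {a : ℤ → ℂ} (ha : Summable fun n => ‖a n‖) (n : ℤ) :
    four (fun w => ∑' m, a m * (w : ℂ) ^ m) n = 2 * π * a n := by
  have hint : ∀ m, Integrable (fun w : Circle => a m * (w : ℂ) ^ m * (w : ℂ) ^ (-n)) arc :=
    fun m => Continuous.integrable_arc
      ((continuous_const.mul (continuous_coe_zpow m)).mul (continuous_coe_zpow _))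
  have h1 : HasSum (fun m => ∫ w : Circle, a m * (w : ℂ) ^ m * (w : ℂ) ^ (-n) ∂arc)
      (∫ w : Circle, ∑' m, a m * (w : ℂ) ^ m * (w : ℂ) ^ (-n) ∂arc) := by
    refine hasSum_integral_of_summable_integral_norm hint ?_
    simp only [norm_mul, norm_coe_zpow, mul_one, integral_arc_const]
    exact ha.mul_left _
  have h2 : ∀ m, ∫ w : Circle, a m * (w : ℂ) ^ m * (w : ℂ) ^ (-n) ∂arc
      = if m = n then 2 * π * a n else 0 := by
    intro m
    have : ∀ w : Circle, a m * (w : ℂ) ^ m * (w : ℂ) ^ (-n) = a m * (w : ℂ) ^ (m - n) := by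
      intro w; rw [mul_assoc, ← zpow_add₀ w.coe_ne_zero, sub_eq_add_neg]
    simp only [this]
    rw [integral_const_mul, integral_coe_zpow]
    by_cases h : m = n
    · subst h; simp [mul_comm]
    · simp [h, sub_eq_zero]
  simp only [h2] at h1
  have h3 := h1.unique (hasSum_ite_eq n (2 * π * a n))
  rw [← h3, four]
  congr 1; ext w
  rw [tsum_mul_right]

lemma continuous_tsum_zpow {a : ℤ → ℂ} (ha : Summable fun n => ‖a n‖) :
    Continuous fun w : Circle => ∑' m, a m * (w : ℂ) ^ m :=
  continuous_tsum (fun m => continuous_const.mul (continuous_coe_zpow m)) ha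
    (fun m w => by rw [norm_mul, norm_coe_zpow, mul_one])

lemma norm_four_le {g : Circle → ℂ} (n : ℤ) : ‖four g n‖ ≤ ∫ w, ‖g w‖ ∂arc := by
  refine (norm_integral_le_integral_norm _).trans_eq ?_
  simp only [norm_mul, norm_coe_zpow, mul_one]

lemma integrable_mul_zpow {g : Circle → ℂ} (hg : Integrable g arc) (n : ℤ) :
    Integrable (fun w : Circle => g w * (w : ℂ) ^ n) arc :=
  hg.mul_bdd (c := 1) (continuous_coe_zpow n).aestronglyMeasurable
    (Eventually.of_forall fun w => (norm_coe_zpow n w).le)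

lemma four_sub {f g : Circle → ℂ} (hf : Integrable f arc) (hg : Integrable g arc) (n : ℤ) :
    four (fun w => f w - g w) n = four f n - four g n := by
  simp only [four, sub_mul]
  exact integral_sub (integrable_mul_zpow hf _) (integrable_mul_zpow hg _)

lemma four_add {f g : Circle → ℂ} (hf : Integrable f arc) (hg : Integrable g arc) (n : ℤ) :
    four (fun w => f w + g w) n = four f n + four g n := by
  simp only [four, add_mul]
  exact integral_add (integrable_mul_zpow hf _) (integrable_mul_zpow hg _)

lemma rfour_add {f g : Circle → ℝ} (hf : Integrable f arc) (hg : Integrable g arc) (n : ℤ) :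
    rfour (fun w => f w + g w) n = rfour f n + rfour g n := by
  have hf' : Integrable (fun w => (f w : ℂ)) arc := hf.ofReal
  have hg' : Integrable (fun w => (g w : ℂ)) arc := hg.ofReal
  simpa only [rfour, Complex.ofReal_add] using four_add hf' hg' n

lemma rfour_sub {f g : Circle → ℝ} (hf : Integrable f arc) (hg : Integrable g arc) (n : ℤ) :
    rfour (fun w => f w - g w) n = rfour f n - rfour g n := by
  have hf' : Integrable (fun w => (f w : ℂ)) arc := hf.ofReal
  have hg' : Integrable (fun w => (g w : ℂ)) arc := hg.ofReal
  simpa only [rfour, Complex.ofReal_sub] using four_sub hf' hg' n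

lemma four_const (c : ℂ) (n : ℤ) : four (fun _ => c) n = if n = 0 then 2 * π * c else 0 := by
  simp only [four]
  rw [integral_const_mul, integral_coe_zpow]
  by_cases h : n = 0 <;> simp [h, mul_comm]

lemma four_translate (g : Circle → ℂ) (v : Circle) (n : ℤ) :
    four (fun w => g (v * w)) n = (v : ℂ) ^ n * four g n := by
  have h := integral_arc_mul_left (fun w : Circle => g w * ((v⁻¹ * w : Circle) : ℂ) ^ (-n)) v
  simp only [inv_mul_cancel_left] at h
  rw [four, h, four, ← integral_const_mul]
  congr 1; ext w
  rw [Circle.coe_mul, Circle.coe_inv, mul_zpow, inv_zpow, zpow_neg, inv_inv]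
  ring

lemma four_conj (g : Circle → ℂ) (n : ℤ) :
    four (fun w => conj (g w)) n = conj (four g (-n)) := by
  rw [four, four, ← integral_conj]
  congr 1; ext w
  rw [map_mul, conj_coe_zpow, neg_neg]

/-- A continuous function is determined by its Fourier coefficients. -/
lemma eq_of_four_eq {f g : Circle → ℂ} (hf : Continuous f) (hg : Continuous g)
    (h : ∀ n, four f n = four g n) : f = g := by
  have h0 : four (fun w => f w - g w) = 0 := by
    ext n; rw [four_sub hf.integrable_arc hg.integrable_arc, h n, sub_self]; rfl
  ext z
  have := hasSum_fourier_inversion (f := fun w => f w - g w) (hf.sub hg) (by rw [h0]; exact summable_zero) z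
  rw [h0] at this
  simp only [Pi.zero_apply, mul_zero, zero_mul] at this
  exact sub_eq_zero.1 (this.unique hasSum_zero)

/-! ### Convolution operators -/

/-- Convolution on the circle with respect to arc length. -/
def conv (K g : Circle → ℝ) (z : Circle) : ℝ := ∫ w, K (z / w) * g w ∂arc

lemma conv_eq (K g : Circle → ℝ) (z : Circle) : conv K g z = ∫ w, K w * g (z / w) ∂arc := by
  rw [conv, ← integral_arc_mul_inv _ z]
  simp only [← div_eq_mul_inv, div_div_cancel]

lemma integrable_kernel {K : Circle → ℝ} (hK : Integrable K arc) (z : Circle) :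
    Integrable (fun w => K (z / w)) arc :=
  hK.comp_div_left z

lemma integral_kernel {E : Type*} [NormedAddCommGroup E] [NormedSpace ℝ E] (K : Circle → E)
    (z : Circle) : ∫ w, K (z / w) ∂arc = ∫ w, K w ∂arc :=
  integral_div_left_eq_self K arc z

lemma integrable_kernel_mul {K g : Circle → ℝ} (hK : Integrable K arc) (hg : Continuous g)
    (z : Circle) : Integrable (fun w => K (z / w) * g w) arc := by
  obtain ⟨C, hC⟩ := isCompact_univ.exists_bound_of_continuousOn hg.continuousOn
  exact (integrable_kernel hK z).mul_bdd (c := C) hg.aestronglyMeasurable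
    (Eventually.of_forall fun w => hC w (mem_univ _))

lemma continuous_conv {K g : Circle → ℝ} (hK : Integrable K arc) (hg : Continuous g) :
    Continuous (conv K g) := by
  obtain ⟨C, hC⟩ := isCompact_univ.exists_bound_of_continuousOn hg.continuousOn
  have : conv K g = fun z => ∫ w, K w * g (z / w) ∂arc := funext (conv_eq K g)
  rw [this]
  refine continuous_of_dominated (bound := fun w => ‖K w‖ * C) ?_ ?_ (hK.norm.mul_const C) ?_
  · intro z
    exact hK.aestronglyMeasurable.mul (by fun_prop : Continuous fun w => g (z / w)).aestronglyMeasurable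
  · refine fun z => Eventually.of_forall fun w => ?_
    rw [norm_mul]
    gcongr
    exact hC _ (mem_univ _)
  · exact Eventually.of_forall fun w => by fun_prop

lemma integrable_kernel_prod {K g : Circle → ℝ} (hK : Integrable K arc) (hg : Integrable g arc) :
    Integrable (fun p : Circle × Circle => K (p.1 / p.2) * g p.2) (arc.prod arc) :=
  (measurePreserving_div_prod arc arc).integrable_comp_of_integrable (hK.mul_prod hg)

lemma rfour_conv {K g : Circle → ℝ} (hK : Integrable K arc) (hg : Integrable g arc) (n : ℤ) :
    rfour (conv K g) n = rfour K n * rfour g n := by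
  have hint : Integrable (fun p : Circle × Circle =>
      ((K (p.1 / p.2) * g p.2 : ℝ) : ℂ) * (p.1 : ℂ) ^ (-n)) (arc.prod arc) := by
    refine (integrable_kernel_prod hK hg).ofReal.mul_bdd (c := 1) ?_
      (Eventually.of_forall fun p => (norm_coe_zpow (-n) p.1).le)
    exact ((continuous_coe_zpow (-n)).comp continuous_fst).aestronglyMeasurable
  calc rfour (conv K g) n
      = ∫ z : Circle, ∫ w : Circle, ((K (z / w) * g w : ℝ) : ℂ) * (z : ℂ) ^ (-n) ∂arc ∂arc := by
        simp only [rfour, four, conv]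
        congr 1; ext z
        rw [integral_mul_const, integral_complex_ofReal]
    _ = ∫ w : Circle, ∫ z : Circle, ((K (z / w) * g w : ℝ) : ℂ) * (z : ℂ) ^ (-n) ∂arc ∂arc :=
        integral_integral_swap hint
    _ = ∫ w : Circle, (g w * (w : ℂ) ^ (-n)) * rfour K n ∂arc := by
        congr 1; ext w
        have h := integral_arc_mul_left
          (fun z : Circle => ((K (z / w) * g w : ℝ) : ℂ) * (z : ℂ) ^ (-n)) w
        rw [← h, rfour, four, ← integral_const_mul]
        congr 1; ext z
        rw [mul_div_cancel_left, Circle.coe_mul, mul_zpow]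
        push_cast; ring
    _ = _ := by rw [integral_mul_const, mul_comm]; rfl

/-! ### The logarithmic kernel and the inverse of the linearised operator -/

lemma abs_log_pow_le {m : ℕ} (hm : m ≠ 0) {x : ℝ} (h0 : 0 ≤ x) (h2 : x ≤ 2) :
    |Real.log x| ^ m ≤ (2 * m) ^ m * x ^ (-(1 / 2) : ℝ) + 1 := by
  have hm' : (0 : ℝ) < m := by positivity
  rcases le_or_gt x 1 with h1 | h1
  · rcases h0.eq_or_lt with rfl | hx
    · simp [hm]
    have hlog : |Real.log x| ≤ (2 * m) * (x⁻¹) ^ (1 / (2 * m) : ℝ) := by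
      rw [abs_of_nonpos (Real.log_nonpos h0 h1), ← Real.log_inv]
      have := Real.log_le_rpow_div (x := x⁻¹) (by positivity) (ε := 1 / (2 * m)) (by positivity)
      refine this.trans_eq ?_
      field_simp
    calc |Real.log x| ^ m ≤ ((2 * m) * (x⁻¹) ^ (1 / (2 * m) : ℝ)) ^ m := by gcongr
      _ = (2 * m) ^ m * x ^ (-(1 / 2) : ℝ) := by
        rw [mul_pow, ← Real.rpow_natCast ((x⁻¹) ^ (1 / (2 * m) : ℝ)),
          ← Real.rpow_mul (by positivity), Real.inv_rpow h0, ← Real.rpow_neg h0]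
        congr 2; field_simp
      _ ≤ _ := by linarith
  · have hl : |Real.log x| ≤ 1 := by
      rw [abs_of_nonneg (Real.log_nonneg h1.le)]
      have := Real.log_le_sub_one_of_pos (by linarith : 0 < x)
      linarith
    have := pow_le_one₀ (n := m) (abs_nonneg _) hl
    have : 0 ≤ (2 * (m : ℝ)) ^ m * x ^ (-(1 / 2) : ℝ) := by positivity
    linarith

lemma norm_one_sub_le_two (w : Circle) : ‖(1 : ℂ) - w‖ ≤ 2 := by
  refine (norm_sub_le _ _).trans ?_
  rw [norm_one, Circle.norm_coe]; norm_num

lemma integrable_abs_log_pow {m : ℕ} (hm : m ≠ 0) :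
    Integrable (fun w : Circle => |Real.log ‖(1 : ℂ) - w‖| ^ m) arc := by
  refine ((integrable_norm_one_sub_rpow.const_mul ((2 * m) ^ m)).add (integrable_const 1)).mono' ?_
    (Eventually.of_forall fun w => ?_)
  · have : Measurable fun w : Circle => ‖(1 : ℂ) - w‖ := Continuous.measurable (by fun_prop)
    exact ((Real.measurable_log.comp this).abs.pow_const m).aestronglyMeasurable
  · rw [Real.norm_eq_abs, abs_of_nonneg (by positivity)]
    exact abs_log_pow_le hm (norm_nonneg _) (norm_one_sub_le_two w)

lemma measurable_log_norm : Measurable fun w : Circle => Real.log ‖(1 : ℂ) - w‖ :=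
  Real.measurable_log.comp (Continuous.measurable (by fun_prop))

lemma integrable_log_norm : Integrable (fun w : Circle => Real.log ‖(1 : ℂ) - w‖) arc := by
  have := integrable_abs_log_pow one_ne_zero
  simp only [pow_one] at this
  exact (integrable_norm_iff measurable_log_norm.aestronglyMeasurable).1 this

/-- The expansion of the logarithmic kernel inside the disc. -/
lemma hasSum_log_norm {r : ℝ} (h0 : 0 ≤ r) (h1 : r < 1) (w : Circle) :
    HasSum (fun n : ℤ => ((r ^ n.natAbs * (|(n : ℝ)|)⁻¹ : ℝ) : ℂ) * (w : ℂ) ^ n)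
      ((-2 * Real.log ‖(1 : ℂ) - r * w‖ : ℝ) : ℂ) := by
  have hz : ‖(r * w : ℂ)‖ < 1 := by
    rw [norm_mul, Circle.norm_coe, Complex.norm_real, Real.norm_eq_abs, abs_of_nonneg h0, mul_one]
    exact h1
  have hA := Complex.hasSum_taylorSeries_neg_log hz
  have hB := Complex.hasSum_conj'.2 hA
  have hs := HasSum.of_nat_of_neg
    (f := fun n : ℤ => ((r ^ n.natAbs * (|(n : ℝ)|)⁻¹ : ℝ) : ℂ) * (w : ℂ) ^ n)
    (g := -Complex.log (1 - r * w)) (g' := conj (-Complex.log (1 - r * w))) ?_ ?_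
  · convert! hs using 1
    simp only [Int.natAbs_zero, Int.cast_zero, abs_zero, inv_zero, mul_zero, Complex.ofReal_zero,
      zero_mul, sub_zero]
    rw [Complex.add_conj, Complex.neg_re, Complex.log_re]
    push_cast; ring
  · convert! hA using 2 with n
    simp only [Int.natAbs_natCast, zpow_natCast, Int.cast_natCast, Nat.abs_cast]
    push_cast; rw [mul_pow]; ring
  · convert! hB using 2 with n
    simp only [Int.natAbs_neg, Int.natAbs_natCast, zpow_neg, zpow_natCast, Int.cast_neg,
      Int.cast_natCast, abs_neg, Nat.abs_cast]
    rw [map_div₀, map_pow, map_mul, Complex.conj_ofReal, map_natCast, ← Circle.coe_inv_eq_conj,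
      Circle.coe_inv]
    push_cast; rw [mul_pow]; ring

lemma half_norm_le_norm_one_sub_mul {r : ℝ} (h0 : 0 ≤ r) (h1 : r ≤ 1) (w : Circle) :
    ‖(1 : ℂ) - w‖ / 2 ≤ ‖(1 : ℂ) - r * w‖ := by
  have e1 : ‖(1 : ℂ) - w‖ ≤ ‖(1 : ℂ) - r * w‖ + (1 - r) := by
    have : (1 : ℂ) - w = (1 - r * w) + ((r - 1 : ℝ) : ℂ) * w := by push_cast; ring
    rw [this]
    refine (norm_add_le _ _).trans ?_
    rw [norm_mul, Circle.norm_coe, Complex.norm_real, Real.norm_eq_abs, abs_of_nonpos (by linarith)]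
    linarith
  have e2 : 1 - r ≤ ‖(1 : ℂ) - r * w‖ := by
    have := norm_sub_norm_le (1 : ℂ) (r * w)
    rw [norm_mul, Circle.norm_coe, Complex.norm_real, Real.norm_eq_abs, abs_of_nonneg h0,
      norm_one] at this
    linarith
  linarith

lemma rfour_neg_two_log_mul {r : ℝ} (h0 : 0 ≤ r) (h1 : r < 1) (n : ℤ) :
    rfour (fun w => -2 * Real.log ‖(1 : ℂ) - r * w‖) n
      = 2 * π * ((r ^ n.natAbs * (|(n : ℝ)|)⁻¹ : ℝ) : ℂ) := by
  have hsum : Summable fun n : ℤ => ‖((r ^ n.natAbs * (|(n : ℝ)|)⁻¹ : ℝ) : ℂ)‖ := by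
    have := (hasSum_log_norm h0 h1 1).summable.norm
    simpa using this
  rw [← four_tsum hsum n, rfour]
  congr 1; funext w
  exact (hasSum_log_norm h0 h1 w).tsum_eq.symm

/-- The Green kernel `-(1/π) log |1-w|` of the half-Laplacian. -/
def greenKer (w : Circle) : ℝ := -(1 / π) * Real.log ‖(1 : ℂ) - w‖

lemma integrable_greenKer : Integrable greenKer arc := integrable_log_norm.const_mul _

/-- The Green kernel inverts the half-Laplacian on functions of mean zero: its Fourier coefficients are
`1/|n|` (with the junk value `0⁻¹ = 0` giving the correct coefficient at `n = 0`). They are obtained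
from the power series of `log |1 - r w|` in the limit `r → 1`. -/
lemma rfour_greenKer (n : ℤ) : rfour greenKer n = ((|(n : ℝ)|⁻¹ : ℝ) : ℂ) := by
  have hlim : Tendsto (fun r : ℝ => rfour (fun w => -2 * Real.log ‖(1 : ℂ) - r * w‖) n) (𝓝[<] 1)
      (𝓝 (rfour (fun w => -2 * Real.log ‖(1 : ℂ) - w‖) n)) := by
    have hae : ∀ᵐ w : Circle ∂arc, w ≠ 1 := by simp [ae_iff]
    have hev : ∀ᶠ r : ℝ in 𝓝[<] 1, 0 ≤ r ∧ r < 1 := by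
      filter_upwards [self_mem_nhdsWithin,
        mem_nhdsWithin_of_mem_nhds (Ioi_mem_nhds (zero_lt_one' ℝ))] with r hr hr0
      exact ⟨le_of_lt hr0, hr⟩
    refine tendsto_integral_filter_of_dominated_convergence
      (fun w => 2 * ((2 * ((1 : ℕ) : ℝ)) ^ 1 *
        ((1 / 2) ^ (-(1 / 2) : ℝ) * ‖(1 : ℂ) - w‖ ^ (-(1 / 2) : ℝ)) + 1)) ?_ ?_ ?_ ?_
    · refine Eventually.of_forall fun r => ?_
      refine AEStronglyMeasurable.mul ?_ (continuous_coe_zpow _).aestronglyMeasurable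
      have : Measurable fun w : Circle => Real.log ‖(1 : ℂ) - r * w‖ :=
        Real.measurable_log.comp (Continuous.measurable (by fun_prop))
      exact (Complex.measurable_ofReal.comp (this.const_mul _)).aestronglyMeasurable
    · filter_upwards [hev] with r hr
      filter_upwards [hae] with w hw
      rw [norm_mul, norm_coe_zpow, mul_one, Complex.norm_real, norm_mul, Real.norm_eq_abs,
        Real.norm_eq_abs, abs_neg, abs_two]
      gcongr
      have hx2 : ‖(1 : ℂ) - r * w‖ ≤ 2 := by
        refine (norm_sub_le _ _).trans ?_
        rw [norm_one, norm_mul, Circle.norm_coe, Complex.norm_real, Real.norm_eq_abs,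
          abs_of_nonneg hr.1]
        linarith [hr.2]
      have h3 := abs_log_pow_le one_ne_zero (norm_nonneg _) hx2
      rw [pow_one] at h3
      refine h3.trans ?_
      have hpos : 0 < ‖(1 : ℂ) - w‖ := norm_pos_iff.2 (sub_ne_zero.2 fun h => hw (by
        apply Circle.ext; exact h.symm))
      gcongr
      rw [← Real.mul_rpow (by norm_num) (norm_nonneg _)]
      refine Real.rpow_le_rpow_of_nonpos (by positivity) ?_ (by norm_num)
      have := half_norm_le_norm_one_sub_mul hr.1 hr.2.le w
      linarith
    · exact ((((integrable_norm_one_sub_rpow.const_mul _).const_mul _).add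
        (integrable_const 1)).const_mul 2)
    · filter_upwards [hae] with w hw
      have hne : ‖(1 : ℂ) - (1 : ℝ) * w‖ ≠ 0 := norm_ne_zero_iff.2 (sub_ne_zero.2 fun h => hw (by
        apply Circle.ext; simpa using h.symm))
      have hc : ContinuousAt (fun r : ℝ =>
          ((-2 * Real.log ‖(1 : ℂ) - r * w‖ : ℝ) : ℂ) * (w : ℂ) ^ (-n)) 1 := by
        refine ContinuousAt.mul ?_ continuousAt_const
        refine Complex.continuous_ofReal.continuousAt.comp ?_
        refine continuousAt_const.mul (ContinuousAt.log ?_ hne)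
        exact Continuous.continuousAt (by fun_prop)
      have := hc.tendsto.mono_left (nhdsWithin_le_nhds (s := Iio 1))
      simpa using this
  have hlim2 : Tendsto (fun r : ℝ => rfour (fun w => -2 * Real.log ‖(1 : ℂ) - r * w‖) n) (𝓝[<] 1)
      (𝓝 (2 * π * ((1 ^ n.natAbs * (|(n : ℝ)|)⁻¹ : ℝ) : ℂ))) := by
    have hc : Continuous fun r : ℝ => (2 * π * ((r ^ n.natAbs * (|(n : ℝ)|)⁻¹ : ℝ) : ℂ)) := by
      fun_prop
    refine ((hc.tendsto 1).mono_left nhdsWithin_le_nhds).congr' ?_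
    filter_upwards [self_mem_nhdsWithin,
        mem_nhdsWithin_of_mem_nhds (Ioi_mem_nhds (zero_lt_one' ℝ))] with r hr hr0
    exact (rfour_neg_two_log_mul (le_of_lt hr0) hr n).symm
  have huniq := tendsto_nhds_unique hlim hlim2
  have e : rfour greenKer n
      = (2 * π : ℂ)⁻¹ * rfour (fun w => -2 * Real.log ‖(1 : ℂ) - w‖) n := by
    rw [rfour, rfour, four, four, ← integral_const_mul]
    congr 1; ext w
    rw [greenKer]; push_cast; field_simp
  rw [e, huniq, one_pow, one_mul]
  have hpi : (π : ℂ) ≠ 0 := by exact_mod_cast Real.pi_ne_zero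
  field_simp

/-- Fourier coefficients `1/(|n|-1) - 1/|n|` of the smooth part of `resolventKer`
(the inverse of `0` being `0`). -/
def resolventCoeff (n : ℤ) : ℝ := (|(n : ℝ)| - 1)⁻¹ - |(n : ℝ)|⁻¹

lemma int_cases_two_le_abs (n : ℤ) : n = 0 ∨ n = 1 ∨ n = -1 ∨ (2 : ℝ) ≤ |(n : ℝ)| := by
  by_cases h : (2 : ℤ) ≤ |n|
  · right; right; right
    exact_mod_cast h
  · rw [not_le, abs_lt] at h
    omega

lemma abs_resolventCoeff_le (n : ℤ) : |resolventCoeff n| ≤ 5 * (1 + (n : ℝ) ^ 2)⁻¹ := by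
  rw [resolventCoeff]
  rcases int_cases_two_le_abs n with rfl | rfl | rfl | h
  · norm_num
  · norm_num
  · norm_num
  · rw [← sq_abs (n : ℝ)]
    set x := |(n : ℝ)|
    have e : (x - 1)⁻¹ - x⁻¹ = 1 / (x * (x - 1)) := by
      have : x - 1 ≠ 0 := by linarith
      have : x ≠ 0 := by linarith
      field_simp; ring
    have hp : 0 < x * (x - 1) := by nlinarith
    rw [e, abs_of_pos (by positivity), ← div_eq_mul_inv, div_le_div_iff₀ hp (by positivity)]
    nlinarith

lemma sq_inv_abs_sub_one_le (n : ℤ) : ((|(n : ℝ)| - 1)⁻¹) ^ 2 ≤ 5 * (1 + (n : ℝ) ^ 2)⁻¹ := by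
  rcases int_cases_two_le_abs n with rfl | rfl | rfl | h
  · norm_num
  · norm_num
  · norm_num
  · rw [← sq_abs (n : ℝ)]
    set x := |(n : ℝ)|
    have hp : 0 < x - 1 := by linarith
    rw [inv_pow, ← one_div, ← div_eq_mul_inv, div_le_div_iff₀ (by positivity) (by positivity)]
    nlinarith

lemma summable_inv_one_add_sq : Summable fun n : ℤ => (1 + (n : ℝ) ^ 2)⁻¹ := by
  have h := (Real.summable_one_div_int_pow (p := 2)).2 (by norm_num)
  refine (h.add (hasSum_ite_eq (0 : ℤ) (1 : ℝ)).summable).of_nonneg_of_le (fun n => by positivity)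
    fun n => ?_
  by_cases hn : n = 0
  · subst hn; norm_num
  · have : (0 : ℝ) < (n : ℝ) ^ 2 := by positivity
    simp only [hn, if_false, add_zero]
    rw [← one_div]
    gcongr
    linarith

lemma summable_resolventCoeff : Summable fun n => ‖(2 * π : ℂ)⁻¹ * (resolventCoeff n : ℂ)‖ := by
  simp only [norm_mul]
  refine Summable.mul_left _ ((summable_inv_one_add_sq.mul_left 5).of_nonneg_of_le
    (fun n => norm_nonneg _) fun n => ?_)
  rw [Complex.norm_real]
  exact abs_resolventCoeff_le n

/-- The smooth part of the resolvent kernel, as an absolutely convergent trigonometric series. -/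
def smoothKer (w : Circle) : ℝ :=
  (∑' n, (2 * π : ℂ)⁻¹ * (resolventCoeff n : ℂ) * (w : ℂ) ^ n).re

lemma coe_smoothKer (w : Circle) :
    (smoothKer w : ℂ) = ∑' n, (2 * π : ℂ)⁻¹ * (resolventCoeff n : ℂ) * (w : ℂ) ^ n := by
  rw [smoothKer, ← Complex.conj_eq_iff_re, Complex.conj_tsum]
  rw [← (Equiv.neg ℤ).tsum_eq]
  congr 1; ext n
  simp only [Equiv.neg_apply, map_mul, conj_coe_zpow, neg_neg, Complex.conj_ofReal, map_inv₀,
    map_ofNat]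
  simp [resolventCoeff]

lemma continuous_smoothKer : Continuous smoothKer :=
  Complex.continuous_re.comp (continuous_tsum_zpow summable_resolventCoeff)

lemma rfour_smoothKer (n : ℤ) : rfour smoothKer n = (resolventCoeff n : ℂ) := by
  have hpi : (π : ℂ) ≠ 0 := by exact_mod_cast Real.pi_ne_zero
  simp only [rfour, coe_smoothKer]
  rw [four_tsum summable_resolventCoeff]
  field_simp

/-- The kernel with Fourier coefficients `1/(|n|-1)` for `|n| ≠ 1` and `0` for `|n| = 1`: the
inverse of `(-Δ)^{1/2} - 1` on the orthogonal complement of its kernel `span {cos, sin}`. -/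
def resolventKer (w : Circle) : ℝ := greenKer w + smoothKer w

lemma integrable_resolventKer : Integrable resolventKer arc :=
  integrable_greenKer.add continuous_smoothKer.integrable_arc

lemma measurable_resolventKer : Measurable resolventKer :=
  (measurable_log_norm.const_mul _).add continuous_smoothKer.measurable

lemma rfour_resolventKer (n : ℤ) : rfour resolventKer n = (((|(n : ℝ)| - 1)⁻¹ : ℝ) : ℂ) := by
  have h : rfour resolventKer n = rfour greenKer n + rfour smoothKer n :=
    rfour_add integrable_greenKer continuous_smoothKer.integrable_arc n
  rw [h, rfour_greenKer, rfour_smoothKer, resolventCoeff]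
  push_cast; ring

lemma integrable_abs_resolventKer_pow {m : ℕ} (hm : m ≠ 0) :
    Integrable (fun w => |resolventKer w| ^ m) arc := by
  obtain ⟨C, hC⟩ := isCompact_univ.exists_bound_of_continuousOn continuous_smoothKer.continuousOn
  refine ((((integrable_abs_log_pow hm).const_mul ((1 / π) ^ m)).add
    (integrable_const (C ^ m))).const_mul (2 ^ (m - 1))).mono'
    (measurable_resolventKer.abs.pow_const m).aestronglyMeasurable
    (Eventually.of_forall fun w => ?_)
  rw [Real.norm_eq_abs, abs_of_nonneg (by positivity)]
  calc |resolventKer w| ^ m ≤ (|greenKer w| + |smoothKer w|) ^ m := by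
        gcongr; exact abs_add_le _ _
    _ ≤ 2 ^ (m - 1) * (|greenKer w| ^ m + |smoothKer w| ^ m) :=
        add_pow_le (abs_nonneg _) (abs_nonneg _) m
    _ ≤ _ := by
        simp only [Pi.add_apply]
        gcongr
        · rw [greenKer, abs_mul, abs_neg, abs_of_pos (by positivity : 0 < 1 / π), mul_pow]
        · exact hC w (mem_univ _)

/-! ### Functions of class `C^n` on the circle -/

lemma IsC.continuous {n : ℕ} {g : Circle → ℝ} (hg : IsC n g) : Continuous g := by
  have hq : IsQuotientMap Circle.exp := isLocalHomeomorph_circleExp.isOpenMap.isQuotientMap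
    Circle.exp.continuous fun w => ⟨Complex.arg w, Circle.exp_arg w⟩
  exact hq.continuous_iff.2 (ContDiff.continuous hg)

lemma periodic_comp_exp (g : Circle → ℝ) : Function.Periodic (fun t : ℝ => g (Circle.exp t)) (2 * π) :=
  fun t => by simp only; rw [Circle.periodic_exp t]

lemma IsC.exists_lipschitz {g : Circle → ℝ} (hg : IsC 1 g) :
    ∃ C : ℝ, 0 ≤ C ∧ ∀ w t, |g (Circle.exp t * w) - g w| ≤ C * |t| := by
  set G := fun t : ℝ => g (Circle.exp t)
  have hG : ContDiff ℝ 1 G := by simpa [IsC] using hg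
  have hd : Continuous (deriv G) := hG.continuous_deriv le_rfl
  have hper : Function.Periodic (deriv G) (2 * π) := fun t => by
    have h := periodic_comp_exp g
    have e : (fun x => G (x + 2 * π)) = G := funext h
    rw [← deriv_comp_add_const, e]
  obtain ⟨C, hC⟩ := isCompact_Icc (a := (0 : ℝ)) (b := 2 * π) |>.exists_bound_of_continuousOn
    hd.continuousOn
  have hC' : ∀ t, ‖deriv G t‖ ≤ C := fun t => by
    obtain ⟨y, hy, e⟩ := hper.exists_mem_Ico₀ Real.two_pi_pos t
    rw [e]; exact hC y ⟨hy.1, hy.2.le⟩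
  refine ⟨C, (norm_nonneg _).trans (hC' 0), fun w t => ?_⟩
  have hw := Circle.exp_arg w
  have := convex_univ.norm_image_sub_le_of_norm_deriv_le (f := G)
    (fun x _ => (hG.differentiable one_ne_zero).differentiableAt) (fun x _ => hC' x)
    (mem_univ (Complex.arg w)) (mem_univ (t + Complex.arg w))
  simp only [G, Circle.exp_add, hw, add_sub_cancel_right] at this
  exact this

/-! ### Regularity of solutions in Fourier space -/

lemma exp_coe_zpow (t : ℝ) (n : ℤ) : ((Circle.exp t : Circle) : ℂ) ^ n = Circle.exp (n * t) := by
  rw [Circle.coe_exp, Circle.coe_exp, ← Complex.exp_int_mul]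
  congr 1; push_cast; ring

lemma norm_exp_zpow_sub_one_le (t : ℝ) (n : ℤ) :
    ‖((Circle.exp t : Circle) : ℂ) ^ n - 1‖ ≤ |(n : ℝ)| * |t| := by
  rw [exp_coe_zpow, Circle.coe_exp, mul_comm, ← abs_mul]
  exact Real.norm_exp_I_mul_ofReal_sub_one_le

lemma rfour_translate_sub {g : Circle → ℝ} (hg : Continuous g) (t : ℝ) (n : ℤ) :
    rfour (fun w => g (Circle.exp t * w) - g w) n
      = (((Circle.exp t : Circle) : ℂ) ^ n - 1) * rfour g n := by
  have h := rfour_sub (f := fun w => g (Circle.exp t * w)) (g := g)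
    (by fun_prop : Continuous fun w => g (Circle.exp t * w)).integrable_arc hg.integrable_arc n
  rw [h, sub_mul, one_mul]
  congr 1
  exact four_translate (fun w => (g w : ℂ)) (Circle.exp t) n

/-- If the `L²` modulus of continuity of `g` is `O(t)`, then the Fourier series of `g` converges
absolutely, by the Cauchy-Schwarz inequality and Parseval's identity. -/
lemma summable_rfour_of_translate_le {g : Circle → ℝ} (hg : Continuous g) {C : ℝ}
    (hC : ∀ t : ℝ, ∫ w, (g (Circle.exp t * w) - g w) ^ 2 ∂arc ≤ C * t ^ 2) :
    Summable fun n => ‖rfour g n‖ := by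
  have hpi := Real.pi_pos
  have key : Summable fun n : ℤ => (n : ℝ) ^ 2 * ‖rfour g n‖ ^ 2 := by
    refine summable_of_sum_le (c := π ^ 2 / 4 * (2 * π * C)) (fun n => by positivity) fun s => ?_
    -- `t` is so small that `|n t| ≤ π` for all `n ∈ s`; there `|e^{int} - 1| ≥ 2 |n t| / π`
    set t : ℝ := π / (1 + ∑ n ∈ s, |(n : ℝ)|) with ht
    have hS : 0 ≤ ∑ n ∈ s, |(n : ℝ)| := Finset.sum_nonneg fun _ _ => abs_nonneg _
    have ht0 : 0 < t := by positivity
    have hn : ∀ n ∈ s, |(n * t : ℝ)| ≤ π := by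
      intro n hn
      rw [abs_mul, abs_of_pos ht0, ht, mul_div_assoc', div_le_iff₀ (by positivity), mul_comm]
      gcongr
      have := Finset.single_le_sum (f := fun n : ℤ => |(n : ℝ)|) (fun _ _ => abs_nonneg _) hn
      linarith
    have hcont : Continuous fun w => g (Circle.exp t * w) - g w := by fun_prop
    have hP := hasSum_parseval_real hcont
    have h1 := sum_le_hasSum s (fun n _ => by positivity) hP
    have h2 : ∑ n ∈ s, (2 / π * |(n * t : ℝ)|) ^ 2 * ‖rfour g n‖ ^ 2
        ≤ 2 * π * (C * t ^ 2) := by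
      refine le_trans (Finset.sum_le_sum fun n hns => ?_) (h1.trans ?_)
      · have e := rfour_translate_sub hg t n
        rw [e, norm_mul, mul_pow ‖_‖, exp_coe_zpow, norm_sub_rev]
        exact mul_le_mul_of_nonneg_right (pow_le_pow_left₀ (by positivity)
          (two_div_pi_mul_le_norm (hn n hns)) 2) (sq_nonneg _)
      · have := hC t
        gcongr
    have h3 : ∑ n ∈ s, (2 / π * |(n * t : ℝ)|) ^ 2 * ‖rfour g n‖ ^ 2
        = 4 / π ^ 2 * t ^ 2 * ∑ n ∈ s, (n : ℝ) ^ 2 * ‖rfour g n‖ ^ 2 := by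
      rw [Finset.mul_sum]
      refine Finset.sum_congr rfl fun n _ => ?_
      rw [mul_pow, sq_abs]; ring
    rw [h3] at h2
    have hk : 0 < 4 / π ^ 2 * t ^ 2 := by positivity
    refine le_of_mul_le_mul_left (h2.trans_eq ?_) hk
    field_simp
  have key2 : Summable fun n : ℤ => ‖rfour g n‖ ^ 2 := (hasSum_parseval_real hg).summable
  refine ((summable_inv_one_add_sq.add (key.add key2))).of_nonneg_of_le
    (fun n => norm_nonneg _) fun n => ?_
  have hp : (0 : ℝ) < 1 + (n : ℝ) ^ 2 := by positivity
  have e : (n : ℝ) ^ 2 * ‖rfour g n‖ ^ 2 + ‖rfour g n‖ ^ 2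
      = (1 + (n : ℝ) ^ 2) * ‖rfour g n‖ ^ 2 := by ring
  rw [e]
  have h1 : (1 + (n : ℝ) ^ 2)⁻¹ * (1 + (n : ℝ) ^ 2) = 1 := inv_mul_cancel₀ hp.ne'
  set x := ‖rfour g n‖
  set y := (1 + (n : ℝ) ^ 2)
  have h2 : 0 ≤ y⁻¹ * (1 - y * x) ^ 2 := by positivity
  have h3 : y⁻¹ * (1 - y * x) ^ 2 = y⁻¹ - 2 * x + y * x ^ 2 := by
    field_simp; ring
  have h4 : 0 ≤ x := norm_nonneg _
  linarith

/-- If a continuous `u` satisfies `(-Δ)^{1/2} u = κ e^u - 1` on the Fourier side, then the Fourier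
series of the right-hand side converges absolutely; that is, `Σ |n| |û(n)| < ∞`. The `L²` modulus of
continuity of `u` is `O(t)` because the right-hand side is square integrable, and the right-hand side
inherits it. -/
lemma summable_rfour_of_equation {κ u : Circle → ℝ} (hκ : IsC 1 κ) (hu : Continuous u)
    (h : ∀ n : ℤ, ((|(n : ℝ)| : ℝ) : ℂ) * rfour u n = rfour (fun w => κ w * Real.exp (u w) - 1) n) :
    Summable fun n => ‖rfour (fun w => κ w * Real.exp (u w) - 1) n‖ := by
  have hκc := hκ.continuous
  set g := fun w => κ w * Real.exp (u w) - 1 with hg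
  have hgc : Continuous g := by fun_prop
  obtain ⟨A, hA0, hA⟩ := hκ.exists_lipschitz
  obtain ⟨B, hB⟩ := isCompact_univ.exists_bound_of_continuousOn hκc.continuousOn
  obtain ⟨M, hM⟩ := isCompact_univ.exists_bound_of_continuousOn hu.continuousOn
  have hB' : ∀ w, |κ w| ≤ B := fun w => hB w (mem_univ _)
  have hM' : ∀ w, |u w| ≤ M := fun w => hM w (mem_univ _)
  have hB0 : 0 ≤ B := (abs_nonneg _).trans (hB' 1)
  have hP := hasSum_parseval_real hgc
  set S := 2 * π * ∫ w, g w ^ 2 ∂arc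
  have hpi := Real.pi_pos
  have step : ∀ t : ℝ, 2 * π * ∫ w, (u (Circle.exp t * w) - u w) ^ 2 ∂arc ≤ S * t ^ 2 := by
    intro t
    have hcont : Continuous fun w => u (Circle.exp t * w) - u w := by fun_prop
    refine hasSum_le (fun n => ?_) (hasSum_parseval_real hcont) (hP.mul_right (t ^ 2))
    rw [rfour_translate_sub hu, ← h n, norm_mul, norm_mul, Complex.norm_real, mul_pow, mul_pow,
      Real.norm_eq_abs, abs_abs, ← sq_abs t]
    calc ‖((Circle.exp t : Circle) : ℂ) ^ n - 1‖ ^ 2 * ‖rfour u n‖ ^ 2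
        ≤ (|(n : ℝ)| * |t|) ^ 2 * ‖rfour u n‖ ^ 2 := by
          gcongr; exact norm_exp_zpow_sub_one_le t n
      _ = _ := by ring
  have hexp : ∀ x y : ℝ, |x| ≤ M → |y| ≤ M → |Real.exp x - Real.exp y| ≤ Real.exp M * |x - y| := by
    intro x y hx hy
    have := (convex_Icc (-M) M).norm_image_sub_le_of_norm_deriv_le (f := Real.exp) (C := Real.exp M)
      (fun x _ => Real.differentiableAt_exp) (fun z hz => by
        rw [Real.deriv_exp, Real.norm_eq_abs, Real.abs_exp]
        exact Real.exp_le_exp.2 hz.2) (abs_le.1 hy) (abs_le.1 hx)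
    exact this
  set E := Real.exp M
  have hE : 0 < E := Real.exp_pos M
  refine summable_rfour_of_translate_le (C := 2 * (A * E) ^ 2 * (2 * π) + 2 * (B * E) ^ 2 *
    (S / (2 * π))) hgc fun t => ?_
  have hpt : ∀ w, (g (Circle.exp t * w) - g w) ^ 2
      ≤ 2 * (A * E) ^ 2 * t ^ 2 + 2 * (B * E) ^ 2 * (u (Circle.exp t * w) - u w) ^ 2 := by
    intro w
    set v := Circle.exp t * w
    have e : g v - g w = (κ v - κ w) * Real.exp (u v)
        + κ w * (Real.exp (u v) - Real.exp (u w)) := by simp only [hg]; ring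
    have h1 : |(κ v - κ w) * Real.exp (u v)| ≤ A * E * |t| := by
      rw [abs_mul, Real.abs_exp]
      calc _ ≤ (A * |t|) * E := by
            gcongr
            · exact hA w t
            · exact Real.exp_le_exp.2 (abs_le.1 (hM' v)).2
        _ = _ := by ring
    have h2 : |κ w * (Real.exp (u v) - Real.exp (u w))| ≤ B * E * |u v - u w| := by
      rw [abs_mul, mul_assoc]
      gcongr
      · exact hB' w
      · exact hexp _ _ (hM' _) (hM' _)
    have h3 : |g v - g w| ≤ A * E * |t| + B * E * |u v - u w| := by
      rw [e]; exact (abs_add_le _ _).trans (add_le_add h1 h2)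
    calc (g v - g w) ^ 2 = |g v - g w| ^ 2 := (sq_abs _).symm
      _ ≤ (A * E * |t| + B * E * |u v - u w|) ^ 2 := by gcongr
      _ ≤ 2 * ((A * E * |t|) ^ 2 + (B * E * |u v - u w|) ^ 2) := add_sq_le
      _ = _ := by rw [mul_pow _ |t|, mul_pow _ |u v - u w|, sq_abs, sq_abs]; ring
  have hi : Continuous fun w => (u (Circle.exp t * w) - u w) ^ 2 := by fun_prop
  calc ∫ w, (g (Circle.exp t * w) - g w) ^ 2 ∂arc
      ≤ ∫ w, (2 * (A * E) ^ 2 * t ^ 2 + 2 * (B * E) ^ 2 * (u (Circle.exp t * w) - u w) ^ 2) ∂arc :=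
        integral_mono (Continuous.integrable_arc (by fun_prop))
          (Continuous.integrable_arc (by fun_prop)) hpt
    _ = 2 * (A * E) ^ 2 * (2 * π) * t ^ 2
          + 2 * (B * E) ^ 2 * ∫ w, (u (Circle.exp t * w) - u w) ^ 2 ∂arc := by
        rw [integral_add (integrable_const _) (hi.integrable_arc.const_mul _), integral_arc_const,
          integral_const_mul, smul_eq_mul]
        ring
    _ ≤ 2 * (A * E) ^ 2 * (2 * π) * t ^ 2 + 2 * (B * E) ^ 2 * (S / (2 * π) * t ^ 2) := by
        gcongr
        rw [div_mul_eq_mul_div, le_div_iff₀ (by positivity), mul_comm]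
        exact step t
    _ = _ := by ring

/-! ### The half-Laplacian of trigonometric series -/

/-- The half-Laplacian at `1` of `w ↦ w^n`, with truncated singularity. The imaginary part of
`1 - v^n` integrates to zero by symmetry and `2 Re (1 - v^n) = |1 - v^n|²`, so that the quotient by
`|1 - v|²` is the square of a geometric sum. -/
def truncSymbol (n : ℤ) (r : ℝ) : ℝ :=
  (1 / (2 * π)) * ∫ v in {v : Circle | r < ‖(1 : ℂ) - v‖},
    ‖∑ k ∈ Finset.range n.natAbs, (v : ℂ) ^ k‖ ^ 2 ∂arc

lemma measurableSet_trunc (z : Circle) (r : ℝ) :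
    MeasurableSet {w : Circle | r < ‖(z : ℂ) - (w : ℂ)‖} :=
  (isOpen_lt continuous_const (by fun_prop)).measurableSet

lemma norm_one_sub_zpow_natAbs (v : Circle) (n : ℤ) :
    ‖(1 : ℂ) - (v : ℂ) ^ n‖ = ‖(1 : ℂ) - (v : ℂ) ^ n.natAbs‖ := by
  rcases Int.natAbs_eq n with h | h
  · conv_lhs => rw [h, zpow_natCast]
  · conv_lhs => rw [h, zpow_neg, zpow_natCast]
    have hne : (v : ℂ) ^ n.natAbs ≠ 0 := pow_ne_zero _ v.coe_ne_zero
    have : (1 : ℂ) - ((v : ℂ) ^ n.natAbs)⁻¹ = -((v : ℂ) ^ n.natAbs)⁻¹ * (1 - (v : ℂ) ^ n.natAbs) := by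
      field_simp; ring
    rw [this, norm_mul, norm_neg, norm_inv, norm_pow, Circle.norm_coe]
    simp

lemma norm_one_sub_zpow_eq (v : Circle) (n : ℤ) :
    ‖(1 : ℂ) - (v : ℂ) ^ n‖ = ‖(1 : ℂ) - v‖ * ‖∑ k ∈ Finset.range n.natAbs, (v : ℂ) ^ k‖ := by
  rw [norm_one_sub_zpow_natAbs, ← norm_mul, mul_neg_geom_sum]

/-- The average over the circle of `|1 + v + ⋯ + v^{m-1}|²` is `m`. -/
lemma integral_norm_geom_sq (m : ℕ) :
    ∫ v : Circle, ‖∑ k ∈ Finset.range m, (v : ℂ) ^ k‖ ^ 2 ∂arc = 2 * π * m := by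
  have e : ∀ v : Circle, ((‖∑ k ∈ Finset.range m, (v : ℂ) ^ k‖ ^ 2 : ℝ) : ℂ)
      = ∑ j ∈ Finset.range m, ∑ k ∈ Finset.range m, (v : ℂ) ^ ((j : ℤ) - k) := by
    intro v
    push_cast
    rw [← Complex.mul_conj', map_sum, Finset.sum_mul_sum]
    refine Finset.sum_congr rfl fun j _ => Finset.sum_congr rfl fun k _ => ?_
    rw [← zpow_natCast, ← zpow_natCast, conj_coe_zpow, ← zpow_add₀ v.coe_ne_zero, sub_eq_add_neg]
  have : ((∫ v : Circle, ‖∑ k ∈ Finset.range m, (v : ℂ) ^ k‖ ^ 2 ∂arc : ℝ) : ℂ)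
      = ((2 * π * m : ℝ) : ℂ) := by
    rw [← integral_complex_ofReal]
    simp only [e]
    rw [integral_finsetSum _ fun j _ => Continuous.integrable_arc
      (continuous_finsetSum _ fun k _ => continuous_coe_zpow _)]
    have h1 : ∀ j ∈ Finset.range m, ∫ v : Circle, ∑ k ∈ Finset.range m, (v : ℂ) ^ ((j : ℤ) - k) ∂arc
        = 2 * π := by
      intro j hj
      rw [integral_finsetSum _ fun k _ => Continuous.integrable_arc (continuous_coe_zpow _)]
      simp only [integral_coe_zpow, sub_eq_zero, Nat.cast_inj]
      rw [Finset.sum_ite_eq, if_pos hj]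
    rw [Finset.sum_congr rfl h1, Finset.sum_const, Finset.card_range, nsmul_eq_mul]
    push_cast; ring
  exact_mod_cast this

lemma continuous_norm_geom_sq (m : ℕ) :
    Continuous fun v : Circle => ‖∑ k ∈ Finset.range m, (v : ℂ) ^ k‖ ^ 2 := by fun_prop

lemma truncSymbol_nonneg (n : ℤ) (r : ℝ) : 0 ≤ truncSymbol n r := by
  rw [truncSymbol]
  have : 0 ≤ ∫ v in {v : Circle | r < ‖(1 : ℂ) - v‖},
    ‖∑ k ∈ Finset.range n.natAbs, (v : ℂ) ^ k‖ ^ 2 ∂arc := integral_nonneg fun v => by positivity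
  have := Real.pi_pos
  positivity

lemma truncSymbol_le (n : ℤ) (r : ℝ) : truncSymbol n r ≤ |(n : ℝ)| := by
  have hpi := Real.pi_pos
  have : ∫ v in {v : Circle | r < ‖(1 : ℂ) - v‖},
    ‖∑ k ∈ Finset.range n.natAbs, (v : ℂ) ^ k‖ ^ 2 ∂arc ≤ 2 * π * n.natAbs := by
    rw [← integral_norm_geom_sq]
    exact setIntegral_le_integral (continuous_norm_geom_sq _).integrable_arc
      (Eventually.of_forall fun v => by positivity)
  rw [truncSymbol, div_mul_eq_mul_div, one_mul, div_le_iff₀ (by positivity)]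
  refine this.trans_eq ?_
  rw [Nat.cast_natAbs, Int.cast_abs]; ring

lemma ae_ne_one : ∀ᵐ w : Circle ∂arc, w ≠ 1 := by simp [ae_iff]

lemma norm_one_sub_pos {w : Circle} (hw : w ≠ 1) : 0 < ‖(1 : ℂ) - w‖ :=
  norm_pos_iff.2 (sub_ne_zero.2 fun h => hw (Circle.ext h.symm))

/-- Integrals over `{|1-v| > r}` converge to the full integral. -/
lemma tendsto_setIntegral_trunc {E : Type*} [NormedAddCommGroup E] [NormedSpace ℝ E]
    {f : Circle → E} (hf : Integrable f arc) :
    Tendsto (fun r : ℝ => ∫ v in {v : Circle | r < ‖(1 : ℂ) - v‖}, f v ∂arc) (𝓝[>] 0)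
      (𝓝 (∫ v, f v ∂arc)) := by
  have e : ∀ r : ℝ, ∫ v in {v : Circle | r < ‖(1 : ℂ) - v‖}, f v ∂arc
      = ∫ v, {v : Circle | r < ‖(1 : ℂ) - v‖}.indicator f v ∂arc := fun r =>
    (integral_indicator (measurableSet_trunc 1 r)).symm
  simp only [e]
  refine tendsto_integral_filter_of_dominated_convergence (fun v => ‖f v‖)
    (Eventually.of_forall fun r => hf.aestronglyMeasurable.indicator (measurableSet_trunc 1 r))
    (Eventually.of_forall fun r => Eventually.of_forall fun v => norm_indicator_le_norm_self _ _)
    hf.norm ?_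
  filter_upwards [ae_ne_one] with v hv
  refine tendsto_const_nhds.congr' ?_
  filter_upwards [mem_nhdsWithin_of_mem_nhds (Iio_mem_nhds (norm_one_sub_pos hv))] with r hr
  rw [indicator_of_mem]
  exact hr

lemma tendsto_truncSymbol (n : ℤ) : Tendsto (truncSymbol n) (𝓝[>] 0) (𝓝 |(n : ℝ)|) := by
  have h := (tendsto_setIntegral_trunc (continuous_norm_geom_sq n.natAbs).integrable_arc).const_mul
    (1 / (2 * π))
  rw [integral_norm_geom_sq] at h
  have hpi := Real.pi_pos.ne'
  convert! h using 2
  rw [Nat.cast_natAbs, Int.cast_abs]; field_simp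

lemma integrableOn_trunc {f : Circle → ℂ} (hf : Continuous f) {r : ℝ} (hr : 0 < r) :
    IntegrableOn (fun v : Circle => f v / ‖(1 : ℂ) - v‖ ^ 2) {v : Circle | r < ‖(1 : ℂ) - v‖} arc := by
  obtain ⟨C, hC⟩ := isCompact_univ.exists_bound_of_continuousOn hf.continuousOn
  refine Measure.integrableOn_of_bounded (M := C / r ^ 2) (measure_ne_top _ _) ?_ ?_
  · have : Measurable fun v : Circle => f v / ‖(1 : ℂ) - v‖ ^ 2 :=
      hf.measurable.div (Continuous.measurable (by fun_prop))
    exact this.aestronglyMeasurable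
  · refine (ae_restrict_iff' (measurableSet_trunc 1 r)).2 (Eventually.of_forall fun v hv => ?_)
    have hv' : r < ‖(1 : ℂ) - v‖ := hv
    rw [norm_div, norm_pow, Complex.norm_real, norm_norm]
    have := hC v (mem_univ _)
    have h0 : 0 ≤ C := (norm_nonneg _).trans this
    gcongr

lemma integral_trunc_one_sub_zpow (n : ℤ) {r : ℝ} (hr : 0 < r) :
    ∫ v in {v : Circle | r < ‖(1 : ℂ) - v‖}, (1 - (v : ℂ) ^ n) / (‖(1 : ℂ) - v‖ : ℂ) ^ 2 ∂arc
      = ((π * truncSymbol n r : ℝ) : ℂ) := by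
  set S := {v : Circle | r < ‖(1 : ℂ) - v‖} with hS
  have hSm : MeasurableSet S := measurableSet_trunc 1 r
  set X := ∫ v in S, (1 - (v : ℂ) ^ n) / ‖(1 : ℂ) - v‖ ^ 2 ∂arc with hX
  have hconj : conj X = ∫ v in S, (1 - (v : ℂ) ^ (-n)) / ‖(1 : ℂ) - v‖ ^ 2 ∂arc := by
    rw [hX, ← integral_conj]
    congr 1; funext v
    rw [map_div₀, map_sub, conj_coe_zpow, map_pow, Complex.conj_ofReal, map_one]
  have hinv : X = ∫ v in S, (1 - (v : ℂ) ^ (-n)) / ‖(1 : ℂ) - v‖ ^ 2 ∂arc := by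
    rw [hX, ← integral_indicator hSm, ← integral_indicator hSm,
      ← integral_inv_eq_self _ arc]
    congr 1; funext v
    have hn : ‖(1 : ℂ) - ((v⁻¹ : Circle) : ℂ)‖ = ‖(1 : ℂ) - v‖ := by
      have := norm_one_sub_zpow_natAbs v (-1)
      simpa using this
    by_cases hv : v ∈ S
    · have hv' : v⁻¹ ∈ S := by
        simp only [hS, mem_ofPred_eq, hn]; exact hv
      rw [indicator_of_mem hv, indicator_of_mem hv', hn, Circle.coe_inv, inv_zpow, zpow_neg]
    · have hv' : v⁻¹ ∉ S := by
        simp only [hS, mem_ofPred_eq, hn]; exact hv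
      rw [indicator_of_notMem hv, indicator_of_notMem hv']
  have h2 : X + X = 2 * ((π * truncSymbol n r : ℝ) : ℂ) := by
    nth_rewrite 2 [hinv]
    have hi : ∀ m : ℤ, IntegrableOn (fun v : Circle => (1 - (v : ℂ) ^ m) / (‖(1 : ℂ) - v‖ : ℂ) ^ 2)
        S arc := fun m =>
      integrableOn_trunc (f := fun v => 1 - (v : ℂ) ^ m)
        (continuous_const.sub (continuous_coe_zpow m)) hr
    rw [hX, ← integral_add (hi n) (hi (-n))]
    have hpi : (π : ℂ) ≠ 0 := by exact_mod_cast Real.pi_ne_zero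
    rw [truncSymbol]
    push_cast
    rw [← integral_complex_ofReal]
    have : (2 : ℂ) * (π * (1 / (2 * π) * ∫ v in S,
        ((‖∑ k ∈ Finset.range n.natAbs, (v : ℂ) ^ k‖ ^ 2 : ℝ) : ℂ) ∂arc))
        = ∫ v in S, ((‖∑ k ∈ Finset.range n.natAbs, (v : ℂ) ^ k‖ ^ 2 : ℝ) : ℂ) ∂arc := by
      field_simp
    rw [this]
    refine setIntegral_congr_fun hSm fun v hv => ?_
    have hv' : 0 < ‖(1 : ℂ) - v‖ := hr.trans hv
    have hne : ((‖(1 : ℂ) - v‖ : ℝ) : ℂ) ≠ 0 := by exact_mod_cast hv'.ne'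
    have e1 : ((‖(1 : ℂ) - (v : ℂ) ^ n‖ ^ 2 : ℝ) : ℂ) = 2 - (v : ℂ) ^ n - (v : ℂ) ^ (-n) := by
      push_cast
      rw [← Complex.mul_conj', map_sub, conj_coe_zpow, map_one]
      have : (v : ℂ) ^ n * (v : ℂ) ^ (-n) = 1 := by
        rw [← zpow_add₀ v.coe_ne_zero]; simp
      linear_combination this
    rw [norm_one_sub_zpow_eq, mul_pow] at e1
    rw [← add_div, div_eq_iff (pow_ne_zero 2 hne)]
    push_cast at e1 ⊢
    linear_combination -e1
  linear_combination (1 / 2 : ℂ) * h2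

lemma truncHalfLap_eq (g : Circle → ℝ) (z : Circle) (r : ℝ) :
    truncHalfLap g z r = (1 / π) * ∫ v in {v : Circle | r < ‖(1 : ℂ) - v‖},
      (g z - g (z * v)) / ‖(1 : ℂ) - v‖ ^ 2 ∂arc := by
  rw [truncHalfLap, ← integral_indicator (measurableSet_trunc z r),
    ← integral_arc_mul_left _ z]
  have := integral_indicator (μ := arc) (f := fun v : Circle =>
    (g z - g (z * v)) / ‖(1 : ℂ) - v‖ ^ 2) (measurableSet_trunc 1 r)
  rw [Circle.coe_one] at this
  rw [← this]
  congr 2; funext v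
  have hn : ‖(z : ℂ) - ((z * v : Circle) : ℂ)‖ = ‖(1 : ℂ) - v‖ := by
    rw [Circle.coe_mul, ← mul_one_sub, norm_mul, Circle.norm_coe, one_mul]
  simp only [indicator, mem_ofPred_eq, hn]

/-- The half-Laplacian of a trigonometric series with `Σ |n| |c_n| < ∞`. -/
lemma hasHalfLap_of_hasSum {u : Circle → ℝ} {c : ℤ → ℂ}
    (hc : Summable fun n => ‖c n‖) (hc1 : Summable fun n : ℤ => |(n : ℝ)| * ‖c n‖)
    (hsum : ∀ z : Circle, HasSum (fun n => c n * (z : ℂ) ^ n) (u z)) (z : Circle) {L : ℝ}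
    (hL : HasSum (fun n : ℤ => ((|(n : ℝ)| : ℝ) : ℂ) * c n * (z : ℂ) ^ n) (L : ℂ)) :
    HasHalfLap u z L := by
  have hpi : (π : ℂ) ≠ 0 := by exact_mod_cast Real.pi_ne_zero
  have e : ∀ r : ℝ, 0 < r → ((truncHalfLap u z r : ℝ) : ℂ)
      = ∑' n : ℤ, c n * (z : ℂ) ^ n * truncSymbol n r := by
    intro r hr
    rw [truncHalfLap_eq]
    push_cast
    rw [← integral_complex_ofReal]
    have hF : ∀ n, IntegrableOn (fun v : Circle => c n * (z : ℂ) ^ n *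
        ((1 - (v : ℂ) ^ n) / ‖(1 : ℂ) - v‖ ^ 2)) {v : Circle | r < ‖(1 : ℂ) - v‖} arc := fun n =>
      (integrableOn_trunc (continuous_const.sub (continuous_coe_zpow n)) hr).const_mul _
    have hs := hasSum_integral_of_summable_integral_norm
      (μ := arc.restrict {v : Circle | r < ‖(1 : ℂ) - v‖}) hF ?_
    · have e2 : ∀ v : Circle, (((u z - u (z * v)) / ‖(1 : ℂ) - v‖ ^ 2 : ℝ) : ℂ)
          = ∑' n, c n * (z : ℂ) ^ n * ((1 - (v : ℂ) ^ n) / ‖(1 : ℂ) - v‖ ^ 2) := by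
        intro v
        have h1 := ((hsum z).sub (hsum (z * v))).div_const ((‖(1 : ℂ) - v‖ ^ 2 : ℝ) : ℂ)
        push_cast at h1 ⊢
        rw [← h1.tsum_eq]
        congr 1; funext n
        rw [mul_zpow]; ring
      simp only [e2]
      rw [← hs.tsum_eq, ← tsum_mul_left]
      congr 1; funext n
      rw [integral_const_mul, integral_trunc_one_sub_zpow n hr]
      push_cast; field_simp
    · refine (hc.mul_right (2 / r ^ 2 * (2 * π))).of_nonneg_of_le
        (fun n => integral_nonneg fun v => norm_nonneg _) fun n => ?_
      have hb : ∀ v ∈ {v : Circle | r < ‖(1 : ℂ) - v‖}, ‖c n * (z : ℂ) ^ n *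
          ((1 - (v : ℂ) ^ n) / ‖(1 : ℂ) - v‖ ^ 2)‖ ≤ ‖c n‖ * (2 / r ^ 2) := by
        intro v hv
        have hv' : r < ‖(1 : ℂ) - v‖ := hv
        rw [norm_mul, norm_mul, norm_coe_zpow, mul_one, norm_div, norm_pow, Complex.norm_real,
          norm_norm]
        gcongr
        refine (norm_sub_le _ _).trans ?_
        rw [norm_one, norm_coe_zpow]; norm_num
      calc _ ≤ ∫ v in {v : Circle | r < ‖(1 : ℂ) - v‖}, ‖c n‖ * (2 / r ^ 2) ∂arc :=
            setIntegral_mono_on (hF n).norm (integrable_const _) (measurableSet_trunc 1 r) hb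
        _ ≤ ∫ v, ‖c n‖ * (2 / r ^ 2) ∂arc :=
            setIntegral_le_integral (integrable_const _)
              (Eventually.of_forall fun v => by positivity)
        _ = _ := by rw [integral_arc_const, smul_eq_mul]; ring
  -- dominated convergence in the series, the truncated symbols being bounded by `|n|`
  have hlim : Tendsto (fun r : ℝ => ∑' n : ℤ, c n * (z : ℂ) ^ n * truncSymbol n r) (𝓝[>] 0)
      (𝓝 (∑' n : ℤ, c n * (z : ℂ) ^ n * (|(n : ℝ)| : ℝ))) := by
    refine tendsto_tsum_of_dominated_convergence hc1 (fun n => ?_) (Eventually.of_forall fun r n => ?_)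
    · exact ((Complex.continuous_ofReal.tendsto _).comp (tendsto_truncSymbol n)).const_mul _
    · rw [norm_mul, norm_mul, norm_coe_zpow, mul_one, Complex.norm_real, Real.norm_eq_abs,
        abs_of_nonneg (truncSymbol_nonneg n r), mul_comm]
      gcongr
      exact truncSymbol_le n r
  have hL' : ∑' n : ℤ, c n * (z : ℂ) ^ n * (|(n : ℝ)| : ℝ) = L := by
    rw [← hL.tsum_eq]
    congr 1; funext n; ring
  rw [hL'] at hlim
  have h3 : Tendsto (fun r => ((truncHalfLap u z r : ℝ) : ℂ)) (𝓝[>] 0) (𝓝 (L : ℂ)) := by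
    refine hlim.congr' ?_
    filter_upwards [self_mem_nhdsWithin] with r hr
    exact (e r hr).symm
  have := (Complex.continuous_re.tendsto _).comp h3
  simpa [HasHalfLap, Function.comp_def] using this

/-- A trigonometric series with `Σ |n| |c_n| < ∞` is continuously differentiable. -/
lemma isC_one_of_hasSum {u : Circle → ℝ} {c : ℤ → ℂ}
    (hc : Summable fun n => ‖c n‖) (hc1 : Summable fun n : ℤ => |(n : ℝ)| * ‖c n‖)
    (hsum : ∀ z : Circle, HasSum (fun n => c n * (z : ℂ) ^ n) (u z)) : IsC 1 u := by
  have hterm : ∀ (n : ℤ) (t : ℝ), HasDerivAt (fun t : ℝ => c n * Complex.exp (n * t * Complex.I))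
      (c n * (Complex.exp (n * t * Complex.I) * (n * Complex.I))) t := by
    intro n t
    have h1 : HasDerivAt (fun t : ℝ => (n * t * Complex.I : ℂ)) (n * Complex.I) t := by
      have := ((Complex.ofRealCLM.hasDerivAt (x := t)).const_mul (n : ℂ)).mul_const Complex.I
      simpa using this
    exact h1.cexp.const_mul _
  have hcd : ContDiff ℝ 1 fun t : ℝ => ∑' n : ℤ, c n * Complex.exp (n * t * Complex.I) := by
    refine contDiff_tsum (𝕜 := ℝ) (N := 1)
      (v := fun k n => if k = 0 then ‖c n‖ else |(n : ℝ)| * ‖c n‖) (fun n => ?_) ?_ ?_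
    · exact contDiff_const.mul
        ((contDiff_const.mul Complex.ofRealCLM.contDiff).mul contDiff_const).cexp
    · intro k _
      by_cases hk : k = 0
      · simpa [hk] using hc
      · simpa [hk] using hc1
    · intro k n t hk
      have hk' : k ≤ 1 := by exact_mod_cast hk
      have hne : ‖Complex.exp (n * t * Complex.I)‖ = 1 := by
        have := Complex.norm_exp_ofReal_mul_I (n * t)
        push_cast at this; exact this
      rw [norm_iteratedFDeriv_eq_norm_iteratedDeriv]
      interval_cases k
      · simp [hne]
      · rw [iteratedDeriv_one, (hterm n t).deriv]
        rw [norm_mul, norm_mul, hne, norm_mul, Complex.norm_I, Complex.norm_intCast]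
        simp [mul_comm]
  have hre := Complex.reCLM.contDiff.comp hcd (n := 1)
  rw [IsC]
  convert! hre using 2 with t
  have h := hsum (Circle.exp t)
  have e : ∑' n : ℤ, c n * Complex.exp (n * t * Complex.I) = u (Circle.exp t) := by
    rw [← h.tsum_eq]
    congr 1; funext n
    rw [exp_coe_zpow, Circle.coe_exp]
    push_cast; rfl
  simp [e]

/-- Continuous solutions of the equation on the Fourier side are classical solutions. -/
theorem isSolution_of_rfour {κ u : Circle → ℝ} (hκ : IsC 1 κ) (hu : Continuous u)
    (h : ∀ n : ℤ, ((|(n : ℝ)| : ℝ) : ℂ) * rfour u n = rfour (fun w => κ w * Real.exp (u w) - 1) n) :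
    IsSolution κ u := by
  have hκc := hκ.continuous
  have hgc : Continuous fun w => κ w * Real.exp (u w) - 1 := by fun_prop
  have hs := summable_rfour_of_equation hκ hu h
  have hs1 : Summable fun n : ℤ => |(n : ℝ)| * ‖rfour u n‖ := by
    refine hs.congr fun n => ?_
    rw [← h n, norm_mul, Complex.norm_real, Real.norm_eq_abs, abs_abs]
  have hs0 : Summable fun n : ℤ => ‖rfour u n‖ := by
    refine (hs1.add (hasSum_ite_eq (0 : ℤ) ‖rfour u 0‖).summable).of_nonneg_of_le
      (fun n => norm_nonneg _) fun n => ?_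
    by_cases hn : n = 0
    · subst hn; simp
    · simp only [hn, if_false, add_zero]
      have : (1 : ℝ) ≤ |(n : ℝ)| := by exact_mod_cast Int.one_le_abs hn
      nlinarith [norm_nonneg (rfour u n)]
  have hinv : ∀ z : Circle, HasSum (fun n => (2 * π : ℂ)⁻¹ * rfour u n * (z : ℂ) ^ n) (u z) := fun z =>
    hasSum_fourier_inversion (f := fun w => (u w : ℂ)) (by fun_prop) hs0.of_norm z
  have hc0 : Summable fun n => ‖(2 * π : ℂ)⁻¹ * rfour u n‖ := by
    simp only [norm_mul]; exact hs0.mul_left _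
  have hc1 : Summable fun n : ℤ => |(n : ℝ)| * ‖(2 * π : ℂ)⁻¹ * rfour u n‖ := by
    refine (hs1.mul_left ‖(2 * π : ℂ)⁻¹‖).congr fun n => ?_
    rw [norm_mul]; ring
  refine ⟨isC_one_of_hasSum hc0 hc1 hinv, fun z => hasHalfLap_of_hasSum hc0 hc1 hinv z ?_⟩
  have hg := hasSum_fourier_inversion
    (f := fun w => ((κ w * Real.exp (u w) - 1 : ℝ) : ℂ)) (by fun_prop) hs.of_norm z
  refine hg.congr_fun ?_
  intro n
  have := h n
  simp only [rfour] at this ⊢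
  rw [← this]; ring

/-! ### Möbius maps and the Poisson kernel -/

section

/-- A finite measure on the circle is determined by its moments of nonnegative order. -/
lemma measure_ext_of_moments {μ ν : Measure Circle} [IsFiniteMeasure μ] [IsFiniteMeasure ν]
    (h : ∀ n : ℕ, ∫ w : Circle, (w : ℂ) ^ n ∂μ = ∫ w : Circle, (w : ℂ) ^ n ∂ν) : μ = ν := by
  have hz : ∀ n : ℤ, ∫ w : Circle, (w : ℂ) ^ n ∂μ = ∫ w : Circle, (w : ℂ) ^ n ∂ν := by
    intro n
    rcases Int.natAbs_eq n with hn | hn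
    · rw [hn]; simpa only [zpow_natCast] using h _
    · have e : ∀ w : Circle, (w : ℂ) ^ n = conj ((w : ℂ) ^ n.natAbs) := by
        intro w
        rw [← zpow_natCast, conj_coe_zpow, ← hn]
      simp only [e]
      rw [integral_conj, integral_conj, h]
  have key : ∀ ψ : C(AddCircle (2 * π), ℂ),
      ∫ w, ψ (AddCircle.homeomorphCircle'.symm w) ∂μ = ∫ w, ψ (AddCircle.homeomorphCircle'.symm w) ∂ν := by
    have hint : ∀ (μ : Measure Circle) [IsFiniteMeasure μ] (ψ : C(AddCircle (2 * π), ℂ)),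
        Integrable (fun w => ψ (AddCircle.homeomorphCircle'.symm w)) μ := fun μ _ ψ =>
      (ψ.continuous.comp AddCircle.homeomorphCircle'.symm.continuous).integrable_of_hasCompactSupport
        (HasCompactSupport.of_compactSpace _)
    have hcont : ∀ (μ : Measure Circle) [IsFiniteMeasure μ],
        Continuous fun ψ : C(AddCircle (2 * π), ℂ) =>
          ∫ w, ψ (AddCircle.homeomorphCircle'.symm w) ∂μ := by
      intro μ _
      refine (LipschitzWith.of_dist_le_mul (K := (μ.real univ).toNNReal) fun ψ φ => ?_).continuous
      rw [dist_eq_norm, ← integral_sub (hint μ ψ) (hint μ φ), Real.coe_toNNReal _ (by positivity)]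
      refine (norm_integral_le_of_norm_le_const (Eventually.of_forall fun w => ?_)).trans_eq
        (mul_comm _ _)
      rw [← dist_eq_norm]
      exact ContinuousMap.dist_apply_le_dist _
    -- the functions with equal integrals form a closed subspace, and trigonometric polynomials are dense
    let S : Submodule ℂ C(AddCircle (2 * π), ℂ) :=
      { carrier := {ψ | ∫ w, ψ (AddCircle.homeomorphCircle'.symm w) ∂μ
          = ∫ w, ψ (AddCircle.homeomorphCircle'.symm w) ∂ν}
        add_mem' := fun {ψ φ} hψ hφ => by
          simp only [mem_ofPred_eq] at hψ hφ
          simp only [mem_ofPred_eq, ContinuousMap.add_apply]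
          rw [integral_add (hint μ ψ) (hint μ φ), integral_add (hint ν ψ) (hint ν φ), hψ, hφ]
        zero_mem' := by simp
        smul_mem' := fun c ψ hψ => by
          simp only [mem_ofPred_eq] at hψ
          simp only [mem_ofPred_eq, ContinuousMap.smul_apply, smul_eq_mul]
          rw [integral_const_mul, integral_const_mul, hψ] }
    have hS : (Submodule.span ℂ (range (@fourier (2 * π)))).topologicalClosure ≤ S := by
      refine Submodule.topologicalClosure_minimal _ (Submodule.span_le.2 ?_)
        (isClosed_eq (hcont μ) (hcont ν))
      rintro _ ⟨n, rfl⟩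
      have : ∀ w : Circle, fourier n (AddCircle.homeomorphCircle'.symm w) = (w : ℂ) ^ n := by
        intro w
        rw [fourier_eq_coe_zpow, Homeomorph.apply_symm_apply]
      change ∫ w, fourier n (AddCircle.homeomorphCircle'.symm w) ∂μ
        = ∫ w, fourier n (AddCircle.homeomorphCircle'.symm w) ∂ν
      simp only [this]
      exact hz n
    rw [span_fourier_closure_eq_top] at hS
    exact fun ψ => hS (Submodule.mem_top (x := ψ))
  refine ext_of_forall_integral_eq_of_IsFiniteMeasure fun g => ?_
  have := key ⟨fun t => (g (AddCircle.homeomorphCircle' t) : ℂ), by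
    have := AddCircle.homeomorphCircle'.continuous; fun_prop⟩
  simp only [ContinuousMap.coe_mk, Homeomorph.apply_symm_apply] at this
  rw [integral_complex_ofReal, integral_complex_ofReal] at this
  exact_mod_cast this

/-- The image `(1-δ)ξ` of the origin under `mobius δ ξ`. -/
def ctr (δ : ℝ) (ξ : Circle) : ℂ := (1 - δ) * ξ

lemma norm_ctr {δ : ℝ} (h1 : δ < 1) (ξ : Circle) : ‖ctr δ ξ‖ = 1 - δ := by
  rw [ctr, norm_mul, Circle.norm_coe, mul_one, ← Complex.ofReal_one, ← Complex.ofReal_sub,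
    Complex.norm_real, Real.norm_eq_abs, abs_of_pos (by linarith)]

/-- The Poisson kernel with pole parameter `(1-δ)ξ`; it is `|(f⁻¹)'|` for `f = mobius δ ξ`. -/
def pker (δ : ℝ) (ξ w : Circle) : ℝ := (1 - (1 - δ) ^ 2) / ‖(w : ℂ) - ctr δ ξ‖ ^ 2

variable {δ : ℝ} {ξ : Circle}

lemma le_norm_sub_ctr (h1 : δ < 1) (w : Circle) : δ ≤ ‖(w : ℂ) - ctr δ ξ‖ := by
  have := norm_sub_norm_le (w : ℂ) (ctr δ ξ)
  rw [norm_ctr h1, Circle.norm_coe] at this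
  linarith

lemma norm_sub_ctr_pos (h0 : 0 < δ) (h1 : δ < 1) (w : Circle) : 0 < ‖(w : ℂ) - ctr δ ξ‖ :=
  h0.trans_le (le_norm_sub_ctr h1 w)

lemma one_sub_sq_pos (h0 : 0 < δ) (h1 : δ < 1) : 0 < 1 - (1 - δ) ^ 2 := by nlinarith

lemma pker_pos (h0 : 0 < δ) (h1 : δ < 1) (w : Circle) : 0 < pker δ ξ w :=
  div_pos (one_sub_sq_pos h0 h1) (pow_pos (norm_sub_ctr_pos h0 h1 w) 2)

lemma continuous_pker (h0 : 0 < δ) (h1 : δ < 1) : Continuous (pker δ ξ) :=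
  continuous_const.div (by fun_prop) fun w => (pow_pos (norm_sub_ctr_pos h0 h1 w) 2).ne'

lemma continuous_circle_iff {X : Type*} [TopologicalSpace X] {f : X → Circle} :
    Continuous f ↔ Continuous fun x => (f x : ℂ) :=
  continuous_induced_rng (f := fun z : Circle => (z : ℂ))

lemma continuous_circleMobius (h0 : 0 < δ) (h1 : δ < 1) : Continuous (circleMobius δ ξ) := by
  have : (fun z : Circle => (circleMobius δ ξ z : ℂ)) = fun z : Circle => mobius δ ξ z :=
    funext fun z => coe_circleMobius h0 h1 ξ z
  refine continuous_circle_iff.2 ?_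
  rw [this]
  unfold mobius
  exact Continuous.div (by fun_prop) (by fun_prop) fun z => mobius_denom_ne_zero h0 h1 ξ z

lemma coe_mul_conj (z : Circle) : (z : ℂ) * conj (z : ℂ) = 1 := by
  rw [Complex.mul_conj, Circle.normSq_coe]; simp

lemma circleMobius_neg_circleMobius (h0 : 0 < δ) (h1 : δ < 1) (ξ z : Circle) :
    circleMobius δ (-ξ) (circleMobius δ ξ z) = z := by
  apply Circle.ext
  rw [coe_circleMobius h0 h1, mobius, div_eq_iff (mobius_denom_ne_zero h0 h1 _ _),
    coe_circleMobius h0 h1, mobius, Circle.coe_neg]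
  have hd := mobius_denom_ne_zero h0 h1 ξ z
  have h := coe_mul_conj ξ
  have hm : (z + (1 - δ) * ξ : ℂ) / (1 + (1 - δ) * conj (ξ : ℂ) * z) *
      (1 + (1 - δ) * conj (ξ : ℂ) * z) = z + (1 - δ) * ξ := div_mul_cancel₀ _ hd
  generalize hM : (z + (1 - δ) * ξ : ℂ) / (1 + (1 - δ) * conj (ξ : ℂ) * z) = M at hm ⊢
  rw [map_neg]
  linear_combination hm

lemma circleMobius_circleMobius_neg (h0 : 0 < δ) (h1 : δ < 1) (ξ z : Circle) :
    circleMobius δ ξ (circleMobius δ (-ξ) z) = z := by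
  simpa using circleMobius_neg_circleMobius h0 h1 (-ξ) z

/-- The denominator of the inverse map, in terms of the distance to the pole parameter. -/
lemma inv_denom_eq (w : Circle) :
    (1 + (1 - δ) * conj ((-ξ : Circle) : ℂ) * w : ℂ) = w * conj ((w : ℂ) - ctr δ ξ) := by
  rw [ctr, map_sub, map_mul, map_sub, Complex.conj_ofReal, map_one, Circle.coe_neg, map_neg]
  linear_combination -(coe_mul_conj w)

lemma norm_inv_denom (w : Circle) :
    ‖(1 + (1 - δ) * conj ((-ξ : Circle) : ℂ) * w : ℂ)‖ = ‖(w : ℂ) - ctr δ ξ‖ := by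
  rw [inv_denom_eq, norm_mul, Circle.norm_coe, one_mul, RCLike.norm_conj]

/-- Conformal distortion of chordal distances. -/
lemma norm_sub_inv_mobius (h0 : 0 < δ) (h1 : δ < 1) (z w : Circle) :
    ‖(circleMobius δ (-ξ) z : ℂ) - circleMobius δ (-ξ) w‖ ^ 2
      = pker δ ξ z * pker δ ξ w * ‖(z : ℂ) - w‖ ^ 2 := by
  have hz := mobius_denom_ne_zero h0 h1 (-ξ) z
  have hw := mobius_denom_ne_zero h0 h1 (-ξ) w
  have key : (circleMobius δ (-ξ) z : ℂ) - circleMobius δ (-ξ) w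
      = ((1 - (1 - δ) ^ 2 : ℝ) : ℂ) * (z - w) / ((1 + (1 - δ) * conj ((-ξ : Circle) : ℂ) * z) *
        (1 + (1 - δ) * conj ((-ξ : Circle) : ℂ) * w)) := by
    rw [coe_circleMobius h0 h1, coe_circleMobius h0 h1, mobius, mobius, div_sub_div _ _ hz hw]
    congr 1
    have h := coe_mul_conj ξ
    rw [Circle.coe_neg, map_neg]
    push_cast
    linear_combination (w - z) * (1 - (δ : ℂ)) ^ 2 * h
  have h := one_sub_sq_pos h0 h1
  rw [key, norm_div, norm_mul, norm_mul, norm_inv_denom, norm_inv_denom, Complex.norm_real,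
    Real.norm_eq_abs, abs_of_pos h, pker, pker]
  have hz' := norm_sub_ctr_pos (ξ := ξ) h0 h1 z
  have hw' := norm_sub_ctr_pos (ξ := ξ) h0 h1 w
  field_simp

/-- Points away from `ξ` are mapped close to `-ξ` by the inverse map. -/
lemma norm_inv_mobius_add_le (h0 : 0 < δ) (h1 : δ < 1) (w : Circle) :
    ‖(circleMobius δ (-ξ) w : ℂ) + ξ‖ ≤ 2 * δ / ‖(w : ℂ) - ctr δ ξ‖ := by
  have hw := mobius_denom_ne_zero h0 h1 (-ξ) w
  have key : (circleMobius δ (-ξ) w : ℂ) + ξ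
      = (δ : ℂ) * (w + ξ) / (1 + (1 - δ) * conj ((-ξ : Circle) : ℂ) * w) := by
    rw [coe_circleMobius h0 h1, mobius, div_add' _ _ _ hw]
    congr 1
    have h := coe_mul_conj ξ
    rw [Circle.coe_neg, map_neg]
    linear_combination -(1 - (δ : ℂ)) * w * h
  rw [key, norm_div, norm_inv_denom, norm_mul, Complex.norm_real, Real.norm_eq_abs, abs_of_pos h0,
    mul_comm 2 δ]
  gcongr
  refine (norm_add_le _ _).trans ?_
  rw [Circle.norm_coe, Circle.norm_coe]; norm_num

lemma conj_inv_mobius_mul_pker (h0 : 0 < δ) (h1 : δ < 1) (w : Circle) :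
    conj (circleMobius δ (-ξ) w : ℂ) * pker δ ξ w
      = ((1 - (1 - δ) ^ 2 : ℝ) : ℂ) * (w / ((w : ℂ) - ctr δ ξ) ^ 2) := by
  have hpos := norm_sub_ctr_pos (ξ := ξ) h0 h1 w
  have hne : (w : ℂ) - ctr δ ξ ≠ 0 := norm_pos_iff.1 hpos
  have hne' : conj ((w : ℂ) - ctr δ ξ) ≠ 0 := by
    rw [Ne, map_eq_zero]; exact hne
  have hw := w.coe_ne_zero
  have e1 : (circleMobius δ (-ξ) w : ℂ) = ((w : ℂ) - ctr δ ξ) / (w * conj ((w : ℂ) - ctr δ ξ)) := by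
    rw [coe_circleMobius h0 h1, mobius, inv_denom_eq, Circle.coe_neg, ctr]
    congr 1; ring
  have e2 : ((pker δ ξ w : ℝ) : ℂ) = ((1 - (1 - δ) ^ 2 : ℝ) : ℂ) /
      (((w : ℂ) - ctr δ ξ) * conj ((w : ℂ) - ctr δ ξ)) := by
    rw [Complex.mul_conj', pker]; push_cast; rfl
  have hc : conj (w : ℂ) = (w : ℂ)⁻¹ := by rw [← Circle.coe_inv_eq_conj, Circle.coe_inv]
  rw [e1, e2, map_div₀, map_mul, Complex.conj_conj, hc]
  field_simp

lemma mobius_denom_ne_zero' (h0 : 0 < δ) (h1 : δ < 1) {z : ℂ} (hz : ‖z‖ ≤ 1) :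
    (1 + (1 - δ) * conj (ξ : ℂ) * z : ℂ) ≠ 0 := by
  intro h
  have e : ((1 - δ) * conj (ξ : ℂ) * z : ℂ) = -1 := by linear_combination h
  have e2 := congrArg norm e
  have e3 : (1 - δ : ℂ) = ((1 - δ : ℝ) : ℂ) := by push_cast; ring
  rw [norm_mul, norm_mul, e3, Complex.norm_real, RCLike.norm_conj, Circle.norm_coe,
    norm_neg, norm_one, Real.norm_eq_abs, abs_of_pos (by linarith)] at e2
  nlinarith [norm_nonneg z]

lemma hasDerivAt_mobius (h0 : 0 < δ) (h1 : δ < 1) {z : ℂ} (hz : ‖z‖ ≤ 1) :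
    HasDerivAt (mobius δ ξ) (((1 - (1 - δ) ^ 2 : ℝ) : ℂ) / (1 + (1 - δ) * conj (ξ : ℂ) * z) ^ 2) z := by
  have hd := mobius_denom_ne_zero' (ξ := ξ) h0 h1 hz
  have hn : HasDerivAt (fun z : ℂ => z + (1 - δ) * ξ) 1 z := (hasDerivAt_id z).add_const _
  have hden : HasDerivAt (fun z : ℂ => 1 + (1 - δ) * conj (ξ : ℂ) * z) ((1 - δ) * conj (ξ : ℂ)) z := by
    have := ((hasDerivAt_id z).const_mul ((1 - δ) * conj (ξ : ℂ))).const_add 1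
    simpa using this
  have := hn.div hden hd
  convert! this using 2
  have h := coe_mul_conj ξ
  push_cast
  linear_combination (1 - (δ : ℂ)) ^ 2 * h

/-- The derivative of `mobius δ ξ` on the circle is the reciprocal of the Poisson kernel at the
image point. -/
lemma norm_deriv_mobius (h0 : 0 < δ) (h1 : δ < 1) (z : Circle) :
    ‖deriv (mobius δ ξ) z‖ = (pker δ ξ (circleMobius δ ξ z))⁻¹ := by
  rw [(hasDerivAt_mobius h0 h1 (Circle.norm_coe z).le).deriv, pker, coe_circleMobius h0 h1]
  have hd := mobius_denom_ne_zero h0 h1 ξ z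
  have e : mobius δ ξ z - ctr δ ξ
      = ((1 - (1 - δ) ^ 2 : ℝ) : ℂ) * z / (1 + (1 - δ) * conj (ξ : ℂ) * z) := by
    rw [mobius, ctr, div_sub' hd]
    congr 1
    have h := coe_mul_conj ξ
    push_cast
    linear_combination -(1 - (δ : ℂ)) ^ 2 * z * h
  have h := one_sub_sq_pos h0 h1
  have hd' : 0 < ‖(1 + (1 - δ) * conj (ξ : ℂ) * z : ℂ)‖ := norm_pos_iff.2 hd
  rw [e, norm_div, norm_div, norm_mul, Circle.norm_coe, Complex.norm_real, Real.norm_eq_abs,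
    abs_of_pos h, norm_pow]
  field_simp

/-- The Möbius map pushes arc length forward to the Poisson kernel. -/
lemma map_circleMobius (h0 : 0 < δ) (h1 : δ < 1) :
    arc.map (circleMobius δ ξ) = arc.withDensity fun w => ENNReal.ofReal (pker δ ξ w) := by
  have hc := continuous_circleMobius (ξ := ξ) h0 h1
  have hp := continuous_pker (ξ := ξ) h0 h1
  have hmem : ctr δ ξ ∈ Metric.ball (0 : ℂ) 1 := by
    rw [mem_ball_zero_iff, norm_ctr h1]; linarith
  have : IsFiniteMeasure (arc.withDensity fun w => ENNReal.ofReal (pker δ ξ w)) :=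
    isFiniteMeasure_withDensity_ofReal hp.integrable_arc.2
  refine measure_ext_of_moments fun n => ?_
  rw [integral_map hc.aemeasurable (Continuous.aestronglyMeasurable (by fun_prop)),
    integral_withDensity_eq_integral_toReal_smul (by fun_prop) (by simp)]
  have e1 : ∫ z, (circleMobius δ ξ z : ℂ) ^ n ∂arc = (2 * π : ℝ) • ctr δ ξ ^ n := by
    have h := integral_arc_coe fun z => mobius δ ξ z ^ n
    have hd : DiffContOnCl ℂ (fun z => mobius δ ξ z ^ n) (Metric.ball 0 |1|) := by
      rw [abs_one]
      refine DifferentiableOn.diffContOnCl fun z hz => ?_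
      rw [closure_ball _ one_ne_zero, mem_closedBall_zero_iff] at hz
      exact ((hasDerivAt_mobius h0 h1 hz).differentiableAt.pow n).differentiableWithinAt
    rw [hd.circleAverage] at h
    simp only [coe_circleMobius h0 h1]
    rw [h]
    congr 2
    simp [mobius, ctr]
  have e2 : ∫ w : Circle, (ENNReal.ofReal (pker δ ξ w)).toReal • (w : ℂ) ^ n ∂arc
      = (2 * π : ℝ) • ctr δ ξ ^ n := by
    have hd : DiffContOnCl ℂ (fun z : ℂ => z ^ n) (Metric.ball 0 1) :=
      (differentiable_pow n).diffContOnCl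
    rw [← hd.circleAverage_poissonKernel_smul hmem, ← integral_arc_coe]
    congr 1; funext w
    rw [ENNReal.toReal_ofReal (pker_pos h0 h1 w).le, pker]
    simp only [Pi.smul_apply', poissonKernel, sub_zero]
    rw [norm_ctr h1, Circle.norm_coe, one_pow]
  rw [e1, e2]

/-- Change of variables under a Möbius map. -/
lemma integral_comp_circleMobius {E : Type*} [NormedAddCommGroup E] [NormedSpace ℝ E]
    (h0 : 0 < δ) (h1 : δ < 1) (g : Circle → E) :
    ∫ z, g (circleMobius δ ξ z) ∂arc = ∫ w, pker δ ξ w • g w ∂arc := by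
  let e : Circle ≃ₜ Circle :=
    { toFun := circleMobius δ ξ
      invFun := circleMobius δ (-ξ)
      left_inv := circleMobius_neg_circleMobius h0 h1 ξ
      right_inv := circleMobius_circleMobius_neg h0 h1 ξ
      continuous_toFun := continuous_circleMobius h0 h1
      continuous_invFun := continuous_circleMobius h0 h1 }
  have hp := continuous_pker (ξ := ξ) h0 h1
  have h := e.measurableEmbedding.integral_map (μ := arc) g
  change ∫ y, g y ∂(arc.map (circleMobius δ ξ)) = ∫ z, g (circleMobius δ ξ z) ∂arc at h
  rw [← h, map_circleMobius h0 h1,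
    integral_withDensity_eq_integral_toReal_smul (by fun_prop) (by simp)]
  congr 1; funext w
  rw [ENNReal.toReal_ofReal (pker_pos h0 h1 w).le]

lemma integral_inv_mobius {E : Type*} [NormedAddCommGroup E] [NormedSpace ℝ E]
    (h0 : 0 < δ) (h1 : δ < 1) (ξ : Circle) (g : Circle → E) :
    ∫ z, g z ∂arc = ∫ w, pker δ ξ w • g (circleMobius δ (-ξ) w) ∂arc := by
  rw [← integral_comp_circleMobius h0 h1 fun w => g (circleMobius δ (-ξ) w)]
  simp only [circleMobius_neg_circleMobius h0 h1]

end

/-! ### Boundary behaviour of Cauchy-type integrals -/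

/-- The Cauchy-type integral `∫ g(w) w / (w-a)² dw`; up to the factor `2π` it is the holomorphic
derivative at `a` of the harmonic extension of `g`. -/
def cauchyD (g : Circle → ℝ) (a : ℂ) : ℂ := ∫ w : Circle, (g w : ℂ) * (w / ((w : ℂ) - a) ^ 2) ∂arc

/-- The nontangential approach region of aperture `C` at the boundary point `1`. -/
def stolz (C : ℝ) : Set ℂ := {a | ‖a‖ < 1 ∧ ‖a - 1‖ ≤ C * (1 - ‖a‖)}

lemma sub_ne_zero_of_norm_lt {a : ℂ} (ha : ‖a‖ < 1) (w : Circle) : (w : ℂ) - a ≠ 0 := by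
  intro h
  rw [sub_eq_zero] at h
  rw [← h, Circle.norm_coe] at ha
  exact lt_irrefl _ ha

lemma norm_sub_pos_of_norm_lt {a : ℂ} (ha : ‖a‖ < 1) (w : Circle) : 0 < ‖(w : ℂ) - a‖ :=
  norm_pos_iff.2 (sub_ne_zero_of_norm_lt ha w)

lemma continuous_cauchyKer {a : ℂ} (ha : ‖a‖ < 1) :
    Continuous fun w : Circle => (w : ℂ) / ((w : ℂ) - a) ^ 2 :=
  Continuous.div (by fun_prop) (by fun_prop) fun w => pow_ne_zero 2 (sub_ne_zero_of_norm_lt ha w)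

lemma integral_poisson {a : ℂ} (ha : ‖a‖ < 1) :
    ∫ w : Circle, (1 - ‖a‖ ^ 2) / ‖(w : ℂ) - a‖ ^ 2 ∂arc = 2 * π := by
  have hmem : a ∈ Metric.ball (0 : ℂ) 1 := by rwa [mem_ball_zero_iff]
  have hd : DiffContOnCl ℂ (fun _ : ℂ => (1 : ℂ)) (Metric.ball 0 1) :=
    (differentiable_const _).diffContOnCl
  have h := hd.circleAverage_poissonKernel_smul hmem
  have h2 := integral_arc_coe (poissonKernel 0 a • fun _ : ℂ => (1 : ℂ))
  rw [h] at h2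
  have e : ∀ w : Circle, (poissonKernel 0 a • fun _ : ℂ => (1 : ℂ)) (w : ℂ)
      = (((1 - ‖a‖ ^ 2) / ‖(w : ℂ) - a‖ ^ 2 : ℝ) : ℂ) := by
    intro w
    simp only [poissonKernel, Pi.smul_apply', sub_zero, Circle.norm_coe, one_pow, Complex.real_smul,
      mul_one]
  simp only [e] at h2
  rw [integral_complex_ofReal] at h2
  have h3 : ((∫ w : Circle, (1 - ‖a‖ ^ 2) / ‖(w : ℂ) - a‖ ^ 2 ∂arc : ℝ) : ℂ) = ((2 * π : ℝ) : ℂ) := by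
    rw [h2]; simp
  exact_mod_cast h3

lemma integral_cauchyKer (a : ℂ) :
    ∫ w : Circle, (w : ℂ) / ((w : ℂ) - a) ^ 2 ∂arc = 0 := by
  rw [integral_arc_coe fun z => z / (z - a) ^ 2, Real.circleAverage_eq_circleIntegral one_ne_zero]
  have h : (∮ z in C(0, 1), (z - 0)⁻¹ • (z / (z - a) ^ 2)) = ∮ z in C(0, 1), (z - a) ^ (-2 : ℤ) := by
    refine circleIntegral.integral_congr zero_le_one fun z hz => ?_
    have hz' : z ≠ 0 := by
      rintro rfl; simp at hz
    simp only [sub_zero, smul_eq_mul]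
    rw [zpow_neg, ← mul_div_assoc, inv_mul_cancel₀ hz', one_div]
    norm_cast
  rw [h, circleIntegral.integral_sub_zpow_of_ne (by norm_num)]
  simp

lemma integral_cauchy_one {a : ℂ} (ha : ‖a‖ < 1) :
    ∫ w : Circle, (w : ℂ) / ((w : ℂ) - a) ∂arc = 2 * π := by
  have hmem : a ∈ Metric.ball (0 : ℂ) |1| := by rwa [abs_one, mem_ball_zero_iff]
  have hd : DiffContOnCl ℂ (fun _ : ℂ => (1 : ℂ)) (Metric.ball 0 |1|) :=
    (differentiable_const _).diffContOnCl
  have h := hd.circleAverage_smul_div hmem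
  have h2 := integral_arc_coe fun z : ℂ => z / (z - a)
  rw [h2]
  simp only [sub_zero, smul_eq_mul, mul_one] at h
  rw [h]; simp

/-- The Cauchy-type integral of `Im w = (w - w⁻¹) / (2i)` is constant; this function carries the
first-order behaviour at `1`. -/
lemma cauchyD_im {a : ℂ} (ha : ‖a‖ < 1) (ha0 : a ≠ 0) :
    cauchyD (fun w => (w : ℂ).im) a = -π * Complex.I := by
  have hI := Complex.I_ne_zero
  have hker := integral_cauchyKer a
  have h1 := integral_cauchy_one ha
  have hc := (continuous_cauchyKer ha).integrable_arc
  have hc1 : Continuous fun w : Circle => (w : ℂ) / ((w : ℂ) - a) :=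
    Continuous.div (by fun_prop) (by fun_prop) (sub_ne_zero_of_norm_lt ha)
  have hi1 := hc1.integrable_arc
  have e : ∀ w : Circle, (((w : ℂ).im : ℝ) : ℂ) * (w / ((w : ℂ) - a) ^ 2)
      = (2 * Complex.I)⁻¹ * ((w : ℂ) / ((w : ℂ) - a) + a * ((w : ℂ) / ((w : ℂ) - a) ^ 2)
        - (a⁻¹ * ((w : ℂ) / ((w : ℂ) - a) ^ 2) - a⁻¹ * (a⁻¹ * ((w : ℂ) / ((w : ℂ) - a) - 1)))) := by
    intro w
    have hne := sub_ne_zero_of_norm_lt ha w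
    have hw := w.coe_ne_zero
    have hc : conj (w : ℂ) = (w : ℂ)⁻¹ := by rw [← Circle.coe_inv_eq_conj, Circle.coe_inv]
    rw [Complex.im_eq_sub_conj, hc]
    field_simp
    ring
  rw [cauchyD]
  simp only [e]
  have hs : Integrable (fun w : Circle => (w : ℂ) / ((w : ℂ) - a) - 1) arc :=
    hi1.sub (integrable_const _)
  have j1 : Integrable (fun w : Circle => (w : ℂ) / ((w : ℂ) - a)
      + a * ((w : ℂ) / ((w : ℂ) - a) ^ 2)) arc := hi1.add (hc.const_mul a)
  have j2 : Integrable (fun w : Circle => a⁻¹ * (a⁻¹ * ((w : ℂ) / ((w : ℂ) - a) - 1))) arc :=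
    (hs.const_mul _).const_mul _
  have j3 : Integrable (fun w : Circle => a⁻¹ * ((w : ℂ) / ((w : ℂ) - a) ^ 2)
      - a⁻¹ * (a⁻¹ * ((w : ℂ) / ((w : ℂ) - a) - 1))) arc := (hc.const_mul _).sub j2
  rw [integral_const_mul, integral_sub j1 j3, integral_add hi1 (hc.const_mul a),
    integral_sub (hc.const_mul _) j2, integral_const_mul,
    integral_const_mul, integral_const_mul, integral_const_mul, integral_sub hi1 (integrable_const _),
    hker, h1, integral_arc_const]
  rw [Complex.real_smul]
  push_cast
  field_simp
  rw [Complex.I_sq]; ring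

lemma norm_arg_le (w : Circle) : |Complex.arg w| ≤ π / 2 * ‖(1 : ℂ) - w‖ := by
  have h := two_div_pi_mul_le_norm (Complex.abs_arg_le_pi w)
  rw [Circle.exp_arg] at h
  have hp := Real.pi_pos
  calc |Complex.arg w| = π / 2 * (2 / π * |Complex.arg w|) := by field_simp
    _ ≤ _ := by gcongr

/-- First-order Taylor expansion at the point `1` of the circle. -/
lemma exists_taylor_one {g : Circle → ℝ} (hg : IsC 1 g) {e : ℝ} (he : 0 < e) :
    ∃ r > 0, ∀ w : Circle, ‖(1 : ℂ) - w‖ < r →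
      |g w - g 1 - tder g 1 * (w : ℂ).im| ≤ e * ‖(1 : ℂ) - w‖ := by
  have hp := Real.pi_pos
  have hG : ContDiff ℝ 1 fun t : ℝ => g (Circle.exp t) := by simpa [IsC] using hg
  have hd : HasDerivAt (fun t : ℝ => g (Circle.exp t)) (tder g 1) 0 := by
    have := ((hG.differentiable one_ne_zero) 0).hasDerivAt
    simpa [tder] using this
  have hs : HasDerivAt (fun t : ℝ => tder g 1 * Real.sin t) (tder g 1) 0 := by
    have := (Real.hasDerivAt_sin 0).const_mul (tder g 1)
    simpa using this
  have hr : HasDerivAt (fun t : ℝ => g (Circle.exp t) - tder g 1 * Real.sin t) 0 0 := by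
    have := hd.sub hs
    rwa [sub_self] at this
  have ho := hr.isLittleO
  simp only [sub_zero, smul_eq_mul, mul_zero, Real.sin_zero, Circle.exp_zero] at ho
  have he' : 0 < e / (π / 2) := by positivity
  obtain ⟨r, hr0, hr⟩ := Metric.eventually_nhds_iff.1 (ho.def he')
  refine ⟨r / (π / 2), by positivity, fun w hw => ?_⟩
  have ha := norm_arg_le w
  have h1 : |Complex.arg w| < r := by
    rw [lt_div_iff₀ (by positivity)] at hw
    linarith
  have h2 := hr (y := Complex.arg w) (by simpa using h1)
  rw [Circle.exp_arg] at h2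
  have h3 : Real.sin (Complex.arg w) = (w : ℂ).im := by
    rw [Complex.sin_arg, Circle.norm_coe, div_one]
  rw [h3, Real.norm_eq_abs, Real.norm_eq_abs] at h2
  have e1 : g w - g 1 - tder g 1 * (w : ℂ).im = g w - tder g 1 * (w : ℂ).im - g 1 := by ring
  rw [e1]
  refine h2.trans ?_
  calc e / (π / 2) * |Complex.arg w| ≤ e / (π / 2) * (π / 2 * ‖(1 : ℂ) - w‖) := by gcongr
    _ = _ := by field_simp

/-- The function `Im w` is odd under `w ↦ w⁻¹`, and so does not contribute to the principal value. -/
lemma integral_trunc_im (r : ℝ) :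
    ∫ v in {v : Circle | r < ‖(1 : ℂ) - v‖}, (v : ℂ).im / ‖(1 : ℂ) - v‖ ^ 2 ∂arc = 0 := by
  have hm := measurableSet_trunc 1 r
  rw [Circle.coe_one] at hm
  rw [← integral_indicator hm]
  set f := {v : Circle | r < ‖(1 : ℂ) - v‖}.indicator
    (fun v : Circle => (v : ℂ).im / ‖(1 : ℂ) - v‖ ^ 2) with hf
  have h : ∀ v, f v⁻¹ = -f v := by
    intro v
    have hn : ‖(1 : ℂ) - ((v⁻¹ : Circle) : ℂ)‖ = ‖(1 : ℂ) - v‖ := by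
      have := norm_one_sub_zpow_natAbs v (-1)
      simpa using this
    have him : ((v⁻¹ : Circle) : ℂ).im = -(v : ℂ).im := by
      rw [Circle.coe_inv_eq_conj, Complex.conj_im]
    simp only [hf, indicator, mem_ofPred_eq, hn, him]
    split_ifs <;> ring
  have h2 := integral_inv_eq_self f arc
  simp only [h] at h2
  rw [integral_neg] at h2
  linarith

/-- The identity `w / (w-1)² = -1/|w-1|²` on the circle. -/
lemma div_sub_one_sq {w : Circle} (hw : w ≠ 1) :
    (w : ℂ) / ((w : ℂ) - 1) ^ 2 = -((1 / ‖(1 : ℂ) - w‖ ^ 2 : ℝ) : ℂ) := by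
  have h1 : (w : ℂ) - 1 ≠ 0 := sub_ne_zero.2 fun h => hw (Circle.ext h)
  have h2 : ((‖(1 : ℂ) - w‖ ^ 2 : ℝ) : ℂ) = (1 - w) * (1 - (w : ℂ)⁻¹) := by
    push_cast
    rw [← Complex.mul_conj', map_sub, map_one, ← Circle.coe_inv_eq_conj, Circle.coe_inv]
  have hw0 := w.coe_ne_zero
  have h3 : (1 : ℂ) - w ≠ 0 := by
    rw [← neg_sub]; exact neg_ne_zero.2 h1
  push_cast at h2 ⊢
  rw [h2]
  have h4 : (1 : ℂ) - (w : ℂ)⁻¹ = (w - 1) / w := by field_simp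
  rw [h4]
  field_simp
  ring

/-- Nontangential boundary limits of `cauchyD`: the principal value half-Laplacian and the
tangential derivative appear as real and imaginary parts. After the first-order Taylor polynomial has
been split off, the integral differs from the truncated half-Laplacian at distance `|a - 1|` by an
integral that is small against the Poisson kernel. -/
theorem tendsto_cauchyD {g : Circle → ℝ} (hg : IsC 1 g) {L : ℝ} (hL : HasHalfLap g 1 L) {C : ℝ}
    (hC : 0 ≤ C) :
    Tendsto (cauchyD g) (𝓝[stolz C] 1) (𝓝 (π * (L - tder g 1 * Complex.I))) := by
  have hp := Real.pi_pos
  set ρ : Circle → ℝ := fun w => g w - g 1 - tder g 1 * (w : ℂ).im with hρ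
  have hgc := hg.continuous
  have hρc : Continuous ρ := by
    have : Continuous fun w : Circle => (w : ℂ).im := Complex.continuous_im.comp (by fun_prop)
    fun_prop
  obtain ⟨B, hB⟩ := isCompact_univ.exists_bound_of_continuousOn hρc.continuousOn
  have hB' : ∀ w, |ρ w| ≤ B := fun w => hB w (mem_univ _)
  have hB0 : 0 ≤ B := (abs_nonneg _).trans (hB' 1)
  have hdist : Tendsto (fun a : ℂ => ‖a - 1‖) (𝓝[stolz C] 1) (𝓝[>] 0) := by
    refine tendsto_nhdsWithin_iff.2 ⟨?_, ?_⟩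
    · have : Continuous fun a : ℂ => ‖a - 1‖ := by fun_prop
      have h := (this.tendsto 1).mono_left (nhdsWithin_le_nhds (s := stolz C))
      simpa using h
    · filter_upwards [self_mem_nhdsWithin] with a ha
      refine norm_pos_iff.2 (sub_ne_zero.2 ?_)
      rintro rfl
      have := ha.1
      simp at this
  set J : ℝ → ℝ := fun r => ∫ v in {v : Circle | r < ‖(1 : ℂ) - v‖}, -(ρ v / ‖(1 : ℂ) - v‖ ^ 2) ∂arc
  have hint : ∀ {f : Circle → ℝ}, Continuous f → ∀ {r : ℝ}, 0 < r →
      IntegrableOn (fun v : Circle => f v / ‖(1 : ℂ) - v‖ ^ 2) {v : Circle | r < ‖(1 : ℂ) - v‖} arc := by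
    intro f hf r hr
    have := (integrableOn_trunc (f := fun v => (f v : ℂ)) (by fun_prop) hr).re
    refine this.congr (Eventually.of_forall fun v => ?_)
    have e : ((f v : ℂ) / (‖(1 : ℂ) - v‖ : ℂ) ^ 2) = ((f v / ‖(1 : ℂ) - v‖ ^ 2 : ℝ) : ℂ) := by
      push_cast; rfl
    simp only [e]
    exact Complex.ofReal_re _
  have hJ : ∀ r, 0 < r → J r = π * truncHalfLap g 1 r := by
    intro r hr
    have e1 : ∀ v : Circle, -(ρ v / ‖(1 : ℂ) - v‖ ^ 2)
        = (g 1 - g v) / ‖(1 : ℂ) - v‖ ^ 2 + tder g 1 * ((v : ℂ).im / ‖(1 : ℂ) - v‖ ^ 2) := by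
      intro v; simp only [hρ]; ring
    have him : Continuous fun w : Circle => (w : ℂ).im := Complex.continuous_im.comp (by fun_prop)
    simp only [J, e1]
    rw [integral_add (hint (f := fun v => g 1 - g v) (by fun_prop) hr) ((hint him hr).const_mul _),
      integral_const_mul, integral_trunc_im, truncHalfLap, Circle.coe_one]
    field_simp
    ring
  have hJlim : Tendsto (fun a : ℂ => (J ‖a - 1‖ : ℂ)) (𝓝[stolz C] 1) (𝓝 ((π * L : ℝ) : ℂ)) := by
    refine (Complex.continuous_ofReal.tendsto _).comp ?_
    have h := ((hL.const_mul π).congr' (f₂ := J) ?_).comp hdist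
    · exact h
    · filter_upwards [self_mem_nhdsWithin] with r hr
      exact (hJ r hr).symm
  -- the Cauchy kernel is compared with its boundary value, cut off at distance `d = |a - 1|` from `1`
  have hdiff : Tendsto (fun a : ℂ => cauchyD ρ a - J ‖a - 1‖) (𝓝[stolz C] 1) (𝓝 0) := by
    refine Metric.tendsto_nhds.2 fun e he => ?_
    obtain ⟨r, hr0, hr⟩ := exists_taylor_one hg (e := e / (12 * π * (C + 1))) (by positivity)
    set e' := e / (12 * π * (C + 1))
    have he' : 0 < e' := by positivity
    have hsmall : ∀ᶠ a in 𝓝[stolz C] (1 : ℂ), ‖a - 1‖ < min (r / 2) (e / (4 * (3 * (B / r * (4 / r ^ 2)) * (2 * π) + 1))) :=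
      (tendsto_nhdsWithin_iff.1 hdist).1.eventually (Iio_mem_nhds (by positivity))
    filter_upwards [hsmall, self_mem_nhdsWithin,
      (tendsto_nhdsWithin_iff.1 hdist).2] with a ha hst hpos
    have hd : 0 < ‖a - 1‖ := hpos
    set d := ‖a - 1‖ with hdd
    have ha1 : d < r / 2 := ha.trans_le (min_le_left _ _)
    have ha2 := ha.trans_le (min_le_right _ _)
    have hnorm := hst.1
    set S := {v : Circle | d < ‖(1 : ℂ) - v‖} with hS
    have hm : MeasurableSet S := by
      have := measurableSet_trunc 1 d; rwa [Circle.coe_one] at this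
    have hρi : Integrable (fun w : Circle => (ρ w : ℂ) * (w / ((w : ℂ) - a) ^ 2)) arc :=
      Continuous.integrable_arc ((by fun_prop : Continuous fun w => (ρ w : ℂ)).mul
        (continuous_cauchyKer hnorm))
    have hJi : Integrable (S.indicator fun v : Circle => -(ρ v / ‖(1 : ℂ) - v‖ ^ 2)) arc :=
      (integrable_indicator_iff hm).2 (hint hρc hd).neg
    have hJi' : Integrable (fun v => ((S.indicator (fun v : Circle => -(ρ v / ‖(1 : ℂ) - v‖ ^ 2)) v : ℝ) : ℂ)) arc :=
      hJi.ofReal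
    have hJe : (J d : ℂ) = ∫ v, ((S.indicator (fun v : Circle => -(ρ v / ‖(1 : ℂ) - v‖ ^ 2)) v : ℝ) : ℂ) ∂arc := by
      rw [integral_complex_ofReal, integral_indicator hm]
    have hPi : Integrable (fun w : Circle => (1 - ‖a‖ ^ 2) / ‖(w : ℂ) - a‖ ^ 2) arc :=
      Continuous.integrable_arc (continuous_const.div (by fun_prop)
        fun w => (pow_pos (norm_sub_pos_of_norm_lt hnorm w) 2).ne')
    have hC1 : d ≤ C * (1 - ‖a‖ ^ 2) := by
      refine hst.2.trans ?_
      gcongr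
      nlinarith [norm_nonneg a]
    have hpt : ∀ w : Circle, ‖(ρ w : ℂ) * (w / ((w : ℂ) - a) ^ 2)
        - ((S.indicator (fun v : Circle => -(ρ v / ‖(1 : ℂ) - v‖ ^ 2)) w : ℝ) : ℂ)‖
        ≤ 3 * e' * C * ((1 - ‖a‖ ^ 2) / ‖(w : ℂ) - a‖ ^ 2) + d * (3 * (B / r * (4 / r ^ 2))) := by
      intro w
      by_cases hw1 : w = 1
      · have : ρ w = 0 := by rw [hw1]; simp [hρ]
        have h2 : S.indicator (fun v : Circle => -(ρ v / ‖(1 : ℂ) - v‖ ^ 2)) w = 0 := by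
          simp [indicator, this]
        rw [h2, this]
        simp only [Complex.ofReal_zero, zero_mul, sub_zero, norm_zero]
        have : 0 ≤ 1 - ‖a‖ ^ 2 := by nlinarith [norm_nonneg a]
        positivity
      have hx : 0 < ‖(1 : ℂ) - w‖ := norm_one_sub_pos hw1
      set x := ‖(1 : ℂ) - w‖ with hxx
      have hy : 0 < ‖(w : ℂ) - a‖ := norm_sub_pos_of_norm_lt hnorm w
      set y := ‖(w : ℂ) - a‖ with hyy
      have step1 : ‖(ρ w : ℂ) * (w / ((w : ℂ) - a) ^ 2)
        - ((S.indicator (fun v : Circle => -(ρ v / ‖(1 : ℂ) - v‖ ^ 2)) w : ℝ) : ℂ)‖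
          ≤ 3 * (|ρ w| / x) * (d / y ^ 2) := by
        by_cases hwS : w ∈ S
        · have hxd : d < x := hwS
          rw [indicator_of_mem hwS]
          have e1 : ((-(ρ w / x ^ 2) : ℝ) : ℂ) = (ρ w : ℂ) * (w / ((w : ℂ) - 1) ^ 2) := by
            rw [div_sub_one_sq hw1]; push_cast; ring
          have hne := sub_ne_zero_of_norm_lt hnorm w
          have hne1 : (w : ℂ) - 1 ≠ 0 := sub_ne_zero.2 fun h => hw1 (Circle.ext h)
          have e2 : (ρ w : ℂ) * (w / ((w : ℂ) - a) ^ 2) - (ρ w : ℂ) * (w / ((w : ℂ) - 1) ^ 2)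
              = (ρ w : ℂ) * (w * ((a - 1) * (2 * (w - 1) - (a - 1))) /
                (((w : ℂ) - a) ^ 2 * ((w : ℂ) - 1) ^ 2)) := by
            field_simp
            ring
          rw [e1, e2, norm_mul, Complex.norm_real, Real.norm_eq_abs, norm_div, norm_mul, norm_mul,
            norm_mul, norm_pow, norm_pow, Circle.norm_coe, one_mul, norm_sub_rev (w : ℂ) 1, ← hxx,
            ← hyy, ← hdd]
          have h3 : ‖(2 * (w - 1) - (a - 1) : ℂ)‖ ≤ 3 * x := by
            refine (norm_sub_le _ _).trans ?_
            rw [norm_mul, norm_sub_rev (w : ℂ) 1, ← hxx, ← hdd, Complex.norm_two]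
            linarith
          calc |ρ w| * (d * ‖(2 * (w - 1) - (a - 1) : ℂ)‖ / (y ^ 2 * x ^ 2))
              ≤ |ρ w| * (d * (3 * x) / (y ^ 2 * x ^ 2)) := by gcongr
            _ = _ := by field_simp
        · have hxd : x ≤ d := not_lt.1 hwS
          rw [indicator_of_notMem hwS, Complex.ofReal_zero, sub_zero, norm_mul, Complex.norm_real,
            Real.norm_eq_abs, norm_div, norm_pow, Circle.norm_coe, ← hyy]
          have h3 : 1 ≤ 3 * (d / x) := by
            have : 1 ≤ d / x := (one_le_div hx).2 hxd
            linarith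
          calc |ρ w| * (1 / y ^ 2) ≤ |ρ w| * (1 / y ^ 2) * (3 * (d / x)) :=
                le_mul_of_one_le_right (by positivity) h3
            _ = _ := by field_simp
      refine step1.trans ?_
      have hP0 : 0 ≤ (1 - ‖a‖ ^ 2) / y ^ 2 := by
        have : 0 ≤ 1 - ‖a‖ ^ 2 := by nlinarith [norm_nonneg a]
        positivity
      -- near `1` the Taylor remainder is a small multiple of the distance, and `d` is controlled by
      -- `1 - |a|²`, which produces the Poisson kernel; away from `1` the kernel is bounded and the
      -- factor `d` is small
      rcases lt_or_ge x r with hxr | hxr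
      · have h4 : |ρ w| / x ≤ e' := (div_le_iff₀ hx).2 (hr w hxr)
        calc 3 * (|ρ w| / x) * (d / y ^ 2) ≤ 3 * e' * ((C * (1 - ‖a‖ ^ 2)) / y ^ 2) := by gcongr
          _ = 3 * e' * C * ((1 - ‖a‖ ^ 2) / y ^ 2) := by ring
          _ ≤ _ := le_add_of_nonneg_right (by positivity)
      · have h4 : r / 2 ≤ y := by
          have h5 : x ≤ y + d := by
            have : (1 : ℂ) - w = -((w - a) + (a - 1)) := by ring
            rw [hxx, this, norm_neg]
            exact norm_add_le _ _
          linarith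
        calc 3 * (|ρ w| / x) * (d / y ^ 2) ≤ 3 * (B / r) * (d / (r / 2) ^ 2) := by
              have := hB' w
              gcongr
          _ = d * (3 * (B / r * (4 / r ^ 2))) := by field_simp; ring
          _ ≤ _ := le_add_of_nonneg_left (by positivity)
    rw [dist_zero_right, cauchyD, hJe, ← integral_sub hρi hJi']
    refine (norm_integral_le_of_norm_le ((hPi.const_mul _).add (integrable_const _))
      (Eventually.of_forall hpt)).trans_lt ?_
    simp only [Pi.add_apply]
    rw [integral_add (hPi.const_mul _) (integrable_const _), integral_const_mul,
      integral_poisson hnorm, integral_arc_const, smul_eq_mul]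
    have hA : 3 * e' * C * (2 * π) ≤ e / 2 := by
      have : e' * (12 * π * (C + 1)) = e := div_mul_cancel₀ _ (by positivity)
      nlinarith [mul_pos he' hp]
    have hB2 : 2 * π * (d * (3 * (B / r * (4 / r ^ 2)))) < e / 2 := by
      set K := 3 * (B / r * (4 / r ^ 2)) * (2 * π)
      have hK : 0 ≤ K := by positivity
      rw [lt_div_iff₀ (by positivity)] at ha2
      have : 2 * π * (d * (3 * (B / r * (4 / r ^ 2)))) = d * K := by simp only [K]; ring
      rw [this]
      nlinarith
    linarith
  have heq : ∀ᶠ a in 𝓝[stolz C] (1 : ℂ),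
      cauchyD g a = (cauchyD ρ a - J ‖a - 1‖) + J ‖a - 1‖ + tder g 1 * (-π * Complex.I) := by
    have hne0 : ∀ᶠ a in 𝓝[stolz C] (1 : ℂ), a ≠ 0 :=
      mem_nhdsWithin_of_mem_nhds (isOpen_ne.mem_nhds one_ne_zero)
    filter_upwards [self_mem_nhdsWithin, hne0] with a hst ha0
    have hnorm := hst.1
    have hk := continuous_cauchyKer hnorm
    have i1 : Integrable (fun w : Circle => (ρ w : ℂ) * (w / ((w : ℂ) - a) ^ 2)) arc :=
      Continuous.integrable_arc ((by fun_prop : Continuous fun w => (ρ w : ℂ)).mul hk)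
    have i2 : Integrable (fun w : Circle => (((w : ℂ).im : ℝ) : ℂ) * (w / ((w : ℂ) - a) ^ 2)) arc :=
      Continuous.integrable_arc ((Complex.continuous_ofReal.comp
        (Complex.continuous_im.comp (by fun_prop))).mul hk)
    rw [← cauchyD_im hnorm ha0]
    simp only [cauchyD, sub_add_cancel]
    have e : ∀ w : Circle, (g w : ℂ) * (w / ((w : ℂ) - a) ^ 2)
        = ((ρ w : ℂ) * (w / ((w : ℂ) - a) ^ 2)
          + tder g 1 * ((((w : ℂ).im : ℝ) : ℂ) * (w / ((w : ℂ) - a) ^ 2)))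
          + g 1 * (w / ((w : ℂ) - a) ^ 2) := by
      intro w; simp only [hρ]; push_cast; ring
    simp only [e]
    have i3 : Integrable (fun w : Circle => (ρ w : ℂ) * (w / ((w : ℂ) - a) ^ 2)
        + tder g 1 * ((((w : ℂ).im : ℝ) : ℂ) * (w / ((w : ℂ) - a) ^ 2))) arc :=
      i1.add (i2.const_mul _)
    rw [integral_add i3 (hk.integrable_arc.const_mul _),
      integral_add i1 (i2.const_mul _), integral_const_mul, integral_const_mul,
      integral_cauchyKer a, mul_zero, add_zero]
  have hfin := (hdiff.add hJlim).add_const (tder g 1 * (-π * Complex.I) : ℂ)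
  have hval : (0 : ℂ) + ((π * L : ℝ) : ℂ) + tder g 1 * (-π * Complex.I)
      = π * (L - tder g 1 * Complex.I) := by push_cast; ring
  rw [hval] at hfin
  refine hfin.congr' ?_
  filter_upwards [heq] with a ha
  rw [ha]

/-! ### First-order expansion of Cauchy-type integrals at the boundary -/

lemma tder_exp (g : Circle → ℝ) (θ : ℝ) :
    tder g (Circle.exp θ) = deriv (fun t : ℝ => g (Circle.exp t)) θ := by
  rw [tder]
  have e : (fun t : ℝ => g (Circle.exp θ * Circle.exp t))
      = fun t : ℝ => (fun s : ℝ => g (Circle.exp s)) (θ + t) := by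
    ext t; simp only [Circle.exp_add]
  have h := deriv_comp_const_add (f := fun s : ℝ => g (Circle.exp s)) θ 0
  rw [add_zero] at h
  rw [e, ← h]

lemma IsC.tder {g : Circle → ℝ} (hg : IsC 2 g) : IsC 1 (tder g) := by
  have h2 : ContDiff ℝ (1 + 1) fun t : ℝ => g (Circle.exp t) := by
    rw [one_add_one_eq_two]; simpa [IsC] using hg
  have h1 := (contDiff_succ_iff_deriv.1 h2).2.2
  rw [IsC]
  simp only [tder_exp]
  simpa using h1

lemma IsC.one_of_two {g : Circle → ℝ} (hg : IsC 2 g) : IsC 1 g :=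
  ContDiff.of_le hg (by norm_num)

/-- Integration by parts against the Herglotz kernel. -/
lemma mul_cauchyD_eq {g : Circle → ℝ} (hg : IsC 1 g) {a : ℂ} (ha : ‖a‖ < 1) :
    a * cauchyD g a = (2 * Complex.I)⁻¹ *
      ∫ w : Circle, (tder g w : ℂ) * (((w : ℂ) + a) / ((w : ℂ) - a)) ∂arc := by
  have hI := Complex.I_ne_zero
  have hG : ContDiff ℝ 1 fun t : ℝ => g (Circle.exp t) := by simpa [IsC] using hg
  set φ : ℝ → ℂ := fun t => (Complex.exp (t * Complex.I) + a) / (Complex.exp (t * Complex.I) - a) with hφ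
  set φ' : ℝ → ℂ := fun t => -2 * Complex.I * a *
    (Complex.exp (t * Complex.I) / (Complex.exp (t * Complex.I) - a) ^ 2) with hφ'
  have hne : ∀ t : ℝ, Complex.exp (t * Complex.I) - a ≠ 0 := fun t => by
    have := sub_ne_zero_of_norm_lt ha (Circle.exp t)
    rwa [Circle.coe_exp] at this
  have hexp : ∀ t : ℝ, HasDerivAt (fun t : ℝ => Complex.exp (t * Complex.I))
      (Complex.exp (t * Complex.I) * Complex.I) t := by
    intro t
    have h1 : HasDerivAt (fun t : ℝ => (t * Complex.I : ℂ)) Complex.I t := by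
      have := (Complex.ofRealCLM.hasDerivAt (x := t)).mul_const Complex.I
      simpa using this
    exact h1.cexp
  have hd : ∀ t, HasDerivAt φ (φ' t) t := by
    intro t
    have := ((hexp t).add_const a).div ((hexp t).sub_const a) (hne t)
    convert! this using 1
    simp only [hφ']
    have := hne t
    field_simp
    ring
  have hgd : ∀ t : ℝ, HasDerivAt (fun t : ℝ => (g (Circle.exp t) : ℂ)) (tder g (Circle.exp t) : ℂ) t := by
    intro t
    rw [tder_exp]
    exact ((hG.differentiable one_ne_zero) t).hasDerivAt.ofReal_comp
  have hgd' : Continuous fun t : ℝ => (tder g (Circle.exp t) : ℂ) := by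
    simp only [tder_exp]
    exact Complex.continuous_ofReal.comp (hG.continuous_deriv le_rfl)
  have hφ'c : Continuous φ' := by
    refine continuous_const.mul (Continuous.div (by fun_prop) (by fun_prop) fun t => pow_ne_zero 2 (hne t))
  have key := intervalIntegral.integral_mul_deriv_eq_deriv_mul (a := 0) (b := 2 * π)
    (fun t _ => hd t) (fun t _ => hgd t) (hφ'c.intervalIntegrable _ _) (hgd'.intervalIntegrable _ _)
  have hper : φ (2 * π) = φ 0 := by
    simp only [hφ]
    push_cast
    rw [Complex.exp_two_pi_mul_I]; simp
  have hper2 : g (Circle.exp (2 * π)) = g (Circle.exp 0) := by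
    simp
  have hL : ∫ w : Circle, (tder g w : ℂ) * (((w : ℂ) + a) / ((w : ℂ) - a)) ∂arc
      = ∫ t in (0 : ℝ)..2 * π, φ t * (tder g (Circle.exp t) : ℂ) := by
    rw [integral_arc]
    congr 1; funext t
    rw [Circle.coe_exp, mul_comm]
  have hR : cauchyD g a = (-2 * Complex.I)⁻¹ * a⁻¹ *
      ∫ t in (0 : ℝ)..2 * π, φ' t * (g (Circle.exp t) : ℂ) ∨ a = 0 := by
    by_cases ha0 : a = 0
    · exact Or.inr ha0
    left
    rw [cauchyD, integral_arc, ← intervalIntegral.integral_const_mul]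
    congr 1; funext t
    simp only [hφ', Circle.coe_exp]
    field_simp
  rw [hL, key, hper, hper2]
  rcases hR with hR | hR
  · by_cases ha0 : a = 0
    · subst ha0; simp [hφ']
    rw [hR]
    field_simp
    ring
  · subst hR; simp [hφ']

/-- The derivative of the Cauchy-type integral of `g` is the Cauchy-type integral of its tangential
derivative. -/
lemma hasDerivAt_mul_cauchyD {g : Circle → ℝ} (hg : IsC 1 g) (ht : Continuous (tder g)) {a : ℂ}
    (ha : ‖a‖ < 1) :
    HasDerivAt (fun a => a * cauchyD g a) (-Complex.I * cauchyD (tder g) a) a := by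
  set f : ℂ → ℂ := fun z => (tder g (Circle.exp (Complex.arg z)) : ℂ) with hf
  have hfw : ∀ w : Circle, f w = tder g w := fun w => by
    simp only [hf, Circle.exp_arg]
  have hci : CircleIntegrable f 0 1 := by
    refine Continuous.intervalIntegrable ?_ _ _
    have e : (fun θ => f (circleMap 0 1 θ)) = fun θ => (tder g (Circle.exp θ) : ℂ) := by
      ext θ
      rw [← hfw, Circle.coe_exp]; simp [circleMap]
    rw [e]; fun_prop
  have hmem : a ∈ Metric.ball (0 : ℂ) 1 := by rwa [mem_ball_zero_iff]
  have h := (hasDerivAt_circleAverage_herglotzRieszKernel_smul hci hmem).const_mul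
    (2 * π * (2 * Complex.I)⁻¹ : ℂ)
  have hI := Complex.I_ne_zero
  have e1 : (2 * π * (2 * Complex.I)⁻¹ : ℂ) *
      Real.circleAverage (fun ζ ↦ (2 * ζ / (ζ - a) ^ 2) • f ζ) 0 1 = -Complex.I * cauchyD (tder g) a := by
    have h2 := integral_arc_coe fun ζ ↦ (2 * ζ / (ζ - a) ^ 2) • f ζ
    rw [Complex.real_smul] at h2
    push_cast at h2
    rw [mul_right_comm, ← h2, cauchyD, ← integral_mul_const, ← integral_const_mul]
    congr 1; funext w
    rw [hfw, smul_eq_mul, mul_inv, Complex.inv_I]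
    ring
  rw [e1] at h
  refine h.congr_of_eventuallyEq ?_
  filter_upwards [Metric.isOpen_ball.mem_nhds hmem] with b hb
  rw [mem_ball_zero_iff] at hb
  rw [mul_cauchyD_eq hg hb]
  have h2 := integral_arc_coe fun ζ ↦ herglotzRieszKernel 0 b ζ • f ζ
  rw [Complex.real_smul] at h2
  push_cast at h2
  rw [mul_right_comm, ← h2, mul_comm]
  congr 2; funext w
  rw [hfw, herglotzRieszKernel_def, smul_eq_mul, sub_zero, sub_zero, mul_comm]

lemma convex_stolz (C : ℝ) (hC : 0 ≤ C) : Convex ℝ (stolz C) := by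
  have h1 : Convex ℝ {a : ℂ | ‖a‖ < 1} := by
    have := convex_ball (0 : ℂ) 1
    convert! this using 1
    ext a; simp
  have h2 : ConvexOn ℝ univ fun a : ℂ => ‖a - 1‖ + C * ‖a‖ := by
    refine ConvexOn.add ?_ ((convexOn_norm convex_univ).smul hC)
    have := (convexOn_norm (E := ℂ) convex_univ).translate_left (-1)
    simpa [Function.comp_def, sub_eq_add_neg] using this
  have h3 := h2.convex_le C
  have : stolz C = {a : ℂ | ‖a‖ < 1} ∩ {a : ℂ | a ∈ univ ∧ ‖a - 1‖ + C * ‖a‖ ≤ C} := by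
    ext a
    simp only [stolz, mem_ofPred_eq, mem_inter_iff, mem_univ, true_and]
    constructor <;> rintro ⟨h, h'⟩ <;> exact ⟨h, by linarith⟩
  rw [this]
  exact h1.inter h3

/-- First-order expansion of `cauchyD h` at a boundary point where its limit vanishes: the mean value
inequality on the convex nontangential region, applied to the derivative, which has the boundary value
given by `tendsto_cauchyD` for `tder h`. -/
theorem cauchyD_isLittleO {h : Circle → ℝ} (hh : IsC 2 h) (h_crit : tder h 1 = 0)
    (h_lap : HasHalfLap h 1 0) {A : ℝ} (hA : HasHalfLap (tder h) 1 A) {C : ℝ} (hC : 0 ≤ C) :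
    (fun a : ℂ => cauchyD h a + π * (tder (tder h) 1 + A * Complex.I) * (a - 1))
      =o[𝓝[stolz C] 1] fun a => a - 1 := by
  set κ : ℂ := π * (tder (tder h) 1 + A * Complex.I) with hκ
  have h1 := hh.one_of_two
  have ht := hh.tder
  have hS0 : Tendsto (cauchyD h) (𝓝[stolz C] 1) (𝓝 0) := by
    have := tendsto_cauchyD h1 h_lap hC
    simpa [h_crit] using this
  have hS1 := tendsto_cauchyD ht hA hC
  have haS : Tendsto (fun a : ℂ => a * cauchyD h a + κ * a) (𝓝[stolz C] 1) (𝓝 κ) := by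
    have hid : Tendsto (fun a : ℂ => a) (𝓝[stolz C] 1) (𝓝 1) :=
      tendsto_id.mono_left nhdsWithin_le_nhds
    have := (hid.mul hS0).add (hid.const_mul κ)
    simpa using this
  have hderiv : Tendsto (fun a => -Complex.I * cauchyD (tder h) a + κ) (𝓝[stolz C] 1) (𝓝 0) := by
    have := (hS1.const_mul (-Complex.I)).add_const κ
    have e : -Complex.I * (π * (A - tder (tder h) 1 * Complex.I)) + κ = 0 := by
      rw [hκ]
      linear_combination (π * tder (tder h) 1 : ℂ) * Complex.I_sq
    rwa [e] at this
  have key : (fun a : ℂ => a * cauchyD h a + κ * (a - 1)) =o[𝓝[stolz C] 1] fun a => a - 1 := by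
    refine isLittleO_iff.2 fun c hc => ?_
    have hev := (Metric.tendsto_nhds.1 hderiv c hc)
    obtain ⟨r, hr0, hr⟩ := Metric.mem_nhdsWithin_iff.1 hev
    have hconv : Convex ℝ (Metric.ball (1 : ℂ) r ∩ stolz C) :=
      (convex_ball _ _).inter (convex_stolz C hC)
    have hmem : Metric.ball (1 : ℂ) r ∩ stolz C ∈ 𝓝[stolz C] (1 : ℂ) :=
      inter_mem (mem_nhdsWithin_of_mem_nhds (Metric.ball_mem_nhds _ hr0)) self_mem_nhdsWithin
    filter_upwards [hmem] with a ha
    have hbound : ∀ b ∈ Metric.ball (1 : ℂ) r ∩ stolz C,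
        ‖(a * cauchyD h a + κ * a) - (b * cauchyD h b + κ * b)‖ ≤ c * ‖a - b‖ := by
      intro b hb
      refine hconv.norm_image_sub_le_of_norm_hasDerivWithin_le
        (f := fun a => a * cauchyD h a + κ * a)
        (f' := fun a => -Complex.I * cauchyD (tder h) a + κ) (fun x hx => ?_) (fun x hx => ?_) hb ha
      · have hx1 := hasDerivAt_mul_cauchyD h1 ht.continuous hx.2.1
        have hx2 := (hasDerivAt_id x).const_mul κ
        rw [mul_one] at hx2
        exact (hx1.add hx2).hasDerivWithinAt
      · have := hr hx
        simp only [mem_ofPred_eq, dist_zero_right] at this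
        exact this.le
    have hne : (𝓝[stolz C] (1 : ℂ)).NeBot := by
      have hcl : (1 : ℂ) ∈ closure (stolz C) := by
        have hseg : Tendsto (fun t : ℝ => (1 : ℂ) + t * (a - 1)) (𝓝[>] 0) (𝓝 1) := by
          have hc : Continuous fun t : ℝ => (1 : ℂ) + t * (a - 1) := by fun_prop
          have := (hc.tendsto 0).mono_left (nhdsWithin_le_nhds (s := Ioi 0))
          simpa using this
        refine mem_closure_of_tendsto hseg ?_
        filter_upwards [self_mem_nhdsWithin, mem_nhdsWithin_of_mem_nhds (Iio_mem_nhds zero_lt_one)]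
          with t ht0 ht1
        have ht0' : (0 : ℝ) < t := ht0
        have ht1' : t < 1 := ht1
        have hb : ‖(1 : ℂ) + t * (a - 1)‖ ≤ (1 - t) + t * ‖a‖ := by
          have : (1 : ℂ) + t * (a - 1) = ((1 - t : ℝ) : ℂ) + (t : ℝ) * a := by push_cast; ring
          rw [this]
          refine (norm_add_le _ _).trans ?_
          rw [norm_mul, Complex.norm_real, Complex.norm_real, Real.norm_eq_abs, Real.norm_eq_abs,
            abs_of_pos ht0', abs_of_pos (by linarith)]
        have ha' := ha.2
        refine ⟨by nlinarith [ha'.1], ?_⟩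
        rw [add_sub_cancel_left, norm_mul, Complex.norm_real, Real.norm_eq_abs, abs_of_pos ht0']
        calc t * ‖a - 1‖ ≤ t * (C * (1 - ‖a‖)) := by gcongr; exact ha'.2
          _ = C * (t * (1 - ‖a‖)) := by ring
          _ ≤ C * (1 - ‖(1 : ℂ) + t * (a - 1)‖) := by gcongr; linarith
      exact mem_closure_iff_nhdsWithin_neBot.1 hcl
    have hlim : Tendsto (fun b => ‖(a * cauchyD h a + κ * a) - (b * cauchyD h b + κ * b)‖)
        (𝓝[stolz C] 1) (𝓝 ‖(a * cauchyD h a + κ * a) - κ‖) := (haS.const_sub _).norm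
    have hlim2 : Tendsto (fun b : ℂ => c * ‖a - b‖) (𝓝[stolz C] 1) (𝓝 (c * ‖a - 1‖)) := by
      have hc : Continuous fun b : ℂ => c * ‖a - b‖ := by fun_prop
      exact (hc.tendsto 1).mono_left nhdsWithin_le_nhds
    have := le_of_tendsto_of_tendsto hlim hlim2 (by
      filter_upwards [hmem] with b hb using hbound b hb)
    convert! this using 2
    ring
  have h0 : (fun a : ℂ => cauchyD h a * (1 - a)) =o[𝓝[stolz C] 1] fun a => a - 1 := by
    have h1 : cauchyD h =o[𝓝[stolz C] 1] fun _ => (1 : ℂ) := (isLittleO_one_iff ℂ).2 hS0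
    have h2 : (fun a : ℂ => 1 - a) =O[𝓝[stolz C] 1] fun a => a - 1 :=
      IsBigO.of_bound 1 (Eventually.of_forall fun a => by rw [one_mul, norm_sub_rev])
    simpa using h1.mul_isBigO h2
  refine (key.add h0).congr_left fun a => ?_
  ring

/-! ### The auxiliary fixed-point problem -/

lemma abs_exp_sub_self_sub_le {R : ℝ} (hR : R ≤ 1) {a b : ℝ} (ha : |a| ≤ R) (hb : |b| ≤ R) :
    |(Real.exp a - a) - (Real.exp b - b)| ≤ 2 * R * |a - b| := by
  have hd : ∀ x ∈ Icc (-R) R, HasDerivWithinAt (fun x => Real.exp x - x) (Real.exp x - 1) (Icc (-R) R) x :=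
    fun x _ => ((Real.hasDerivAt_exp x).sub (hasDerivAt_id x)).hasDerivWithinAt
  refine (convex_Icc (-R) R).norm_image_sub_le_of_norm_hasDerivWithin_le hd (fun x hx => ?_)
    (abs_le.1 hb) (abs_le.1 ha)
  have hx' : |x| ≤ R := abs_le.2 hx
  exact (Real.abs_exp_sub_one_le (hx'.trans hR)).trans (by gcongr)

lemma abs_exp_sub_exp_le {a b : ℝ} (ha : |a| ≤ 1) (hb : |b| ≤ 1) :
    |Real.exp a - Real.exp b| ≤ 3 * |a - b| := by
  have h := abs_exp_sub_self_sub_le le_rfl ha hb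
  have : Real.exp a - Real.exp b = ((Real.exp a - a) - (Real.exp b - b)) + (a - b) := by ring
  rw [this]
  refine (abs_add_le _ _).trans (by linarith)

lemma exp_le_three {a : ℝ} (ha : |a| ≤ 1) : Real.exp a ≤ 3 :=
  (Real.exp_le_exp.2 ((le_abs_self a).trans ha)).trans Real.exp_one_lt_three.le

/-- The potential `∫ |K(z/w)| |η(w)| dw` of `|η|` with respect to the resolvent kernel `K`. -/
def potential (η : Circle → ℝ) (z : Circle) : ℝ := conv (fun w => |resolventKer w|) (fun w => |η w|) z

/-- The total mass of the absolute value of the resolvent kernel. -/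
def kerMass : ℝ := ∫ w, |resolventKer w| ∂arc

lemma kerMass_nonneg : 0 ≤ kerMass := integral_nonneg fun _ => abs_nonneg _

lemma abs_conv_le {K g g' : Circle → ℝ} (hK : Integrable K arc)
    (hg' : Continuous g') (h : ∀ w, |g w| ≤ g' w) (z : Circle) :
    |conv K g z| ≤ conv (fun w => |K w|) g' z := by
  refine norm_integral_le_of_norm_le (f := fun w => K (z / w) * g w)
    (integrable_kernel_mul hK.abs hg' z)
    (Eventually.of_forall fun w => ?_)
  rw [norm_mul, Real.norm_eq_abs, Real.norm_eq_abs]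
  exact mul_le_mul_of_nonneg_left (h w) (abs_nonneg _)

lemma conv_const (K : Circle → ℝ) (c : ℝ) (z : Circle) :
    conv K (fun _ => c) z = (∫ w, K w ∂arc) * c := by
  rw [conv, integral_mul_const, integral_kernel]

lemma conv_const_mul (K g : Circle → ℝ) (c : ℝ) (z : Circle) :
    conv K (fun w => c * g w) z = c * conv K g z := by
  simp only [conv]
  rw [← integral_const_mul]
  congr 1; funext w; ring

lemma conv_add {K g g' : Circle → ℝ} (hK : Integrable K arc) (hg : Continuous g)
    (hg' : Continuous g') (z : Circle) :
    conv K (fun w => g w + g' w) z = conv K g z + conv K g' z := by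
  simp only [conv, mul_add]
  exact integral_add (integrable_kernel_mul hK hg z) (integrable_kernel_mul hK hg' z)

lemma conv_sub {K g g' : Circle → ℝ} (hK : Integrable K arc) (hg : Continuous g)
    (hg' : Continuous g') (z : Circle) :
    conv K (fun w => g w - g' w) z = conv K g z - conv K g' z := by
  simp only [conv, mul_sub]
  exact integral_sub (integrable_kernel_mul hK hg z) (integrable_kernel_mul hK hg' z)

/-- A bound on a convolution with the resolvent kernel by the potential of `η` and a constant. -/
lemma abs_conv_resolventKer_le {η g : Circle → ℝ} (hη : Continuous η) {c d : ℝ}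
    (h : ∀ w, |g w| ≤ c * |η w| + d) (z : Circle) :
    |conv resolventKer g z| ≤ c * potential η z + kerMass * d := by
  have hc : Continuous fun w => c * |η w| := by fun_prop
  have hc' : Continuous fun w => c * |η w| + d := by fun_prop
  refine (abs_conv_le integrable_resolventKer hc' h z).trans_eq ?_
  rw [conv_add integrable_resolventKer.abs hc continuous_const, conv_const_mul, conv_const]
  rfl

/-- The nonlinearity `(1+η)e^φ - 1`. -/
def nonlin (η φ : Circle → ℝ) (w : Circle) : ℝ := (1 + η w) * Real.exp (φ w) - 1

lemma continuous_nonlin {η φ : Circle → ℝ} (hη : Continuous η) (hφ : Continuous φ) :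
    Continuous (nonlin η φ) := by
  unfold nonlin; fun_prop

/-- The fixed-point map `φ ↦ K ⋆ ((1+η)e^φ - 1 - φ)` of the auxiliary equation, where `K` is the
resolvent kernel. Its fixed points satisfy `(-Δ)^{1/2} φ = (1+η)e^φ - 1` up to the first harmonics. -/
def auxMap (η φ : C(Circle, ℝ)) : C(Circle, ℝ) :=
  ⟨conv resolventKer fun w => nonlin η φ w - φ w,
    continuous_conv integrable_resolventKer
      ((continuous_nonlin η.continuous φ.continuous).sub φ.continuous)⟩

lemma abs_apply_le_of_norm_le {φ : C(Circle, ℝ)} {R : ℝ} (h : ‖φ‖ ≤ R) (w : Circle) : |φ w| ≤ R :=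
  (φ.norm_coe_le_norm w).trans h

/-- Lipschitz bound for the fixed-point map. The density enters the first factor only through its
potential, which is small for concentrated densities, although their supremum is not. -/
lemma norm_auxMap_sub_le {η η' φ φ' : C(Circle, ℝ)} {R x : ℝ} (hR : R ≤ 1)
    (hφ : ‖φ‖ ≤ R) (hφ' : ‖φ'‖ ≤ R) (hx : ∀ z, potential η z ≤ x) :
    ‖auxMap η φ - auxMap η' φ'‖ ≤
      (3 * x + kerMass * (2 * R)) * ‖φ - φ'‖ + kerMass * (3 * ‖η - η'‖) := by
  have hx0 : 0 ≤ x := (integral_nonneg fun w => by positivity : 0 ≤ potential η 1).trans (hx 1)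
  have hR0 : 0 ≤ R := (norm_nonneg _).trans hφ
  have hk := kerMass_nonneg
  refine (ContinuousMap.norm_le _ (by positivity)).2 fun z => ?_
  have e : (auxMap η φ - auxMap η' φ') z = conv resolventKer
      (fun w => (nonlin η φ w - φ w) - (nonlin η' φ' w - φ' w)) z :=
    (conv_sub integrable_resolventKer
      ((continuous_nonlin η.continuous φ.continuous).sub φ.continuous)
      ((continuous_nonlin η'.continuous φ'.continuous).sub φ'.continuous) z).symm
  rw [e, Real.norm_eq_abs]
  have hb : ∀ w, |(nonlin η φ w - φ w) - (nonlin η' φ' w - φ' w)|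
      ≤ (3 * ‖φ - φ'‖) * |η w| + (2 * R * ‖φ - φ'‖ + 3 * ‖η - η'‖) := by
    intro w
    have h1 := abs_apply_le_of_norm_le hφ w
    have h2 := abs_apply_le_of_norm_le hφ' w
    have h3 : |φ w - φ' w| ≤ ‖φ - φ'‖ := (φ - φ').norm_coe_le_norm w
    have h4 : |η w - η' w| ≤ ‖η - η'‖ := (η - η').norm_coe_le_norm w
    have e2 : (nonlin η φ w - φ w) - (nonlin η' φ' w - φ' w)
        = η w * (Real.exp (φ w) - Real.exp (φ' w)) + ((Real.exp (φ w) - φ w)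
          - (Real.exp (φ' w) - φ' w)) + (η w - η' w) * Real.exp (φ' w) := by
      simp only [nonlin]; ring
    rw [e2]
    refine (abs_add_three _ _ _).trans ?_
    rw [abs_mul, abs_mul, Real.abs_exp]
    have i1 := abs_exp_sub_exp_le (h1.trans hR) (h2.trans hR)
    have i2 := abs_exp_sub_self_sub_le hR h1 h2
    have i3 := exp_le_three (h2.trans hR)
    have j1 : |η w| * |Real.exp (φ w) - Real.exp (φ' w)| ≤ |η w| * (3 * ‖φ - φ'‖) := by
      gcongr; exact i1.trans (by gcongr)
    have j2 : |(Real.exp (φ w) - φ w) - (Real.exp (φ' w) - φ' w)| ≤ 2 * R * ‖φ - φ'‖ :=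
      i2.trans (by gcongr)
    have j3 : |η w - η' w| * Real.exp (φ' w) ≤ ‖η - η'‖ * 3 := by gcongr
    linarith
  refine (abs_conv_resolventKer_le η.continuous hb z).trans ?_
  have := mul_le_mul_of_nonneg_left (hx z) (by positivity : 0 ≤ 3 * ‖φ - φ'‖)
  nlinarith

lemma norm_auxMap_le {η φ : C(Circle, ℝ)} {R x : ℝ} (hR : R ≤ 1)
    (hφ : ‖φ‖ ≤ R) (hx : ∀ z, potential η z ≤ x) :
    ‖auxMap η φ‖ ≤ 3 * x + kerMass * ‖φ‖ ^ 2 := by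
  have hx0 : 0 ≤ x := (integral_nonneg fun w => by positivity : 0 ≤ potential η 1).trans (hx 1)
  have hk := kerMass_nonneg
  refine (ContinuousMap.norm_le _ (by positivity)).2 fun z => ?_
  have hb : ∀ w, |nonlin η φ w - φ w| ≤ 3 * |η w| + ‖φ‖ ^ 2 := by
    intro w
    have h1 := (abs_apply_le_of_norm_le hφ w).trans hR
    have e2 : nonlin η φ w - φ w = η w * Real.exp (φ w) + (Real.exp (φ w) - 1 - φ w) := by
      simp only [nonlin]; ring
    rw [e2]
    refine (abs_add_le _ _).trans ?_
    rw [abs_mul, Real.abs_exp]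
    have i1 := Real.abs_exp_sub_one_sub_id_le h1
    have i2 := exp_le_three h1
    have i3 : φ w ^ 2 ≤ ‖φ‖ ^ 2 := by
      rw [← sq_abs]; exact pow_le_pow_left₀ (abs_nonneg _) (φ.norm_coe_le_norm w) 2
    have i4 := mul_le_mul_of_nonneg_left i2 (abs_nonneg (η w))
    linarith
  refine (abs_conv_resolventKer_le η.continuous hb z).trans ?_
  have := hx z
  linarith

/-- Solution operator of the auxiliary equation `φ = K ⋆ ((1+η)e^φ - 1 - φ)` for densities `η` of
small potential. -/
theorem exists_aux_solution : ∃ x₀ > 0, ∃ S : C(Circle, ℝ) → C(Circle, ℝ),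
    (∀ η : C(Circle, ℝ), (∀ z, potential η z ≤ x₀) → auxMap η (S η) = S η ∧ ‖S η‖ ≤ 1) ∧
    (∀ η : C(Circle, ℝ), ∀ x ≤ x₀, (∀ z, potential η z ≤ x) → ‖S η‖ ≤ 4 * x) ∧
    ContinuousOn S {η | ∀ z, potential η z ≤ x₀} := by
  have hk := kerMass_nonneg
  -- the radius makes the contribution of the quadratic terms a contraction: `kerMass * R ≤ 1 / 8`
  set R : ℝ := (8 * (kerMass + 1))⁻¹ with hRdef
  have hR0 : 0 < R := by positivity
  have hkR : kerMass * R ≤ 1 / 8 := by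
    rw [hRdef, ← div_eq_mul_inv, div_le_iff₀ (by positivity)]; linarith
  have hR8 : R ≤ 1 / 8 := by
    rw [hRdef, inv_le_comm₀ (by positivity) (by norm_num)]; linarith
  have hR1 : R ≤ 1 := by linarith
  have hex : ∀ η : C(Circle, ℝ), ∃ φ : C(Circle, ℝ), (∀ z, potential η z ≤ R / 8) →
      auxMap η φ = φ ∧ ‖φ‖ ≤ R := by
    intro η
    by_cases hη : ∀ z, potential η z ≤ R / 8
    · have hmaps : MapsTo (auxMap η) (Metric.closedBall 0 R) (Metric.closedBall 0 R) := by
        intro φ hφ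
        rw [mem_closedBall_zero_iff] at hφ ⊢
        refine (norm_auxMap_le hR1 hφ hη).trans ?_
        have : kerMass * ‖φ‖ ^ 2 ≤ kerMass * R * R := by
          rw [mul_assoc, ← sq]; gcongr
        nlinarith
      have hcontr : ContractingWith (1 / 2) (hmaps.restrict (auxMap η) _ _) := by
        refine ⟨by rw [← NNReal.coe_lt_coe]; norm_num, LipschitzWith.of_dist_le_mul fun φ φ' => ?_⟩
        rw [Subtype.dist_eq, Subtype.dist_eq, dist_eq_norm, dist_eq_norm]
        have h1 := mem_closedBall_zero_iff.1 φ.2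
        have h2 := mem_closedBall_zero_iff.1 φ'.2
        refine (norm_auxMap_sub_le (η' := η) hR1 h1 h2 hη).trans ?_
        rw [sub_self, norm_zero, mul_zero, mul_zero, add_zero]
        refine mul_le_mul_of_nonneg_right ?_ (norm_nonneg _)
        push_cast
        linarith
      obtain ⟨φ, hφ, hfix, -⟩ := ContractingWith.exists_fixedPoint'
        Metric.isClosed_closedBall.isComplete hmaps hcontr
        (Metric.mem_closedBall_self hR0.le) (edist_ne_top _ _)
      exact ⟨φ, fun _ => ⟨hfix, mem_closedBall_zero_iff.1 hφ⟩⟩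
    · exact ⟨0, fun h => absurd h hη⟩
  choose S hS using hex
  refine ⟨R / 8, by positivity, S, fun η hη => ⟨(hS η hη).1, (hS η hη).2.trans hR1⟩, ?_, ?_⟩
  · intro η x hx hη
    obtain ⟨h1, h2⟩ := hS η fun z => (hη z).trans hx
    have h3 := norm_auxMap_le hR1 h2 hη
    rw [h1] at h3
    have h4 : kerMass * ‖S η‖ ^ 2 ≤ 1 / 8 * ‖S η‖ := by
      rw [sq, ← mul_assoc]
      refine mul_le_mul_of_nonneg_right ?_ (norm_nonneg _)
      exact (mul_le_mul_of_nonneg_left h2 hk).trans hkR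
    have hx0 : 0 ≤ x := (integral_nonneg fun w => by positivity : 0 ≤ potential η 1).trans (hη 1)
    linarith
  · have hlip : LipschitzOnWith (Real.toNNReal (kerMass * 6)) S {η | ∀ z, potential η z ≤ R / 8} := by
      refine LipschitzOnWith.of_dist_le_mul fun η hη η' hη' => ?_
      obtain ⟨h1, h2⟩ := hS η hη
      obtain ⟨h1', h2'⟩ := hS η' hη'
      have h3 := norm_auxMap_sub_le (η' := η') hR1 h2 h2' hη
      rw [h1, h1'] at h3
      rw [dist_eq_norm, dist_eq_norm, Real.coe_toNNReal _ (by positivity)]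
      have : (3 * (R / 8) + kerMass * (2 * R)) * ‖S η - S η'‖ ≤ 1 / 2 * ‖S η - S η'‖ :=
        mul_le_mul_of_nonneg_right (by linarith) (norm_nonneg _)
      linarith
    exact hlip.continuousOn

/-! ### From the auxiliary equation to a solution -/

section

lemma integral_greenKer : ∫ w, greenKer w ∂arc = 0 := by
  have h := rfour_greenKer 0
  simp only [four, neg_zero, zpow_zero, mul_one, Int.cast_zero, abs_zero, inv_zero] at h
  rw [integral_complex_ofReal] at h
  exact_mod_cast h

lemma rfour_zero (g : Circle → ℝ) : rfour g 0 = ((∫ w, g w ∂arc : ℝ) : ℂ) := by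
  simp only [four, neg_zero, zpow_zero, mul_one]
  exact integral_complex_ofReal

lemma rfour_neg (g : Circle → ℝ) (n : ℤ) : rfour g (-n) = conj (rfour g n) := by
  have h := four_conj (fun w => (g w : ℂ)) (-n)
  simp only [Complex.conj_ofReal, neg_neg] at h
  exact h

/-- The half-Laplacian, on the Fourier side, of a solution of the auxiliary equation whose
nonlinearity is orthogonal to the first harmonics. -/
lemma abs_mul_rfour_of_aux {η φ : C(Circle, ℝ)} (hfix : auxMap η φ = φ)
    (horth : rfour (nonlin η φ) 1 = 0) (n : ℤ) :
    ((|(n : ℝ)| : ℝ) : ℂ) * rfour φ n = rfour (nonlin η φ) n := by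
  have hN := continuous_nonlin η.continuous φ.continuous
  have e : rfour φ n = (((|(n : ℝ)| - 1)⁻¹ : ℝ) : ℂ) * (rfour (nonlin η φ) n - rfour φ n) := by
    have h1 : (φ : Circle → ℝ) = conv resolventKer fun w => nonlin η φ w - φ w :=
      (congrArg DFunLike.coe hfix).symm
    have hi : Integrable (fun w => nonlin η φ w - φ w) arc := (hN.sub φ.continuous).integrable_arc
    conv_lhs => rw [h1]
    rw [rfour_conv integrable_resolventKer hi,
      rfour_resolventKer, rfour_sub hN.integrable_arc φ.continuous.integrable_arc]
  by_cases hn : |(n : ℝ)| = 1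
  · rw [hn, sub_self, inv_zero, Complex.ofReal_zero, zero_mul] at e
    rw [e, mul_zero]
    have hn' : n = 1 ∨ n = -1 := by
      have : |n| = 1 := by exact_mod_cast hn
      rcases abs_choice n with h | h <;> omega
    rcases hn' with rfl | rfl
    · exact horth.symm
    · rw [rfour_neg, horth, map_zero]
  · have hne : ((|(n : ℝ)| : ℝ) : ℂ) - 1 ≠ 0 := by
      rw [sub_ne_zero]; exact_mod_cast hn
    rw [Complex.ofReal_inv, Complex.ofReal_sub, Complex.ofReal_one, eq_inv_mul_iff_mul_eq₀ hne] at e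
    linear_combination e

/-- A continuous function with prescribed half-Laplacian is, up to a constant, a Green potential. -/
lemma exists_eq_add_conv_greenKer {f g : Circle → ℝ} (hf : Continuous f) (hg : Continuous g)
    (h : ∀ n : ℤ, ((|(n : ℝ)| : ℝ) : ℂ) * rfour f n = rfour g n) :
    ∃ c, ∀ z, f z = c + conv greenKer g z := by
  have hc := continuous_conv integrable_greenKer hg
  set c : ℝ := (2 * π)⁻¹ * ∫ w, f w ∂arc with hcdef
  have key : (fun w => (f w : ℂ)) = fun w => ((c + conv greenKer g w : ℝ) : ℂ) := by
    refine eq_of_four_eq (by fun_prop) (by fun_prop) fun n => ?_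
    have h2 : rfour (fun w => c + conv greenKer g w) n
        = (if n = 0 then 2 * π * (c : ℂ) else 0) + ((|(n : ℝ)|⁻¹ : ℝ) : ℂ) * rfour g n := by
      rw [rfour_add continuous_const.integrable_arc hc.integrable_arc,
        rfour_conv integrable_greenKer hg.integrable_arc, rfour_greenKer, rfour, four_const]
    refine Eq.trans ?_ h2.symm
    by_cases hn : n = 0
    · subst hn
      rw [if_pos rfl, Int.cast_zero, abs_zero, inv_zero, Complex.ofReal_zero, zero_mul, add_zero]
      refine (rfour_zero f).trans ?_
      rw [hcdef]
      have := Real.pi_ne_zero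
      push_cast
      field_simp
    · have hn' : ((|(n : ℝ)| : ℝ) : ℂ) ≠ 0 := by
        rw [Complex.ofReal_ne_zero, abs_ne_zero]; exact_mod_cast hn
      rw [if_neg hn, zero_add, ← h n, Complex.ofReal_inv, inv_mul_cancel_left₀ hn']
  exact ⟨c, fun z => Complex.ofReal_injective (congrFun key z)⟩

lemma greenKer_div (z w : Circle) : greenKer (z / w) = -(1 / π) * Real.log ‖(z : ℂ) - w‖ := by
  have : (1 : ℂ) - (z / w : Circle) = (w - z) / w := by
    rw [Circle.coe_div]; have := w.coe_ne_zero; field_simp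
  rw [greenKer, this, norm_div, Circle.norm_coe, div_one, norm_sub_rev]

variable {δ : ℝ} {ξ : Circle}

/-- Conformal change of variables in the Green kernel. -/
lemma greenKer_inv_mobius (h0 : 0 < δ) (h1 : δ < 1) {z w : Circle} (hzw : z ≠ w) :
    greenKer (circleMobius δ (-ξ) z / circleMobius δ (-ξ) w)
      = -(1 / (2 * π)) * (Real.log (pker δ ξ z) + Real.log (pker δ ξ w)) + greenKer (z / w) := by
  have h := norm_sub_inv_mobius (ξ := ξ) h0 h1 z w
  have h' := congrArg Real.log h
  have hz := pker_pos (ξ := ξ) h0 h1 z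
  have hw := pker_pos (ξ := ξ) h0 h1 w
  have hn : ‖(z : ℂ) - w‖ ≠ 0 := norm_ne_zero_iff.2 (sub_ne_zero.2 fun h => hzw (Circle.ext h))
  rw [Real.log_pow, Real.log_mul (by positivity) (by positivity), Real.log_mul hz.ne' hw.ne',
    Real.log_pow] at h'
  rw [greenKer_div, greenKer_div]
  push_cast at h'
  have hpi := Real.pi_ne_zero
  field_simp
  linarith

lemma ae_ne (z : Circle) : ∀ᵐ w : Circle ∂arc, z ≠ w := by
  have : ∀ᵐ w : Circle ∂arc, w ≠ z := by simp [ae_iff]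
  filter_upwards [this] with w hw using hw.symm

lemma continuous_log_pker (h0 : 0 < δ) (h1 : δ < 1) : Continuous fun w => Real.log (pker δ ξ w) :=
  (continuous_pker h0 h1).log fun w => (pker_pos h0 h1 w).ne'

/-- Green potentials are conformally covariant, up to a multiple of the logarithm of the conformal
factor and a constant. -/
lemma conv_greenKer_inv_mobius (h0 : 0 < δ) (h1 : δ < 1) {M : Circle → ℝ} (hM : Continuous M)
    (w : Circle) :
    conv greenKer M (circleMobius δ (-ξ) w)
      = -(1 / (2 * π)) * (Real.log (pker δ ξ w) * ∫ z, M z ∂arc)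
        - 1 / (2 * π) * (∫ v, Real.log (pker δ ξ v) * (pker δ ξ v * M (circleMobius δ (-ξ) v)) ∂arc)
        + conv greenKer (fun v => pker δ ξ v * M (circleMobius δ (-ξ) v)) w := by
  have hP := continuous_pker (ξ := ξ) h0 h1
  have hlP := continuous_log_pker (ξ := ξ) h0 h1
  have hF := continuous_circleMobius (ξ := -ξ) h0 h1
  have hg : Continuous fun v => pker δ ξ v * M (circleMobius δ (-ξ) v) := by fun_prop
  set g := fun v => pker δ ξ v * M (circleMobius δ (-ξ) v) with hgdef
  have hgi : ∫ z, M z ∂arc = ∫ v, g v ∂arc := by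
    rw [integral_inv_mobius h0 h1 ξ]; rfl
  rw [hgi]
  simp only [conv]
  rw [integral_inv_mobius h0 h1 ξ]
  have i1 : Integrable (fun v => -(1 / (2 * π)) * Real.log (pker δ ξ w) * g v) arc :=
    hg.integrable_arc.const_mul _
  have i2 : Integrable (fun v => -(1 / (2 * π)) * (Real.log (pker δ ξ v) * g v)) arc :=
    (hlP.mul hg).integrable_arc.const_mul _
  have i12 : Integrable (fun v => -(1 / (2 * π)) * Real.log (pker δ ξ w) * g v
    + -(1 / (2 * π)) * (Real.log (pker δ ξ v) * g v)) arc := i1.add i2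
  have i3 := integrable_kernel_mul integrable_greenKer hg w
  have e : ∫ v, pker δ ξ v • (greenKer (circleMobius δ (-ξ) w / circleMobius δ (-ξ) v)
        * M (circleMobius δ (-ξ) v)) ∂arc
      = ∫ v, (-(1 / (2 * π)) * Real.log (pker δ ξ w) * g v
        + -(1 / (2 * π)) * (Real.log (pker δ ξ v) * g v)) + greenKer (w / v) * g v ∂arc := by
    refine integral_congr_ae ?_
    filter_upwards [ae_ne w] with v hv
    rw [greenKer_inv_mobius h0 h1 hv, smul_eq_mul, hgdef]
    ring
  rw [e, integral_add i12 i3, integral_add i1 i2, integral_const_mul, integral_const_mul]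
  ring

/-- The relative deviation of the coefficient `κ` from `c`, in the frame of the conformal map
`f_{δ,ξ}`. -/
def relPert (κ : Circle → ℝ) (c δ : ℝ) (ξ z : Circle) : ℝ := (κ (circleMobius δ ξ z) - c) / c

/-- The function `u` on the circle with `φ = u ∘ f + log |f'| + log c` for `f = mobius δ ξ`: the
inverse of `f` is `mobius δ (-ξ)`, and the conformal factor of the inverse is the Poisson kernel. -/
def pullBack (c δ : ℝ) (ξ : Circle) (φ : Circle → ℝ) (w : Circle) : ℝ :=
  φ (circleMobius δ (-ξ) w) - Real.log c + Real.log (pker δ ξ w)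

/-- A solution of the auxiliary equation whose nonlinearity is orthogonal to the first harmonics
gives a solution of the original equation. -/
theorem isSolution_pullBack {κ : Circle → ℝ} (hκ : IsC 1 κ) {c : ℝ} (hc : 0 < c) (h0 : 0 < δ)
    (h1 : δ < 1) {η φ : C(Circle, ℝ)} (hη : ∀ z, η z = relPert κ c δ ξ z)
    (hfix : auxMap η φ = φ) (horth : rfour (nonlin η φ) 1 = 0) :
    IsSolution κ (pullBack c δ ξ φ) := by
  have hκc := hκ.continuous
  have hF := continuous_circleMobius (ξ := -ξ) h0 h1
  have hP := continuous_pker (ξ := ξ) h0 h1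
  have hN := continuous_nonlin η.continuous φ.continuous
  have hu : Continuous (pullBack c δ ξ φ) := by
    have := φ.continuous
    have := continuous_log_pker (ξ := ξ) h0 h1
    unfold pullBack; fun_prop
  set u := pullBack c δ ξ φ with hudef
  have hmain := abs_mul_rfour_of_aux hfix horth
  obtain ⟨c₁, hc₁⟩ := exists_eq_add_conv_greenKer φ.continuous hN hmain
  have hM : Continuous fun w => nonlin η φ w + 1 := hN.add continuous_const
  have hpull : ∀ v, pker δ ξ v * (nonlin η φ (circleMobius δ (-ξ) v) + 1) = κ v * Real.exp (u v) := by
    intro v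
    have hPv := pker_pos (ξ := ξ) h0 h1 v
    rw [hudef, pullBack, Real.exp_add, Real.exp_sub, Real.exp_log hc, Real.exp_log hPv, nonlin, hη,
      relPert, circleMobius_circleMobius_neg h0 h1]
    field_simp
    ring
  have hN0 : ∫ w, nonlin η φ w ∂arc = 0 := by
    have := hmain 0
    rw [Int.cast_zero, abs_zero, Complex.ofReal_zero, zero_mul, rfour_zero] at this
    exact_mod_cast this.symm
  have hMint : ∫ w, (nonlin η φ w + 1) ∂arc = 2 * π := by
    rw [integral_add hN.integrable_arc (integrable_const _), hN0, integral_arc_const, zero_add,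
      smul_eq_mul, mul_one]
  have hmass : ∫ v, κ v * Real.exp (u v) ∂arc = 2 * π := by
    rw [← hMint, integral_inv_mobius h0 h1 ξ fun w => nonlin η φ w + 1]
    simp only [smul_eq_mul, hpull]
  have hconv1 : ∀ z, conv greenKer (fun w => nonlin η φ w + 1) z = conv greenKer (nonlin η φ) z := by
    intro z
    rw [conv_add integrable_greenKer hN continuous_const, conv_const, integral_greenKer, zero_mul,
      add_zero]
  have hψc : Continuous fun w => κ w * Real.exp (u w) - 1 := by fun_prop
  have hκu : Continuous fun w => κ w * Real.exp (u w) := by fun_prop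
  obtain ⟨c₂, hc₂⟩ : ∃ c₂, ∀ w, u w = c₂ + conv greenKer (fun w => κ w * Real.exp (u w) - 1) w := by
    refine ⟨c₁ - Real.log c - 1 / (2 * π) *
      (∫ v, Real.log (pker δ ξ v) * (κ v * Real.exp (u v)) ∂arc), fun w => ?_⟩
    have h2 := conv_greenKer_inv_mobius (ξ := ξ) h0 h1 hM w
    simp only [hpull] at h2
    rw [hconv1, hMint] at h2
    rw [conv_sub integrable_greenKer hκu continuous_const, conv_const, integral_greenKer, zero_mul,
      sub_zero]
    conv_lhs => rw [hudef, pullBack, hc₁, h2]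
    have := Real.pi_ne_zero
    field_simp
    ring
  refine isSolution_of_rfour hκ hu fun n => ?_
  by_cases hn : n = 0
  · subst hn
    rw [Int.cast_zero, abs_zero, Complex.ofReal_zero, zero_mul, rfour_zero,
      integral_sub hκu.integrable_arc (integrable_const _), hmass, integral_arc_const, smul_eq_mul,
      mul_one, sub_self, Complex.ofReal_zero]
  · have hn' : ((|(n : ℝ)| : ℝ) : ℂ) ≠ 0 := by
      rw [Complex.ofReal_ne_zero, abs_ne_zero]; exact_mod_cast hn
    have e : rfour u n = ((|(n : ℝ)|⁻¹ : ℝ) : ℂ) * rfour (fun w => κ w * Real.exp (u w) - 1) n := by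
      have hcG := continuous_conv integrable_greenKer hψc
      conv_lhs => rw [funext hc₂]
      rw [rfour_add continuous_const.integrable_arc hcG.integrable_arc,
        rfour_conv integrable_greenKer hψc.integrable_arc, rfour_greenKer, rfour, four_const,
        if_neg hn, zero_add]
    rw [e, Complex.ofReal_inv, mul_inv_cancel_left₀ hn']

/-- The solution, read in the frame of the conformal map. -/
lemma pullBack_circleMobius (h0 : 0 < δ) (h1 : δ < 1) (c : ℝ) (φ : Circle → ℝ) (z : Circle) :
    pullBack c δ ξ φ (circleMobius δ ξ z) + Real.log ‖deriv (mobius δ ξ) (z : ℂ)‖ + Real.log c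
      = φ z := by
  rw [pullBack, norm_deriv_mobius h0 h1, circleMobius_neg_circleMobius h0 h1, Real.log_inv]
  ring

end

/-! ### Concentrated densities -/

/-- A density `η` that is bounded by `C` and concentrates near the point `-ξ` at scale `s⁴`, with a
mean that is smaller than its mass by a factor `s²`. The scale of the conformal map is `δ = s⁴`; with
`s = δ^{1/4}` as the parameter all bounds have integral exponents. -/
structure Concentrated (C s : ℝ) (ξ : Circle) (η : Circle → ℝ) : Prop where
  bdd : ∀ z, |η z| ≤ C
  mass : ∫ z, |η z| ∂arc ≤ C * s ^ 4
  mean : |∫ z, η z ∂arc| ≤ C * s ^ 6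
  moment : ∫ z : Circle, |η z| * √‖(z : ℂ) + ξ‖ ∂arc ≤ C * s ^ 6

lemma Concentrated.const_nonneg {C s : ℝ} {ξ : Circle} {η : Circle → ℝ}
    (h : Concentrated C s ξ η) : 0 ≤ C := (abs_nonneg _).trans (h.bdd 1)

lemma potential_nonneg (η : Circle → ℝ) (z : Circle) : 0 ≤ potential η z :=
  integral_nonneg fun _ => by positivity

/-- The potential is estimated by cutting the logarithmic kernel at height `s⁻¹`. -/
lemma Concentrated.potential_le {C s : ℝ} {ξ : Circle} {η : Circle → ℝ}
    (h : Concentrated C s ξ η) (hη : Continuous η) (hs : 0 < s) (z : Circle) :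
    potential η z ≤ (C + C * ∫ w, |resolventKer w| ^ 4 ∂arc) * s ^ 3 := by
  have hK4 := integrable_abs_resolventKer_pow (m := 4) (by norm_num)
  have i1 : Integrable (fun w => s⁻¹ * |η w|) arc := (hη.abs.integrable_arc).const_mul _
  have i2 : Integrable (fun w => s ^ 3 * C * |resolventKer (z / w)| ^ 4) arc :=
    (integrable_kernel hK4 z).const_mul _
  have hle : potential η z ≤ ∫ w, (s⁻¹ * |η w| + s ^ 3 * C * |resolventKer (z / w)| ^ 4) ∂arc := by
    refine integral_mono (integrable_kernel_mul integrable_resolventKer.abs hη.abs z) (i1.add i2)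
      fun w => ?_
    simp only
    set x := |resolventKer (z / w)| with hx
    have hx0 : 0 ≤ x := abs_nonneg _
    have hxle : x ≤ s⁻¹ + s ^ 3 * x ^ 4 := by
      rcases le_total x s⁻¹ with hxs | hxs
      · have : 0 ≤ s ^ 3 * x ^ 4 := by positivity
        linarith
      · have h1 : 1 ≤ s * x := by
          calc (1 : ℝ) = s * s⁻¹ := (mul_inv_cancel₀ hs.ne').symm
            _ ≤ s * x := by gcongr
        have h3 : 1 ≤ (s * x) ^ 3 := one_le_pow₀ h1
        have : x ≤ s ^ 3 * x ^ 4 := by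
          calc x = 1 * x := (one_mul x).symm
            _ ≤ (s * x) ^ 3 * x := by gcongr
            _ = s ^ 3 * x ^ 4 := by ring
        have : 0 < s⁻¹ := by positivity
        linarith
    calc x * |η w| ≤ (s⁻¹ + s ^ 3 * x ^ 4) * |η w| := by gcongr
      _ = s⁻¹ * |η w| + s ^ 3 * x ^ 4 * |η w| := by ring
      _ ≤ s⁻¹ * |η w| + s ^ 3 * x ^ 4 * C := by gcongr; exact h.bdd w
      _ = _ := by ring
  rw [integral_add i1 i2, integral_const_mul, integral_const_mul,
    integral_kernel (fun w => |resolventKer w| ^ 4) z] at hle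
  have : s⁻¹ * ∫ w, |η w| ∂arc ≤ s⁻¹ * (C * s ^ 4) := by gcongr; exact h.mass
  have e : s⁻¹ * (C * s ^ 4) = C * s ^ 3 := by field_simp
  linarith

lemma norm_zpow_sub_zpow_le (z v : Circle) (n : ℤ) :
    ‖(z : ℂ) ^ n - (v : ℂ) ^ n‖ ≤ 2 * (√|(n : ℝ)| * √‖(z : ℂ) - v‖) := by
  have h2 : ‖(z : ℂ) ^ n - (v : ℂ) ^ n‖ ≤ 2 := by
    refine (norm_sub_le _ _).trans ?_
    rw [norm_coe_zpow, norm_coe_zpow]; norm_num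
  have hn : ‖(z : ℂ) ^ n - (v : ℂ) ^ n‖ ≤ |(n : ℝ)| * ‖(z : ℂ) - v‖ := by
    have e1 : (z : ℂ) ^ n - (v : ℂ) ^ n = -(v : ℂ) ^ n * (1 - ((z / v : Circle) : ℂ) ^ n) := by
      have := zpow_ne_zero n v.coe_ne_zero
      rw [Circle.coe_div, div_zpow]; field_simp; ring
    have e2 : ‖(1 : ℂ) - (z / v : Circle)‖ = ‖(z : ℂ) - v‖ := by
      have : (1 : ℂ) - (z / v : Circle) = (v - z) / v := by
        rw [Circle.coe_div]; have := v.coe_ne_zero; field_simp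
      rw [this, norm_div, Circle.norm_coe, div_one, norm_sub_rev]
    rw [e1, norm_mul, norm_neg, norm_coe_zpow, one_mul, norm_one_sub_zpow_eq, e2, mul_comm]
    refine mul_le_mul_of_nonneg_right ((norm_sum_le _ _).trans ?_) (norm_nonneg _)
    simp only [norm_pow, Circle.norm_coe, one_pow, Finset.sum_const, Finset.card_range, nsmul_eq_mul,
      mul_one]
    rw [Nat.cast_natAbs, Int.cast_abs]
  set y := ‖(z : ℂ) ^ n - (v : ℂ) ^ n‖
  rw [← Real.sqrt_mul (abs_nonneg _)]
  set x := |(n : ℝ)| * ‖(z : ℂ) - v‖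
  have hy : 0 ≤ y := norm_nonneg _
  have hx : 0 ≤ x := by positivity
  have hsq := Real.sq_sqrt hx
  have hs0 := Real.sqrt_nonneg x
  nlinarith [sq_nonneg (y - 2 * √x)]

/-- The geometric mean of the trivial bound by the mass and the bound obtained by comparison with the
mean value, which grows in `n`. -/
lemma Concentrated.norm_rfour_sq_le {C s : ℝ} {ξ : Circle} {η : Circle → ℝ}
    (h : Concentrated C s ξ η) (hη : Continuous η) (n : ℤ) :
    ‖rfour η n‖ ^ 2 ≤ C ^ 2 * s ^ 10 * (1 + 2 * √|(n : ℝ)|) := by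
  have hC := h.const_nonneg
  have hηc : Continuous fun w => (η w : ℂ) := by fun_prop
  have h1 : ‖rfour η n‖ ≤ C * s ^ 4 := by
    refine (norm_four_le n).trans ?_
    simp only [Complex.norm_real, Real.norm_eq_abs]
    exact h.mass
  have h2 : ‖rfour η n‖ ≤ C * s ^ 6 * (1 + 2 * √|(n : ℝ)|) := by
    have e : rfour η n = (((-ξ : Circle) : ℂ) ^ (-n)) * ((∫ z, η z ∂arc : ℝ) : ℂ)
        + ∫ z : Circle, (η z : ℂ) * ((z : ℂ) ^ (-n) - ((-ξ : Circle) : ℂ) ^ (-n)) ∂arc := by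
      have i1 := integrable_mul_zpow hηc.integrable_arc (-n)
      have i2 : Integrable (fun z => (η z : ℂ) * ((-ξ : Circle) : ℂ) ^ (-n)) arc :=
        hηc.integrable_arc.mul_const _
      simp only [mul_sub]
      rw [integral_sub i1 i2, integral_mul_const, integral_complex_ofReal]
      change ∫ z : Circle, (η z : ℂ) * (z : ℂ) ^ (-n) ∂arc = _
      ring
    rw [e]
    refine (norm_add_le _ _).trans ?_
    rw [norm_mul, norm_coe_zpow, one_mul, Complex.norm_real, Real.norm_eq_abs]
    have i3 : Integrable (fun z : Circle => |η z| * √‖(z : ℂ) + ξ‖ * (2 * √|(n : ℝ)|)) arc :=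
      (by fun_prop : Continuous fun z : Circle => |η z| * √‖(z : ℂ) + ξ‖ * (2 * √|(n : ℝ)|)).integrable_arc
    have h3 : ‖∫ z : Circle, (η z : ℂ) * ((z : ℂ) ^ (-n) - ((-ξ : Circle) : ℂ) ^ (-n)) ∂arc‖
        ≤ C * s ^ 6 * (2 * √|(n : ℝ)|) := by
      refine (norm_integral_le_of_norm_le i3 (Eventually.of_forall fun z => ?_)).trans ?_
      · rw [norm_mul, Complex.norm_real, Real.norm_eq_abs, mul_assoc]
        refine mul_le_mul_of_nonneg_left ?_ (abs_nonneg _)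
        refine (norm_zpow_sub_zpow_le z (-ξ) (-n)).trans_eq ?_
        rw [Circle.coe_neg, sub_neg_eq_add, Int.cast_neg, abs_neg]
        ring
      · rw [integral_mul_const]
        exact mul_le_mul_of_nonneg_right h.moment (by positivity)
    have := h.mean
    linarith
  calc ‖rfour η n‖ ^ 2 = ‖rfour η n‖ * ‖rfour η n‖ := sq _
    _ ≤ (C * s ^ 4) * (C * s ^ 6 * (1 + 2 * √|(n : ℝ)|)) := by
        have : 0 ≤ C * s ^ 4 := (norm_nonneg _).trans h1
        gcongr
    _ = _ := by ring

/-- Summable weights dominating the squared symbol of the resolvent against the growth of the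
Fourier coefficients of concentrated densities. -/
def symbolWeight (n : ℤ) : ℝ := 5 * (1 + (n : ℝ) ^ 2)⁻¹ * (1 + 2 * √|(n : ℝ)|)

lemma summable_symbolWeight : Summable symbolWeight := by
  have h1 := summable_inv_one_add_sq.mul_left 5
  have h2 : Summable fun n : ℤ => 10 * ((1 + (n : ℝ) ^ 2)⁻¹ * √|(n : ℝ)|) := by
    refine Summable.mul_left _ ?_
    refine Summable.of_nonneg_of_le (fun n => by positivity) (fun n => ?_)
      (Real.summable_abs_int_rpow (b := 3 / 2) (by norm_num))
    by_cases hn : n = 0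
    · subst hn
      simp only [Int.cast_zero, abs_zero, Real.sqrt_zero, mul_zero]
      positivity
    · have hn' : 0 < |(n : ℝ)| := by rw [abs_pos]; exact_mod_cast hn
      rw [Real.sqrt_eq_rpow, ← sq_abs (n : ℝ)]
      have e : |(n : ℝ)| ^ (-(3 / 2) : ℝ) = (|(n : ℝ)| ^ 2)⁻¹ * |(n : ℝ)| ^ (1 / 2 : ℝ) := by
        rw [← Real.rpow_natCast, ← Real.rpow_neg hn'.le, ← Real.rpow_add hn']
        norm_num
      rw [e]
      gcongr
      linarith
  refine (h1.add h2).congr fun n => ?_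
  rw [symbolWeight]; ring

lemma symbolWeight_nonneg (n : ℤ) : 0 ≤ symbolWeight n := by
  unfold symbolWeight; positivity

lemma tsum_symbolWeight_nonneg : 0 ≤ ∑' n, symbolWeight n := tsum_nonneg symbolWeight_nonneg

/-- The convolution with the resolvent kernel is of size `s⁴` in every Lebesgue space; its square
integral gains another factor `s²` over the expected `s⁸` because the mean of `η` is small. -/
lemma Concentrated.integral_conv_sq_le {C s : ℝ} {ξ : Circle} {η : Circle → ℝ}
    (h : Concentrated C s ξ η) (hη : Continuous η) :
    ∫ z, conv resolventKer η z ^ 2 ∂arc ≤ C ^ 2 * (∑' n, symbolWeight n) * s ^ 10 := by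
  have hs := hasSum_parseval_real (continuous_conv integrable_resolventKer hη)
  have hw := summable_symbolWeight.hasSum.mul_left (C ^ 2 * s ^ 10)
  have hle := hasSum_le (fun n => ?_) hs hw
  · have h0 : 0 ≤ ∫ z, conv resolventKer η z ^ 2 ∂arc := integral_nonneg fun z => sq_nonneg _
    nlinarith [Real.pi_gt_three]
  · rw [rfour_conv integrable_resolventKer hη.integrable_arc, rfour_resolventKer, norm_mul, mul_pow,
      Complex.norm_real, Real.norm_eq_abs, sq_abs, symbolWeight]
    have h1 := sq_inv_abs_sub_one_le n
    have h2 := h.norm_rfour_sq_le hη n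
    calc _ ≤ (5 * (1 + (n : ℝ) ^ 2)⁻¹) * (C ^ 2 * s ^ 10 * (1 + 2 * √|(n : ℝ)|)) := by gcongr
      _ = _ := by ring

lemma Concentrated.abs_integral_mul_conv_smoothKer_le {C s : ℝ} {ξ : Circle} {η : Circle → ℝ}
    (h : Concentrated C s ξ η) (hη : Continuous η) :
    |∫ z, η z * conv smoothKer η z ∂arc| ≤ C ^ 2 * (∑' n, symbolWeight n) * s ^ 10 := by
  have hi := continuous_smoothKer.integrable_arc
  have hc := continuous_conv hi hη
  have hs := hasSum_parseval ⟨fun w => (η w : ℂ), by fun_prop⟩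
    ⟨fun w => (conv smoothKer η w : ℂ), by fun_prop⟩
  have hw := summable_symbolWeight.hasSum.mul_left (C ^ 2 * s ^ 10)
  have hle := hs.norm_le_of_bounded hw fun n => ?_
  · have e : ∫ w, (η w : ℂ) * conj (conv smoothKer η w : ℂ) ∂arc
        = ((∫ z, η z * conv smoothKer η z ∂arc : ℝ) : ℂ) := by
      rw [← integral_complex_ofReal]
      simp only [Complex.conj_ofReal, Complex.ofReal_mul]
    simp only [ContinuousMap.coe_mk] at hle
    rw [e, norm_mul, norm_mul, Complex.norm_real, Complex.norm_real, Real.norm_eq_abs,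
      Real.norm_eq_abs, abs_of_pos Real.pi_pos, Complex.norm_ofNat] at hle
    have h0 := abs_nonneg (∫ z, η z * conv smoothKer η z ∂arc)
    nlinarith [Real.pi_gt_three]
  · simp only [ContinuousMap.coe_mk]
    rw [norm_mul, RCLike.norm_conj]
    have e := rfour_conv hi hη.integrable_arc n
    rw [rfour_smoothKer] at e
    rw [show four (fun w => (conv smoothKer η w : ℂ)) n = _ from e, norm_mul, Complex.norm_real,
      Real.norm_eq_abs, symbolWeight]
    have h1 := abs_resolventCoeff_le n
    have h2 := h.norm_rfour_sq_le hη n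
    calc _ = |resolventCoeff n| * ‖rfour η n‖ ^ 2 := by ring
      _ ≤ (5 * (1 + (n : ℝ) ^ 2)⁻¹) * (C ^ 2 * s ^ 10 * (1 + 2 * √|(n : ℝ)|)) := by gcongr
      _ = _ := by ring

/-! ### Size of the solution of the auxiliary equation -/

section

/-- `φ` solves the auxiliary equation for a density `η` concentrated at scale `δ = s⁴`, and is small.
In the supremum norm it is only of size `s³`, the Green kernel being unbounded. -/
structure AuxSolution (C s : ℝ) (ξ : Circle) (η φ : C(Circle, ℝ)) : Prop where
  conc : Concentrated C s ξ η
  pos : 0 < s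
  le_one : s ≤ 1
  fixed : auxMap η φ = φ
  norm_le_one : ‖φ‖ ≤ 1
  potential_le : ∀ z, potential η z ≤ C * s ^ 3
  norm_le : ‖φ‖ ≤ 4 * (C * s ^ 3)

/-- The part of the solution that is of higher order in `η`. -/
def remainder (η φ : Circle → ℝ) : Circle → ℝ :=
  conv resolventKer fun w => η w * (Real.exp (φ w) - 1) + (Real.exp (φ w) - 1 - φ w)

section

variable {C s : ℝ} {ξ : Circle} {η φ : C(Circle, ℝ)}

lemma AuxSolution.const_nonneg (h : AuxSolution C s ξ η φ) : 0 ≤ C := h.conc.const_nonneg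

lemma AuxSolution.abs_le (h : AuxSolution C s ξ η φ) (w : Circle) : |φ w| ≤ 4 * (C * s ^ 3) :=
  (φ.norm_coe_le_norm w).trans h.norm_le

lemma AuxSolution.abs_le_one (h : AuxSolution C s ξ η φ) (w : Circle) : |φ w| ≤ 1 :=
  (φ.norm_coe_le_norm w).trans h.norm_le_one

lemma AuxSolution.sq_le (h : AuxSolution C s ξ η φ) (w : Circle) : φ w ^ 2 ≤ 16 * C ^ 2 * s ^ 6 := by
  rw [← sq_abs]
  calc |φ w| ^ 2 ≤ (4 * (C * s ^ 3)) ^ 2 := by gcongr; exact h.abs_le w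
    _ = _ := by ring

lemma AuxSolution.eq_add (h : AuxSolution C s ξ η φ) (z : Circle) :
    φ z = conv resolventKer η z + remainder η φ z := by
  have hr : Continuous fun w => η w * (Real.exp (φ w) - 1) + (Real.exp (φ w) - 1 - φ w) := by fun_prop
  rw [remainder, ← conv_add integrable_resolventKer η.continuous hr]
  conv_lhs => rw [← h.fixed]
  change conv resolventKer _ z = _
  congr 1
  funext w
  simp only [nonlin]
  ring

lemma AuxSolution.continuous_remainder : Continuous (remainder η φ) :=
  continuous_conv integrable_resolventKer (by fun_prop)

lemma AuxSolution.abs_remainder_le (h : AuxSolution C s ξ η φ) (z : Circle) :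
    |remainder η φ z| ≤ (8 * C ^ 2 + 16 * kerMass * C ^ 2) * s ^ 6 := by
  have hC := h.const_nonneg
  have hs := h.pos.le
  have hb : ∀ w, |η w * (Real.exp (φ w) - 1) + (Real.exp (φ w) - 1 - φ w)|
      ≤ (8 * (C * s ^ 3)) * |η w| + 16 * C ^ 2 * s ^ 6 := by
    intro w
    have h1 := Real.abs_exp_sub_one_le (h.abs_le_one w)
    have h2 := Real.abs_exp_sub_one_sub_id_le (h.abs_le_one w)
    have h3 := h.abs_le w
    have h4 := h.sq_le w
    refine (abs_add_le _ _).trans (add_le_add ?_ (h2.trans h4))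
    rw [abs_mul, mul_comm]
    exact mul_le_mul_of_nonneg_right (by linarith) (abs_nonneg _)
  refine (abs_conv_resolventKer_le η.continuous hb z).trans ?_
  have := mul_le_mul_of_nonneg_left (h.potential_le z) (by positivity : 0 ≤ 8 * (C * s ^ 3))
  calc _ ≤ 8 * (C * s ^ 3) * (C * s ^ 3) + kerMass * (16 * C ^ 2 * s ^ 6) := by linarith
    _ = _ := by ring

lemma AuxSolution.abs_le_potential (h : AuxSolution C s ξ η φ) (z : Circle) :
    |φ z| ≤ potential η z + (8 * C ^ 2 + 16 * kerMass * C ^ 2) * s ^ 6 := by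
  have h1 : |conv resolventKer η z| ≤ 1 * potential η z + kerMass * 0 :=
    abs_conv_resolventKer_le η.continuous (fun w => by linarith) z
  have h2 := h.abs_remainder_le z
  have h3 := h.eq_add z
  rw [h3]
  refine (abs_add_le _ _).trans (by linarith)

lemma AuxSolution.integral_sq_le (h : AuxSolution C s ξ η φ) :
    ∫ z, φ z ^ 2 ∂arc ≤ (2 * (C ^ 2 * ∑' n, symbolWeight n)
      + 4 * π * (8 * C ^ 2 + 16 * kerMass * C ^ 2) ^ 2) * s ^ 10 := by
  set D := 8 * C ^ 2 + 16 * kerMass * C ^ 2 with hD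
  have hs := h.pos.le
  have hc := continuous_conv integrable_resolventKer η.continuous
  have i1 : Integrable (fun z => 2 * conv resolventKer η z ^ 2) arc :=
    (by fun_prop : Continuous fun z => 2 * conv resolventKer η z ^ 2).integrable_arc
  have i2 : Integrable (fun _ : Circle => 2 * (D * s ^ 6) ^ 2) arc := integrable_const _
  have hle : ∫ z, φ z ^ 2 ∂arc ≤ ∫ z, (2 * conv resolventKer η z ^ 2 + 2 * (D * s ^ 6) ^ 2) ∂arc := by
    refine integral_mono (by fun_prop : Continuous fun z => φ z ^ 2).integrable_arc (i1.add i2)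
      fun z => ?_
    have h1 := h.abs_remainder_le z
    have h2 : remainder η φ z ^ 2 ≤ (D * s ^ 6) ^ 2 := by
      rw [← sq_abs]; gcongr
    simp only
    rw [h.eq_add z]
    nlinarith [sq_nonneg (conv resolventKer η z - remainder η φ z)]
  rw [integral_add i1 i2, integral_const_mul, integral_arc_const, smul_eq_mul] at hle
  have h3 := h.conc.integral_conv_sq_le η.continuous
  have h4 : s ^ 12 ≤ s ^ 10 := pow_le_pow_of_le_one hs h.le_one (by norm_num)
  have h5 : 2 * π * (2 * (D * s ^ 6) ^ 2) ≤ 4 * π * D ^ 2 * s ^ 10 := by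
    calc 2 * π * (2 * (D * s ^ 6) ^ 2) = 4 * π * D ^ 2 * s ^ 12 := by ring
      _ ≤ _ := by gcongr
  linarith

/-- To leading order, pairing `φ` with the density gives the Green energy of the density. -/
lemma AuxSolution.abs_integral_mul_sub_le (h : AuxSolution C s ξ η φ) :
    |∫ z, η z * φ z ∂arc - ∫ z, η z * conv greenKer η z ∂arc| ≤
      (C ^ 2 * (∑' n, symbolWeight n) + C * (8 * C ^ 2 + 16 * kerMass * C ^ 2)) * s ^ 10 := by
  set D := 8 * C ^ 2 + 16 * kerMass * C ^ 2 with hD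
  have hk := kerMass_nonneg
  have hD0 : 0 ≤ D := by positivity
  have hG := continuous_conv integrable_greenKer η.continuous
  have hb := continuous_conv continuous_smoothKer.integrable_arc η.continuous
  have hr := AuxSolution.continuous_remainder (η := η) (φ := φ)
  have e0 : ∀ z, conv resolventKer η z = conv greenKer η z + conv smoothKer η z := by
    intro z
    simp only [conv]
    rw [← integral_add (integrable_kernel_mul integrable_greenKer η.continuous z)
      (integrable_kernel_mul continuous_smoothKer.integrable_arc η.continuous z)]
    congr 1; funext w; rw [resolventKer]; ring
  have iφ : Integrable (fun z => η z * φ z) arc :=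
    (by fun_prop : Continuous fun z => η z * φ z).integrable_arc
  have iG : Integrable (fun z => η z * conv greenKer η z) arc :=
    (by fun_prop : Continuous fun z => η z * conv greenKer η z).integrable_arc
  have ib : Integrable (fun z => η z * conv smoothKer η z) arc :=
    (by fun_prop : Continuous fun z => η z * conv smoothKer η z).integrable_arc
  have ir : Integrable (fun z => η z * remainder η φ z) arc :=
    (by fun_prop : Continuous fun z => η z * remainder η φ z).integrable_arc
  have e : ∫ z, η z * φ z ∂arc - ∫ z, η z * conv greenKer η z ∂arc
      = ∫ z, η z * conv smoothKer η z ∂arc + ∫ z, η z * remainder η φ z ∂arc := by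
    rw [← integral_sub iφ iG, ← integral_add ib ir]
    congr 1; funext z
    rw [h.eq_add z, e0]; ring
  rw [e]
  refine (abs_add_le _ _).trans ?_
  have h1 := h.conc.abs_integral_mul_conv_smoothKer_le η.continuous
  have h2 : |∫ z, η z * remainder η φ z ∂arc| ≤ C * s ^ 4 * (D * s ^ 6) := by
    have i4 : Integrable (fun z => |η z| * (D * s ^ 6)) arc :=
      (by fun_prop : Continuous fun z => |η z| * (D * s ^ 6)).integrable_arc
    refine (norm_integral_le_of_norm_le (f := fun z => η z * remainder η φ z) i4 (Eventually.of_forall fun z => ?_)).trans ?_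
    · rw [norm_mul, Real.norm_eq_abs, Real.norm_eq_abs]
      exact mul_le_mul_of_nonneg_left (h.abs_remainder_le z) (abs_nonneg _)
    · rw [integral_mul_const]
      exact mul_le_mul_of_nonneg_right h.conc.mass (by have := h.pos; positivity)
  calc _ ≤ C ^ 2 * (∑' n, symbolWeight n) * s ^ 10 + C * s ^ 4 * (D * s ^ 6) := add_le_add h1 h2
    _ = _ := by ring

lemma norm_add_le_two_sqrt (z ξ : Circle) : ‖(z : ℂ) + ξ‖ ≤ 2 * √‖(z : ℂ) + ξ‖ := by
  have h2 : ‖(z : ℂ) + ξ‖ ≤ 2 := by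
    refine (norm_add_le _ _).trans ?_
    rw [Circle.norm_coe, Circle.norm_coe]; norm_num
  have h0 := norm_nonneg ((z : ℂ) + ξ)
  have hs := Real.sq_sqrt h0
  have hs0 := Real.sqrt_nonneg ‖(z : ℂ) + ξ‖
  nlinarith

/-- Expansion of the first harmonic of the nonlinearity up to second order in the density. The density
is concentrated at `-ξ`, where the first harmonic is `-conj ξ`; this is how the Green energy enters. -/
lemma exists_norm_rfour_nonlin_sub_le (C : ℝ) : ∃ C' : ℝ, ∀ (s : ℝ) (ξ : Circle) (η φ : C(Circle, ℝ)),
    AuxSolution C s ξ η φ →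
    ‖rfour (nonlin η φ) 1 - rfour η 1
      + conj (ξ : ℂ) * ((∫ z, η z * conv greenKer η z ∂arc : ℝ) : ℂ)‖ ≤ C' * s ^ 9 := by
  set T := ∑' n, symbolWeight n with hT
  set D := 8 * C ^ 2 + 16 * kerMass * C ^ 2 with hD
  set C₂ := 2 * (C ^ 2 * T) + 4 * π * D ^ 2 with hC₂
  refine ⟨16 * C ^ 3 + C₂ + 8 * C ^ 2 + (C ^ 2 * T + C * D), fun s ξ η φ h => ?_⟩
  have hC := h.const_nonneg
  have hs := h.pos.le
  have hk := kerMass_nonneg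
  have hT0 : 0 ≤ T := tsum_symbolWeight_nonneg
  have hD0 : 0 ≤ D := by positivity
  have hC₂0 : 0 ≤ C₂ := by positivity
  have hs10 : s ^ 10 ≤ s ^ 9 := pow_le_pow_of_le_one hs h.le_one (by norm_num)
  -- pointwise expansion of the nonlinearity
  set ρ : Circle → ℝ := fun w => η w * (Real.exp (φ w) - 1 - φ w) + (Real.exp (φ w) - 1 - φ w) with hρ
  have hρc : Continuous ρ := by fun_prop
  have eN : nonlin η φ = fun w => (η w + η w * φ w + ρ w) + φ w := by
    funext w; simp only [nonlin, hρ]; ring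
  have cηφ : Continuous fun w => η w * φ w := by fun_prop
  have c12 : Continuous fun w => η w + η w * φ w := by fun_prop
  have c123 : Continuous fun w => η w + η w * φ w + ρ w := by fun_prop
  have hφ1 : rfour φ 1 = 0 := by
    have hN := continuous_nonlin η.continuous φ.continuous
    have hi : Integrable (fun w => nonlin η φ w - φ w) arc := (hN.sub φ.continuous).integrable_arc
    have h1 : (φ : Circle → ℝ) = conv resolventKer fun w => nonlin η φ w - φ w :=
      (congrArg DFunLike.coe h.fixed).symm
    conv_lhs => rw [h1]
    rw [rfour_conv integrable_resolventKer hi, rfour_resolventKer]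
    simp
  have e1 : rfour (nonlin η φ) 1 = rfour η 1 + rfour (fun w => η w * φ w) 1 + rfour ρ 1 := by
    rw [eN, rfour_add c123.integrable_arc φ.continuous.integrable_arc,
      rfour_add c12.integrable_arc hρc.integrable_arc,
      rfour_add η.continuous.integrable_arc cηφ.integrable_arc, hφ1, add_zero]
  -- the remainder
  have hρ1 : ‖rfour ρ 1‖ ≤ 16 * C ^ 3 * s ^ 10 + C₂ * s ^ 10 := by
    have i1 : Integrable (fun z => |η z| * (16 * C ^ 2 * s ^ 6)) arc :=
      (by fun_prop : Continuous fun z => |η z| * (16 * C ^ 2 * s ^ 6)).integrable_arc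
    have i2 : Integrable (fun z => φ z ^ 2) arc :=
      (by fun_prop : Continuous fun z => φ z ^ 2).integrable_arc
    have i3 : Integrable (fun z => ‖(ρ z : ℂ)‖) arc :=
      (by fun_prop : Continuous fun z => ‖(ρ z : ℂ)‖).integrable_arc
    refine (norm_four_le 1).trans ((integral_mono i3 (i1.add i2) fun z => ?_).trans ?_)
    · simp only [Pi.add_apply]
      rw [Complex.norm_real, Real.norm_eq_abs]
      refine (abs_add_le _ _).trans ?_
      have h2 := Real.abs_exp_sub_one_sub_id_le (h.abs_le_one z)
      rw [abs_mul]
      exact add_le_add (mul_le_mul_of_nonneg_left (h2.trans (h.sq_le z)) (abs_nonneg _)) h2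
    · have := integral_add i1 i2
      rw [integral_mul_const] at this
      refine this.trans_le ?_
      have h1 := h.integral_sq_le
      have h2 : (∫ z, |η z| ∂arc) * (16 * C ^ 2 * s ^ 6) ≤ C * s ^ 4 * (16 * C ^ 2 * s ^ 6) :=
        mul_le_mul_of_nonneg_right h.conc.mass (by positivity)
      calc _ ≤ C * s ^ 4 * (16 * C ^ 2 * s ^ 6) + C₂ * s ^ 10 := add_le_add h2 h1
        _ = _ := by ring
  -- concentration at `-ξ`
  have hηφ : ‖rfour (fun w => η w * φ w) 1 + conj (ξ : ℂ) * ((∫ z, η z * φ z ∂arc : ℝ) : ℂ)‖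
      ≤ 8 * C ^ 2 * s ^ 9 := by
    have cc : Continuous fun w => ((η w * φ w : ℝ) : ℂ) := by fun_prop
    have e : rfour (fun w => η w * φ w) 1 + conj (ξ : ℂ) * ((∫ z, η z * φ z ∂arc : ℝ) : ℂ)
        = ∫ z : Circle, ((η z * φ z : ℝ) : ℂ) * conj ((z : ℂ) + ξ) ∂arc := by
      have i1 : Integrable (fun z : Circle => ((η z * φ z : ℝ) : ℂ) * conj (z : ℂ)) arc :=
        Continuous.integrable_arc (cc.mul (Complex.continuous_conj.comp (by fun_prop)))
      have i2 : Integrable (fun z => ((η z * φ z : ℝ) : ℂ) * conj (ξ : ℂ)) arc :=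
        cc.integrable_arc.mul_const _
      simp only [map_add, mul_add]
      rw [integral_add i1 i2, integral_mul_const, integral_complex_ofReal, mul_comm (conj (ξ : ℂ))]
      congr 1
      change ∫ z : Circle, ((η z * φ z : ℝ) : ℂ) * (z : ℂ) ^ (-1 : ℤ) ∂arc = _
      congr 1; funext z
      rw [← conj_coe_zpow, zpow_one]
    rw [e]
    have i3 : Integrable (fun z : Circle => |η z| * √‖(z : ℂ) + ξ‖ * (8 * (C * s ^ 3))) arc :=
      (by fun_prop : Continuous fun z : Circle => |η z| * √‖(z : ℂ) + ξ‖ * (8 * (C * s ^ 3))).integrable_arc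
    refine (norm_integral_le_of_norm_le i3 (Eventually.of_forall fun z => ?_)).trans ?_
    · rw [norm_mul, Complex.norm_real, RCLike.norm_conj, Real.norm_eq_abs, abs_mul]
      have h1 := norm_add_le_two_sqrt z ξ
      have h2 := h.abs_le z
      calc |η z| * |φ z| * ‖(z : ℂ) + ξ‖ ≤ |η z| * (4 * (C * s ^ 3)) * (2 * √‖(z : ℂ) + ξ‖) := by gcongr
        _ = _ := by ring
    · rw [integral_mul_const]
      calc _ ≤ C * s ^ 6 * (8 * (C * s ^ 3)) :=
            mul_le_mul_of_nonneg_right h.conc.moment (by positivity)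
        _ = _ := by ring
  have hG := h.abs_integral_mul_sub_le
  have e2 : rfour (nonlin η φ) 1 - rfour η 1
      + conj (ξ : ℂ) * ((∫ z, η z * conv greenKer η z ∂arc : ℝ) : ℂ)
      = (rfour (fun w => η w * φ w) 1 + conj (ξ : ℂ) * ((∫ z, η z * φ z ∂arc : ℝ) : ℂ)) + rfour ρ 1
        - conj (ξ : ℂ) * ((∫ z, η z * φ z ∂arc - ∫ z, η z * conv greenKer η z ∂arc : ℝ) : ℂ) := by
    rw [e1]; push_cast; ring
  rw [e2]
  refine (norm_sub_le _ _).trans ?_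
  refine (add_le_add_left (norm_add_le _ _) _).trans ?_
  rw [norm_mul, RCLike.norm_conj, Circle.norm_coe, one_mul, Complex.norm_real, Real.norm_eq_abs]
  have hCT : 0 ≤ C ^ 2 * T + C * D := by positivity
  have h16 : 0 ≤ 16 * C ^ 3 := by positivity
  have a1 := mul_le_mul_of_nonneg_left hs10 h16
  have a2 := mul_le_mul_of_nonneg_left hs10 hC₂0
  have a3 := mul_le_mul_of_nonneg_left hs10 hCT
  linarith

/-- Power means of the potential of a density, by convexity. -/
lemma integral_potential_pow_le {η : Circle → ℝ} (hη : Continuous η) {N : ℝ} (hN : 0 < N)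
    (hle : ∫ w, |η w| ∂arc ≤ N) {m : ℕ} (hm : m ≠ 0) :
    ∫ z, potential η z ^ m ∂arc ≤ N ^ m * ∫ w, |resolventKer w| ^ m ∂arc := by
  have hKm := integrable_abs_resolventKer_pow hm
  have hηa : Continuous fun w => |η w| := hη.abs
  have hpt : ∀ z, potential η z ^ m ≤ N ^ (m - 1) * conv (fun w => |resolventKer w| ^ m) (fun w => |η w|) z := by
    intro z
    set N' := ∫ w, |η w| ∂arc with hN'
    have hN'0 : 0 ≤ N' := integral_nonneg fun w => abs_nonneg _
    have hi1 := integrable_kernel_mul integrable_resolventKer.abs hηa z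
    have him := integrable_kernel_mul hKm hηa z
    have hp0 := potential_nonneg η z
    rcases hp0.eq_or_lt with h0 | hpos
    · rw [← h0, zero_pow hm]
      exact mul_nonneg (by positivity) (integral_nonneg fun w => by positivity)
    set a := potential η z / N with ha
    have ha0 : 0 < a := by positivity
    -- tangent line to `x ↦ x ^ m` at the mean value `a`
    have htan : ∀ x : ℝ, 0 ≤ x → a ^ m + m * a ^ (m - 1) * (x - a) ≤ x ^ m := by
      intro x hx
      have hxa : 0 ≤ x / a := by positivity
      have hb := one_add_mul_sub_le_pow (a := x / a) (by linarith) m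
      have e : x ^ m = a ^ m * (x / a) ^ m := by rw [← mul_pow, mul_div_cancel₀ _ ha0.ne']
      rw [e]
      refine le_trans (le_of_eq ?_) (mul_le_mul_of_nonneg_left hb (by positivity))
      obtain ⟨j, rfl⟩ := Nat.exists_eq_succ_of_ne_zero hm
      simp only [Nat.succ_eq_add_one, Nat.add_sub_cancel]
      field_simp
      ring
    have hint : ∫ w, ((a ^ m - m * a ^ (m - 1) * a) * |η w|
        + m * a ^ (m - 1) * (|resolventKer (z / w)| * |η w|)) ∂arc
        ≤ conv (fun w => |resolventKer w| ^ m) (fun w => |η w|) z := by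
      refine integral_mono ((hηa.integrable_arc.const_mul _).add (hi1.const_mul _)) him fun w => ?_
      have := mul_le_mul_of_nonneg_right (htan _ (abs_nonneg (resolventKer (z / w)))) (abs_nonneg (η w))
      simp only
      linarith
    have i1 : Integrable (fun w => (a ^ m - m * a ^ (m - 1) * a) * |η w|) arc :=
      hηa.integrable_arc.const_mul _
    have i2 : Integrable (fun w => m * a ^ (m - 1) * (|resolventKer (z / w)| * |η w|)) arc :=
      hi1.const_mul _
    rw [integral_add i1 i2, integral_const_mul, integral_const_mul] at hint
    have e1 : ∫ w, |resolventKer (z / w)| * |η w| ∂arc = N * a := by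
      rw [ha, mul_div_cancel₀ _ hN.ne']; rfl
    rw [e1, ← hN'] at hint
    have ea : a ^ (m - 1) * a = a ^ m := by rw [← pow_succ, Nat.sub_add_cancel (Nat.pos_of_ne_zero hm)]
    have eN : N ^ (m - 1) * N = N ^ m := by rw [← pow_succ, Nat.sub_add_cancel (Nat.pos_of_ne_zero hm)]
    have e2 : potential η z ^ m = N ^ (m - 1) * (a ^ m * N) := by
      have : potential η z = a * N := by rw [ha, div_mul_cancel₀ _ hN.ne']
      rw [this, mul_pow, ← eN]; ring
    rw [e2]
    refine mul_le_mul_of_nonneg_left ?_ (by positivity)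
    have hm1 : (1 : ℝ) ≤ m := by exact_mod_cast Nat.pos_of_ne_zero hm
    have ham : 0 ≤ a ^ m := by positivity
    have h5 : 0 ≤ a ^ m * ((m - 1) * (N - N')) :=
      mul_nonneg ham (mul_nonneg (by linarith) (by linarith))
    have h6 : (a ^ m - m * a ^ (m - 1) * a) * N' + m * a ^ (m - 1) * (N * a)
        = a ^ m * N + a ^ m * ((m - 1) * (N - N')) := by
      rw [← ea]; ring
    linarith
  have hc := continuous_conv hKm hηa
  have hpc : Continuous (potential η) := continuous_conv integrable_resolventKer.abs hηa
  have hfub : ∫ z, conv (fun w => |resolventKer w| ^ m) (fun w => |η w|) z ∂arc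
      = (∫ w, |resolventKer w| ^ m ∂arc) * ∫ w, |η w| ∂arc := by
    have := rfour_conv hKm hηa.integrable_arc 0
    rw [rfour_zero, rfour_zero, rfour_zero] at this
    exact_mod_cast this
  calc ∫ z, potential η z ^ m ∂arc
      ≤ ∫ z, N ^ (m - 1) * conv (fun w => |resolventKer w| ^ m) (fun w => |η w|) z ∂arc :=
        integral_mono (hpc.pow m).integrable_arc (hc.integrable_arc.const_mul _) hpt
    _ = N ^ (m - 1) * ((∫ w, |resolventKer w| ^ m ∂arc) * ∫ w, |η w| ∂arc) := by
        rw [integral_const_mul, hfub]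
    _ ≤ N ^ (m - 1) * ((∫ w, |resolventKer w| ^ m ∂arc) * N) := by
        have : 0 ≤ ∫ w, |resolventKer w| ^ m ∂arc := integral_nonneg fun w => by positivity
        gcongr
    _ = N ^ m * ∫ w, |resolventKer w| ^ m ∂arc := by
        conv_rhs => rw [← Nat.sub_add_cancel (Nat.pos_of_ne_zero hm), pow_succ]
        rw [Nat.sub_add_cancel (Nat.pos_of_ne_zero hm)]
        ring

/-- The solution of the auxiliary equation is of the order of the mass in every Lebesgue space, since
all powers of the resolvent kernel are integrable. -/
lemma exists_eLpNorm_le (C : ℝ) {p : ℝ≥0∞} (hp : p ≠ ∞) : ∃ C' : ℝ,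
    ∀ (s : ℝ) (ξ : Circle) (η φ : C(Circle, ℝ)), AuxSolution C s ξ η φ →
    eLpNorm φ p arc ≤ ENNReal.ofReal (C' * s ^ 4) := by
  obtain ⟨m, hm⟩ := ENNReal.exists_nat_gt hp
  have hm0 : m ≠ 0 := by rintro rfl; simp at hm
  set D := 8 * C ^ 2 + 16 * kerMass * C ^ 2 with hD
  have hk := kerMass_nonneg
  have hD0 : 0 ≤ D := by positivity
  set Km := ∫ w, |resolventKer w| ^ m ∂arc with hKm
  have hKm0 : 0 ≤ Km := integral_nonneg fun w => by positivity
  set V := 2 ^ (m - 1) * ((C + 1) ^ m * Km + 2 * π * D ^ m) with hV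
  set κ : ℝ≥0∞ := arc univ ^ (1 / p.toReal - 1 / (m : ℝ≥0∞).toReal) with hκ
  have hκt : κ ≠ ∞ := by
    refine ENNReal.rpow_ne_top_of_ne_zero ?_ (measure_ne_top _ _)
    intro h
    have := arc_real_univ
    rw [measureReal_def, h, ENNReal.toReal_zero] at this
    exact Real.two_pi_pos.ne this
  refine ⟨V ^ ((m : ℝ)⁻¹) * κ.toReal, fun s ξ η φ h => ?_⟩
  have hC := h.const_nonneg
  have hs := h.pos
  have hV0 : 0 ≤ V := by positivity
  have hint : ∫ z, |φ z| ^ m ∂arc ≤ V * (s ^ 4) ^ m := by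
    have hpc : Continuous (potential η) := continuous_conv integrable_resolventKer.abs η.continuous.abs
    have hpot := integral_potential_pow_le (N := (C + 1) * s ^ 4) η.continuous (by positivity)
      (h.conc.mass.trans (by gcongr; linarith)) hm0
    have i1 : Integrable (fun z => potential η z ^ m) arc := (hpc.pow m).integrable_arc
    have i2 : Integrable (fun _ : Circle => (D * s ^ 4) ^ m) arc := integrable_const _
    have i3 : Integrable (fun z => potential η z ^ m + (D * s ^ 4) ^ m) arc := i1.add i2
    calc ∫ z, |φ z| ^ m ∂arc ≤ ∫ z, 2 ^ (m - 1) * (potential η z ^ m + (D * s ^ 4) ^ m) ∂arc := by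
          refine integral_mono (by fun_prop : Continuous fun z => |φ z| ^ m).integrable_arc
            (i3.const_mul _) fun z => ?_
          have h1 : |φ z| ≤ potential η z + D * s ^ 4 := by
            refine (h.abs_le_potential z).trans ?_
            have : s ^ 6 ≤ s ^ 4 := pow_le_pow_of_le_one hs.le h.le_one (by norm_num)
            gcongr
          exact (pow_le_pow_left₀ (abs_nonneg _) h1 m).trans
            (add_pow_le (potential_nonneg _ _) (by positivity) m)
      _ = 2 ^ (m - 1) * (∫ z, potential η z ^ m ∂arc + 2 * π * (D * s ^ 4) ^ m) := by
          rw [integral_const_mul, integral_add i1 i2, integral_arc_const, smul_eq_mul]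
      _ ≤ 2 ^ (m - 1) * (((C + 1) * s ^ 4) ^ m * Km + 2 * π * (D * s ^ 4) ^ m) := by gcongr
      _ = V * (s ^ 4) ^ m := by rw [hV, mul_pow, mul_pow]; ring
  have hmem : MemLp φ m arc :=
    φ.continuous.memLp_of_hasCompactSupport (HasCompactSupport.of_compactSpace _)
  refine (eLpNorm_le_eLpNorm_mul_rpow_measure_univ hm.le
    φ.continuous.aestronglyMeasurable).trans ?_
  rw [hmem.eLpNorm_eq_integral_rpow_norm (by exact_mod_cast hm0) (ENNReal.natCast_ne_top m),
    ← hκ, ENNReal.toReal_natCast]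
  have e : (∫ z, ‖φ z‖ ^ (m : ℝ) ∂arc) ^ ((m : ℝ)⁻¹) ≤ V ^ ((m : ℝ)⁻¹) * s ^ 4 := by
    simp only [Real.rpow_natCast, Real.norm_eq_abs]
    refine (Real.rpow_le_rpow (integral_nonneg fun z => by positivity) hint (by positivity)).trans_eq ?_
    rw [Real.mul_rpow hV0 (by positivity), Real.pow_rpow_inv_natCast (by positivity) hm0]
  calc _ ≤ ENNReal.ofReal (V ^ ((m : ℝ)⁻¹) * s ^ 4) * κ := by gcongr
    _ = ENNReal.ofReal (V ^ ((m : ℝ)⁻¹) * s ^ 4) * ENNReal.ofReal κ.toReal := by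
        rw [ENNReal.ofReal_toReal hκt]
    _ = ENNReal.ofReal (V ^ ((m : ℝ)⁻¹) * κ.toReal * s ^ 4) := by
        rw [← ENNReal.ofReal_mul (by positivity)]; congr 1; ring

end

end

/-! ### The density produced by the coefficient -/

section

lemma exists_abs_sub_le {k : Circle → ℝ} (hk : IsC 1 k) :
    ∃ C : ℝ, 0 ≤ C ∧ ∀ w : Circle, |k w - k 1| ≤ C * ‖(1 : ℂ) - w‖ := by
  obtain ⟨C, hC, h⟩ := hk.exists_lipschitz
  refine ⟨C * (π / 2), by positivity, fun w => ?_⟩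
  have h1 := h 1 (Complex.arg w)
  rw [mul_one, Circle.exp_arg] at h1
  rw [mul_assoc]
  exact h1.trans (mul_le_mul_of_nonneg_left (norm_arg_le w) hC)

/-- Quadratic flatness at a critical point. -/
lemma exists_abs_sub_le_sq {h : Circle → ℝ} (hh : IsC 2 h) (hcrit : tder h 1 = 0) :
    ∃ C : ℝ, 0 ≤ C ∧ ∀ w : Circle, |h w - h 1| ≤ C * ‖(1 : ℂ) - w‖ ^ 2 := by
  obtain ⟨C, hC, hlip⟩ := hh.tder.exists_lipschitz
  refine ⟨C * (π / 2) ^ 2, by positivity, fun w => ?_⟩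
  set t := Complex.arg w with ht
  have hd : ∀ x ∈ Icc (-|t|) |t|, HasDerivWithinAt (fun x => h (Circle.exp x)) (tder h (Circle.exp x))
      (Icc (-|t|) |t|) x := by
    intro x _
    rw [tder_exp]
    exact ((ContDiff.differentiable hh.one_of_two one_ne_zero) x).hasDerivAt.hasDerivWithinAt
  have hb : ∀ x ∈ Icc (-|t|) |t|, ‖tder h (Circle.exp x)‖ ≤ C * |t| := by
    intro x hx
    have h1 := hlip 1 x
    rw [mul_one, hcrit, sub_zero] at h1
    exact h1.trans (mul_le_mul_of_nonneg_left (abs_le.2 hx) hC)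
  have h2 := (convex_Icc (-|t|) |t|).norm_image_sub_le_of_norm_hasDerivWithin_le hd hb
    (x := 0) (y := t) ⟨by simp, by simp⟩ ⟨neg_abs_le t, le_abs_self t⟩
  rw [Circle.exp_zero, ht, Circle.exp_arg, ← ht, sub_zero, Real.norm_eq_abs, Real.norm_eq_abs] at h2
  refine h2.trans ?_
  have h3 := norm_arg_le w
  calc C * |t| * |t| = C * |t| ^ 2 := by ring
    _ ≤ C * (π / 2 * ‖(1 : ℂ) - w‖) ^ 2 := by gcongr
    _ = _ := by ring

/-- At a critical point the principal value defining the half-Laplacian is an absolutely convergent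
integral. That it vanishes is what makes the mean of the density small compared with its mass. -/
lemma integral_div_sq_eq_zero {h : Circle → ℝ} (hh : Continuous h) {C : ℝ}
    (hC : ∀ w : Circle, |h w - h 1| ≤ C * ‖(1 : ℂ) - w‖ ^ 2) (h_lap : HasHalfLap h 1 0) :
    Integrable (fun w : Circle => (h w - h 1) / ‖(1 : ℂ) - w‖ ^ 2) arc ∧
    ∫ w : Circle, (h w - h 1) / ‖(1 : ℂ) - w‖ ^ 2 ∂arc = 0 := by
  have hm : Measurable fun w : Circle => (h w - h 1) / ‖(1 : ℂ) - w‖ ^ 2 :=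
    (hh.measurable.sub_const _).div (Continuous.measurable (by fun_prop))
  have hint : Integrable (fun w : Circle => (h w - h 1) / ‖(1 : ℂ) - w‖ ^ 2) arc := by
    refine (integrable_const C).mono' hm.aestronglyMeasurable ?_
    filter_upwards [ae_ne_one] with w hw
    have := norm_one_sub_pos hw
    rw [norm_div, norm_pow, norm_norm, Real.norm_eq_abs, div_le_iff₀ (by positivity)]
    exact hC w
  refine ⟨hint, ?_⟩
  have h1 := (tendsto_setIntegral_trunc hint).const_mul (-(1 / π))
  have e : (fun r : ℝ => -(1 / π) * ∫ v in {v : Circle | r < ‖(1 : ℂ) - v‖},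
      (h v - h 1) / ‖(1 : ℂ) - v‖ ^ 2 ∂arc) = truncHalfLap h 1 := by
    funext r
    rw [truncHalfLap, neg_mul, ← mul_neg, ← integral_neg, Circle.coe_one]
    congr 2
    funext v
    ring
  rw [e] at h1
  have h2 := tendsto_nhds_unique h1 h_lap
  have := Real.pi_ne_zero
  simpa using h2

/-- Parameters `(ε, δ, τ)` in a cone around the positive `δ`-axis. -/
def cone (M : ℝ) : Set (ℝ × ℝ × ℝ) :=
  {p | 0 < p.2.1 ∧ p.2.1 ≤ 1 / 2 ∧ |p.1| ≤ M * p.2.1 ∧ |p.2.2| ≤ M * p.2.1}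

section geometry

variable {M δ τ : ℝ}

lemma norm_one_sub_exp_le (t : ℝ) : ‖(1 : ℂ) - Circle.exp t‖ ≤ |t| := by
  have := norm_exp_zpow_sub_one_le t 1
  rw [norm_sub_rev]
  simpa using this

lemma norm_one_sub_ctr_le (h0 : 0 < δ) (hτ : |τ| ≤ M * δ) :
    ‖(1 : ℂ) - ctr δ (Circle.exp τ)‖ ≤ (1 + M) * δ := by
  have e : (1 : ℂ) - ctr δ (Circle.exp τ) = (1 - Circle.exp τ) + ((δ : ℝ) : ℂ) * Circle.exp τ := by
    rw [ctr]; ring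
  rw [e]
  refine (norm_add_le _ _).trans ?_
  rw [norm_mul, Circle.norm_coe, mul_one, Complex.norm_real, Real.norm_eq_abs, abs_of_pos h0]
  linarith [norm_one_sub_exp_le τ]

lemma ctr_mem_stolz (h0 : 0 < δ) (h1 : δ < 1) (hτ : |τ| ≤ M * δ) :
    ctr δ (Circle.exp τ) ∈ stolz (1 + M) := by
  have hn := norm_ctr h1 (Circle.exp τ)
  refine ⟨by rw [hn]; linarith, ?_⟩
  rw [hn, norm_sub_rev, sub_sub_cancel]
  exact norm_one_sub_ctr_le h0 hτ

lemma norm_one_sub_le_mul (hM : 0 ≤ M) (h0 : 0 < δ) (h1 : δ < 1) (hτ : |τ| ≤ M * δ) (w : Circle) :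
    ‖(1 : ℂ) - w‖ ≤ (2 + M) * ‖(w : ℂ) - ctr δ (Circle.exp τ)‖ := by
  have h2 := norm_one_sub_ctr_le h0 hτ
  have h3 := le_norm_sub_ctr (ξ := Circle.exp τ) h1 w
  have e : (1 : ℂ) - w = (1 - ctr δ (Circle.exp τ)) - (w - ctr δ (Circle.exp τ)) := by ring
  rw [e]
  refine (norm_sub_le _ _).trans ?_
  nlinarith

lemma one_sub_sq_le (δ : ℝ) : 1 - (1 - δ) ^ 2 ≤ 2 * δ := by nlinarith [sq_nonneg δ]

lemma le_one_sub_sq (h0 : 0 < δ) (h1 : δ < 1) : δ ≤ 1 - (1 - δ) ^ 2 := by nlinarith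

lemma sqrt_div_norm_le (hM : 0 ≤ M) (h0 : 0 < δ) (h1 : δ < 1) (hτ : |τ| ≤ M * δ) {w : Circle}
    (hw : w ≠ 1) : √(δ / ‖(w : ℂ) - ctr δ (Circle.exp τ)‖)
      ≤ √(2 + M) * √δ * ‖(1 : ℂ) - w‖ ^ (-(1 / 2) : ℝ) := by
  have hx := norm_one_sub_pos hw
  have hd := norm_sub_ctr_pos (ξ := Circle.exp τ) h0 h1 w
  have hle := norm_one_sub_le_mul hM h0 h1 hτ w
  rw [Real.rpow_neg hx.le, ← Real.sqrt_eq_rpow, ← Real.sqrt_mul (by positivity), ← Real.sqrt_inv,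
    ← Real.sqrt_mul (by positivity)]
  refine Real.sqrt_le_sqrt ?_
  rw [← div_eq_mul_inv, div_le_div_iff₀ hd hx]
  nlinarith

end geometry

/-- The perturbed coefficient, normalised by the distance to the centre of the conformal map. -/
def normPert (h k : Circle → ℝ) (p : ℝ × ℝ × ℝ) (w : Circle) : ℝ :=
  (h w + p.1 * k w - h 1) / ‖(w : ℂ) - ctr p.2.1 (Circle.exp p.2.2)‖ ^ 2

/-- The density belonging to the parameters `(ε, δ, τ)`, for the conformal map `f_{δ,ξ}` with
`ξ = exp (iτ)`. -/
def dens (h k : Circle → ℝ) (p : ℝ × ℝ × ℝ) : Circle → ℝ :=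
  relPert (fun z => h z + p.1 * k z) (h 1) p.2.1 (Circle.exp p.2.2)

variable {h k : Circle → ℝ} {p : ℝ × ℝ × ℝ}

lemma pker_mul_dens (h0 : 0 < p.2.1) (h1 : p.2.1 < 1) (w : Circle) :
    pker p.2.1 (Circle.exp p.2.2) w * dens h k p (circleMobius p.2.1 (-Circle.exp p.2.2) w)
      = (1 - (1 - p.2.1) ^ 2) / h 1 * normPert h k p w := by
  rw [dens, relPert, circleMobius_circleMobius_neg h0 h1, pker, normPert]
  ring

lemma continuous_dens (hh : Continuous h) (hk : Continuous k) (h0 : 0 < p.2.1) (h1 : p.2.1 < 1) :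
    Continuous (dens h k p) := by
  have := continuous_circleMobius (ξ := Circle.exp p.2.2) h0 h1
  unfold dens relPert
  fun_prop

lemma continuous_normPert (hh : Continuous h) (hk : Continuous k) (h0 : 0 < p.2.1)
    (h1 : p.2.1 < 1) : Continuous (normPert h k p) := by
  unfold normPert
  exact Continuous.div (by fun_prop) (by fun_prop) fun w => (pow_pos (norm_sub_ctr_pos h0 h1 w) 2).ne'

/-- The coefficient `h` is flat to second order and the perturbation `k` vanishes to first order at the
point `1`, with constant `C`. -/
structure Flat (C : ℝ) (h k : Circle → ℝ) : Prop where
  cont_h : Continuous h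
  cont_k : Continuous k
  nonneg : 0 ≤ C
  pos : 0 < h 1
  sq_bound : ∀ w : Circle, |h w - h 1| ≤ C * ‖(1 : ℂ) - w‖ ^ 2
  lin_bound : ∀ w : Circle, |k w| ≤ C * ‖(1 : ℂ) - w‖

lemma Flat.abs_normPert_le {C M : ℝ} (hf : Flat C h k) (hM : 0 ≤ M) (hp : p ∈ cone M) (w : Circle) :
    |normPert h k p w| ≤ C * ((2 + M) ^ 2 + M * (2 + M)) := by
  obtain ⟨h0, h2, hε, hτ⟩ := hp
  have h1 : p.2.1 < 1 := by linarith
  have hC := hf.nonneg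
  have hd := norm_sub_ctr_pos (ξ := Circle.exp p.2.2) h0 h1 w
  have hδd := le_norm_sub_ctr (ξ := Circle.exp p.2.2) h1 w
  have hx := norm_one_sub_le_mul hM h0 h1 hτ w
  rw [normPert]
  set d := ‖(w : ℂ) - ctr p.2.1 (Circle.exp p.2.2)‖
  set x := ‖(1 : ℂ) - w‖ with hxdef
  have hx0 : 0 ≤ x := norm_nonneg _
  rw [abs_div, abs_of_pos (pow_pos hd 2), div_le_iff₀ (pow_pos hd 2)]
  have e : h w + p.1 * k w - h 1 = (h w - h 1) + p.1 * k w := by ring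
  rw [e]
  refine (abs_add_le _ _).trans ?_
  rw [abs_mul]
  have a1 : |h w - h 1| ≤ C * ((2 + M) * d) ^ 2 := (hf.sq_bound w).trans (by gcongr)
  have a2 : |p.1| * |k w| ≤ (M * d) * (C * ((2 + M) * d)) := by
    refine mul_le_mul (hε.trans (by gcongr)) ((hf.lin_bound w).trans (by gcongr)) (abs_nonneg _)
      (by positivity)
  calc _ ≤ C * ((2 + M) * d) ^ 2 + (M * d) * (C * ((2 + M) * d)) := add_le_add a1 a2
    _ = _ := by ring

/-- The mean of the normalised perturbation tends to the integral of `(h - h 1) / |w - 1|²`, which is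
zero, at the rate `√δ`: the difference of the integrands is at most a multiple of
`δ / |w - a| ≤ √(δ / |w - a|)`, where `a` is the centre. -/
lemma Flat.abs_mean_normPert_le {C M : ℝ} (hf : Flat C h k) (h_lap : HasHalfLap h 1 0) (hM : 0 ≤ M)
    (hp : p ∈ cone M) :
    |∫ w, normPert h k p w ∂arc| ≤ (C * (3 + M) * (1 + M) + M * C * (2 + M)) * √(2 + M)
      * (∫ w : Circle, ‖(1 : ℂ) - w‖ ^ (-(1 / 2) : ℝ) ∂arc) * √p.2.1 := by
  obtain ⟨h0, h2, hε, hτ⟩ := hp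
  have h1 : p.2.1 < 1 := by linarith
  have hC := hf.nonneg
  obtain ⟨hi, hz⟩ := integral_div_sq_eq_zero hf.cont_h hf.sq_bound h_lap
  have hn := (continuous_normPert hf.cont_h hf.cont_k h0 h1).integrable_arc
  have e : ∫ w, normPert h k p w ∂arc
      = ∫ w, (normPert h k p w - (h w - h 1) / ‖(1 : ℂ) - w‖ ^ 2) ∂arc := by
    rw [integral_sub hn hi, hz, sub_zero]
  set C₂ := C * (3 + M) * (1 + M) + M * C * (2 + M) with hC₂
  have hC₂0 : 0 ≤ C₂ := by positivity
  have i1 : Integrable (fun w : Circle => C₂ * √(2 + M) * √p.2.1 * ‖(1 : ℂ) - w‖ ^ (-(1 / 2) : ℝ)) arc :=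
    integrable_norm_one_sub_rpow.const_mul _
  rw [e]
  refine (norm_integral_le_of_norm_le (f := fun w : Circle =>
    normPert h k p w - (h w - h 1) / ‖(1 : ℂ) - w‖ ^ 2) i1 ?_).trans_eq ?_
  · filter_upwards [ae_ne_one] with w hw
    have hd := norm_sub_ctr_pos (ξ := Circle.exp p.2.2) h0 h1 w
    have hδd := le_norm_sub_ctr (ξ := Circle.exp p.2.2) h1 w
    have hx := norm_one_sub_le_mul hM h0 h1 hτ w
    have hsqrt := sqrt_div_norm_le hM h0 h1 hτ hw
    have hx0 := norm_one_sub_pos hw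
    have hxd : |‖(1 : ℂ) - w‖ - ‖(w : ℂ) - ctr p.2.1 (Circle.exp p.2.2)‖| ≤ (1 + M) * p.2.1 := by
      refine le_trans ?_ (norm_one_sub_ctr_le h0 hτ)
      rw [norm_sub_rev (1 : ℂ) (w : ℂ)]
      refine (abs_norm_sub_norm_le _ _).trans_eq ?_
      rw [norm_sub_rev]; congr 1; ring
    rw [normPert]
    set d := ‖(w : ℂ) - ctr p.2.1 (Circle.exp p.2.2)‖
    set x := ‖(1 : ℂ) - w‖ with hxdef
    have e2 : (h w + p.1 * k w - h 1) / d ^ 2 - (h w - h 1) / x ^ 2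
        = ((h w - h 1) * ((x + d) * (x - d)) / x ^ 2 + p.1 * k w) / d ^ 2 := by
      field_simp; ring
    have hnum : |(h w - h 1) * ((x + d) * (x - d)) / x ^ 2 + p.1 * k w| ≤ C₂ * (p.2.1 * d) := by
      refine (abs_add_le _ _).trans ?_
      rw [abs_div, abs_mul, abs_mul, abs_mul, abs_of_pos (pow_pos hx0 2),
        abs_of_pos (by positivity : 0 < x + d)]
      have a1 : |h w - h 1| * ((x + d) * |x - d|) / x ^ 2 ≤ C * (((3 + M) * d) * ((1 + M) * p.2.1)) := by
        rw [div_le_iff₀ (by positivity)]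
        calc _ ≤ (C * x ^ 2) * (((3 + M) * d) * ((1 + M) * p.2.1)) := by
              gcongr
              · exact hf.sq_bound w
              · linarith
          _ = _ := by ring
      have a2 : |p.1| * |k w| ≤ (M * p.2.1) * (C * ((2 + M) * d)) :=
        mul_le_mul hε ((hf.lin_bound w).trans (by gcongr)) (abs_nonneg _) (by positivity)
      calc _ ≤ C * (((3 + M) * d) * ((1 + M) * p.2.1)) + (M * p.2.1) * (C * ((2 + M) * d)) :=
            add_le_add a1 a2
        _ = _ := by rw [hC₂]; ring
    have hle1 : p.2.1 / d ≤ √(p.2.1 / d) := by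
      have hq : p.2.1 / d ≤ 1 := (div_le_one hd).2 hδd
      have hq0 : 0 ≤ p.2.1 / d := by positivity
      exact Real.le_sqrt_of_sq_le (by nlinarith)
    rw [e2, Real.norm_eq_abs, abs_div, abs_of_pos (pow_pos hd 2)]
    calc _ ≤ C₂ * (p.2.1 * d) / d ^ 2 := by gcongr
      _ = C₂ * (p.2.1 / d) := by field_simp
      _ ≤ C₂ * (√(2 + M) * √p.2.1 * x ^ (-(1 / 2) : ℝ)) := by
          gcongr; exact hle1.trans hsqrt
      _ = _ := by ring
  · rw [integral_const_mul]; ring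

lemma sqrt_sqrt_pow_four {δ : ℝ} (h0 : 0 ≤ δ) : (√(√δ)) ^ 4 = δ := by
  rw [show 4 = 2 * 2 from rfl, pow_mul, Real.sq_sqrt (Real.sqrt_nonneg _), Real.sq_sqrt h0]

lemma sqrt_sqrt_pow_six {δ : ℝ} (h0 : 0 ≤ δ) : (√(√δ)) ^ 6 = δ * √δ := by
  rw [show 6 = 4 + 2 from rfl, pow_add, sqrt_sqrt_pow_four h0, Real.sq_sqrt (Real.sqrt_nonneg _)]

/-- Change of variables to the original frame for integrands that are positively homogeneous in the
density: the Jacobian is absorbed into the density. -/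
lemma integral_dens_comp (h0 : 0 < p.2.1) (h1 : p.2.1 < 1) (g : ℝ → Circle → ℝ)
    (hg : ∀ c, 0 < c → ∀ x z, g (c * x) z = c * g x z) :
    ∫ z, g (dens h k p z) z ∂arc = ∫ w, g (pker p.2.1 (Circle.exp p.2.2) w
      * dens h k p (circleMobius p.2.1 (-Circle.exp p.2.2) w))
        (circleMobius p.2.1 (-Circle.exp p.2.2) w) ∂arc := by
  rw [integral_inv_mobius h0 h1 (Circle.exp p.2.2)]
  congr 1; funext w
  rw [smul_eq_mul, hg _ (pker_pos h0 h1 w)]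

/-- The densities are concentrated at scale `δ`, uniformly in the cone of parameters. -/
theorem Flat.exists_concentrated {C M : ℝ} (hf : Flat C h k) (h_lap : HasHalfLap h 1 0)
    (hM : 0 ≤ M) :
    ∃ C' : ℝ, ∀ p ∈ cone M, Concentrated C' (√(√p.2.1)) (Circle.exp p.2.2) (dens h k p) := by
  have hC := hf.nonneg
  have hc := hf.pos
  set C₁ := C * ((2 + M) ^ 2 + M * (2 + M)) with hC₁
  have hC₁0 : 0 ≤ C₁ := by positivity
  set J := ∫ w : Circle, ‖(1 : ℂ) - w‖ ^ (-(1 / 2) : ℝ) ∂arc with hJ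
  have hJ0 : 0 ≤ J := integral_nonneg fun w => by positivity
  set C₂ := (C * (3 + M) * (1 + M) + M * C * (2 + M)) * √(2 + M) * J with hC₂
  have hC₂0 : 0 ≤ C₂ := by positivity
  set K₁ := (4 * C + M * (2 * C)) / h 1
  set K₂ := 2 * π * (2 / h 1 * C₁)
  set K₃ := 2 / h 1 * C₂
  set K₄ := 2 / h 1 * C₁ * (√2 * √(2 + M)) * J
  have k1 : 0 ≤ K₁ := by positivity
  have k2 : 0 ≤ K₂ := by positivity
  have k3 : 0 ≤ K₃ := by positivity
  have k4 : 0 ≤ K₄ := by positivity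
  refine ⟨K₁ + K₂ + K₃ + K₄, fun p hp => ?_⟩
  have hnp := hf.abs_normPert_le hM hp
  have hmean := hf.abs_mean_normPert_le h_lap hM hp
  obtain ⟨h0, h2, hε, hτ⟩ := hp
  have h1 : p.2.1 < 1 := by linarith
  have hη := continuous_dens (p := p) hf.cont_h hf.cont_k h0 h1
  have hF := continuous_circleMobius (ξ := -Circle.exp p.2.2) h0 h1
  have hs6 : 0 ≤ p.2.1 * √p.2.1 := by positivity
  have hfac : (1 - (1 - p.2.1) ^ 2) / h 1 ≤ 2 / h 1 * p.2.1 := by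
    rw [div_mul_eq_mul_div]; gcongr; exact one_sub_sq_le _
  have hfac0 : 0 ≤ (1 - (1 - p.2.1) ^ 2) / h 1 := (div_pos (one_sub_sq_pos h0 h1) hc).le
  have hpd : ∀ w, |(1 - (1 - p.2.1) ^ 2) / h 1 * normPert h k p w| ≤ 2 / h 1 * p.2.1 * C₁ := fun w => by
    rw [abs_mul, abs_of_nonneg hfac0]
    exact mul_le_mul hfac (hnp w) (abs_nonneg _) (by positivity)
  refine ⟨fun z => ?_, ?_, ?_, ?_⟩
  · have : |dens h k p z| ≤ K₁ := by
      rw [dens, relPert, abs_div, abs_of_pos hc]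
      refine div_le_div_of_nonneg_right ?_ hc.le
      set v := circleMobius p.2.1 (Circle.exp p.2.2) z
      have e : h v + p.1 * k v - h 1 = (h v - h 1) + p.1 * k v := by ring
      rw [e]
      refine (abs_add_le _ _).trans ?_
      rw [abs_mul]
      have hv := norm_one_sub_le_two v
      have a1 : |h v - h 1| ≤ C * 2 ^ 2 := (hf.sq_bound v).trans (by gcongr)
      have a2 : |p.1| * |k v| ≤ M * (C * 2) :=
        mul_le_mul (hε.trans (by nlinarith)) ((hf.lin_bound v).trans (by gcongr)) (abs_nonneg _) hM
      linarith
    linarith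
  · rw [sqrt_sqrt_pow_four h0.le, integral_dens_comp h0 h1 (fun x _ => |x|) fun c hc x _ => by
      rw [abs_mul, abs_of_pos hc]]
    simp only [pker_mul_dens h0 h1]
    have hi : Integrable (fun w => |(1 - (1 - p.2.1) ^ 2) / h 1 * normPert h k p w|) arc :=
      ((continuous_normPert hf.cont_h hf.cont_k h0 h1).const_mul _).abs.integrable_arc
    refine (integral_mono hi (integrable_const _) hpd).trans ?_
    rw [integral_arc_const, smul_eq_mul]
    calc 2 * π * (2 / h 1 * p.2.1 * C₁) = K₂ * p.2.1 := by ring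
      _ ≤ _ := by gcongr; linarith
  · rw [sqrt_sqrt_pow_six h0.le, integral_dens_comp h0 h1 (fun x _ => x) fun c _ x _ => rfl]
    simp only [pker_mul_dens h0 h1]
    rw [integral_const_mul, abs_mul, abs_of_nonneg hfac0]
    calc _ ≤ (2 / h 1 * p.2.1) * (C₂ * √p.2.1) := by gcongr
      _ = K₃ * (p.2.1 * √p.2.1) := by ring
      _ ≤ _ := by gcongr; linarith
  · rw [sqrt_sqrt_pow_six h0.le, integral_dens_comp h0 h1
      (fun x z => |x| * √‖(z : ℂ) + Circle.exp p.2.2‖) fun c hc x _ => by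
      rw [abs_mul, abs_of_pos hc, mul_assoc]]
    simp only [pker_mul_dens h0 h1]
    have i1 : Integrable (fun w : Circle => 2 / h 1 * p.2.1 * C₁ *
        (√2 * (√(2 + M) * √p.2.1 * ‖(1 : ℂ) - w‖ ^ (-(1 / 2) : ℝ)))) arc :=
      ((integrable_norm_one_sub_rpow.const_mul _).const_mul _).const_mul _
    have hi : Integrable (fun w => |(1 - (1 - p.2.1) ^ 2) / h 1 * normPert h k p w| *
        √‖(circleMobius p.2.1 (-Circle.exp p.2.2) w : ℂ) + Circle.exp p.2.2‖) arc := by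
      have := continuous_normPert (p := p) hf.cont_h hf.cont_k h0 h1
      exact Continuous.integrable_arc (by fun_prop)
    refine (integral_mono_ae hi i1 ?_).trans ?_
    · filter_upwards [ae_ne_one] with w hw
      have hsq := sqrt_div_norm_le hM h0 h1 hτ hw
      have hFw := norm_inv_mobius_add_le (ξ := Circle.exp p.2.2) h0 h1 w
      have hd := norm_sub_ctr_pos (ξ := Circle.exp p.2.2) h0 h1 w
      refine mul_le_mul (hpd w) ?_ (Real.sqrt_nonneg _) (by positivity)
      refine (Real.sqrt_le_sqrt hFw).trans ?_
      rw [mul_div_assoc, Real.sqrt_mul zero_le_two]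
      gcongr
    · rw [integral_const_mul, integral_const_mul, integral_const_mul]
      calc _ = K₄ * (p.2.1 * √p.2.1) := by ring
        _ ≤ _ := by gcongr; linarith

/-- The first harmonic of the density is a Cauchy-type integral of the coefficient. -/
lemma rfour_dens_one (hh : Continuous h) (hk : Continuous k) (h0 : 0 < p.2.1) (h1 : p.2.1 < 1) :
    rfour (dens h k p) 1 = (((1 - (1 - p.2.1) ^ 2) / h 1 : ℝ) : ℂ) *
      (cauchyD h (ctr p.2.1 (Circle.exp p.2.2)) + p.1 * cauchyD k (ctr p.2.1 (Circle.exp p.2.2))) := by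
  set a := ctr p.2.1 (Circle.exp p.2.2) with ha
  have han : ‖a‖ < 1 := by rw [ha, norm_ctr h1]; linarith
  have hcK := continuous_cauchyKer han
  change ∫ z : Circle, (dens h k p z : ℂ) * (z : ℂ) ^ (-1 : ℤ) ∂arc = _
  rw [integral_inv_mobius h0 h1 (Circle.exp p.2.2)]
  have e : ∀ w : Circle, pker p.2.1 (Circle.exp p.2.2) w •
      ((dens h k p (circleMobius p.2.1 (-Circle.exp p.2.2) w) : ℂ) *
        (circleMobius p.2.1 (-Circle.exp p.2.2) w : ℂ) ^ (-1 : ℤ))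
      = (((1 - (1 - p.2.1) ^ 2) / h 1 : ℝ) : ℂ) * (((h w : ℂ) * (w / ((w : ℂ) - a) ^ 2)
        + p.1 * ((k w : ℂ) * (w / ((w : ℂ) - a) ^ 2))) - h 1 * (w / ((w : ℂ) - a) ^ 2)) := by
    intro w
    have h2 := conj_inv_mobius_mul_pker (ξ := Circle.exp p.2.2) h0 h1 w
    rw [← conj_coe_zpow, zpow_one, Complex.real_smul, dens, relPert, circleMobius_circleMobius_neg h0 h1]
    calc _ = (((h w + p.1 * k w - h 1) / h 1 : ℝ) : ℂ) *
        (conj (circleMobius p.2.1 (-Circle.exp p.2.2) w : ℂ) * pker p.2.1 (Circle.exp p.2.2) w) := by ring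
      _ = _ := by rw [h2]; push_cast; ring
  simp only [e]
  have hhc : Continuous fun w => (h w : ℂ) := by fun_prop
  have hkc : Continuous fun w => (k w : ℂ) := by fun_prop
  have i1 : Integrable (fun w : Circle => (h w : ℂ) * (w / ((w : ℂ) - a) ^ 2)) arc :=
    (hhc.mul hcK).integrable_arc
  have i2 : Integrable (fun w : Circle => (p.1 : ℂ) * ((k w : ℂ) * (w / ((w : ℂ) - a) ^ 2))) arc :=
    (continuous_const.mul (hkc.mul hcK)).integrable_arc
  have i12 : Integrable (fun w : Circle => (h w : ℂ) * (w / ((w : ℂ) - a) ^ 2)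
    + p.1 * ((k w : ℂ) * (w / ((w : ℂ) - a) ^ 2))) arc := i1.add i2
  have i3 : Integrable (fun w : Circle => (h 1 : ℂ) * (w / ((w : ℂ) - a) ^ 2)) arc :=
    (continuous_const.mul hcK).integrable_arc
  rw [integral_const_mul, integral_sub i12 i3, integral_add i1 i2, integral_const_mul,
    integral_const_mul, integral_cauchyKer, mul_zero, sub_zero]
  rfl

end

/-! ### The quadratic term -/

section

variable {h k : Circle → ℝ} {p : ℝ × ℝ × ℝ}

lemma integrable_mul_kernel_mul {K g : Circle → ℝ} (hK : Integrable K arc) (hg : Continuous g) :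
    Integrable (fun x : Circle × Circle => g x.1 * (K (x.1 / x.2) * g x.2)) (arc.prod arc) := by
  obtain ⟨C, hC⟩ := isCompact_univ.exists_bound_of_continuousOn hg.continuousOn
  exact (integrable_kernel_prod hK hg.integrable_arc).bdd_mul (c := C)
    (hg.comp continuous_fst).aestronglyMeasurable (Eventually.of_forall fun x => hC x.1 (mem_univ _))

lemma integral_mul_conv {K g : Circle → ℝ} (hK : Integrable K arc) (hg : Continuous g) :
    ∫ z, g z * conv K g z ∂arc
      = ∫ x : Circle × Circle, g x.1 * (K (x.1 / x.2) * g x.2) ∂(arc.prod arc) := by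
  rw [integral_prod _ (integrable_mul_kernel_mul hK hg)]
  congr 1; funext z
  rw [conv, ← integral_const_mul]

lemma Q_eq (h : Circle → ℝ) : Q h = π * ∫ x : Circle × Circle,
    ((h x.1 - h 1) / ‖(1 : ℂ) - x.1‖ ^ 2) * (greenKer (x.1 / x.2)
      * ((h x.2 - h 1) / ‖(1 : ℂ) - x.2‖ ^ 2)) ∂(arc.prod arc) := by
  rw [Q, ← integral_const_mul]
  congr 1; funext x
  rw [greenKer_div, one_div, Real.log_inv, norm_sub_rev (x.1 : ℂ) 1, norm_sub_rev (x.2 : ℂ) 1]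
  have := Real.pi_ne_zero
  field_simp

lemma tendsto_normPert (h k : Circle → ℝ) {w : Circle} (hw : w ≠ 1) :
    Tendsto (fun p => normPert h k p w) (𝓝 0) (𝓝 ((h w - h 1) / ‖(1 : ℂ) - w‖ ^ 2)) := by
  have hc : ContinuousAt (fun p : ℝ × ℝ × ℝ => normPert h k p w) 0 := by
    unfold normPert ctr
    refine ContinuousAt.div (by fun_prop) (by fun_prop) ?_
    have := norm_one_sub_pos hw
    rw [norm_sub_rev] at this
    simp only [Prod.fst_zero, Prod.snd_zero, Circle.exp_zero, Circle.coe_one, Complex.ofReal_zero,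
      sub_zero, mul_one]
    positivity
  have := hc.tendsto
  convert! this using 2
  simp only [normPert, ctr, Prod.fst_zero, Prod.snd_zero, Circle.exp_zero, Circle.coe_one,
    Complex.ofReal_zero, sub_zero, mul_one, zero_mul, add_zero]
  rw [norm_sub_rev]

/-- The Green energy of the normalised perturbation converges to the quadratic form. -/
lemma Flat.tendsto_energy {C M : ℝ} (hf : Flat C h k) (hM : 0 ≤ M) :
    Tendsto (fun p => ∫ z, normPert h k p z * conv greenKer (normPert h k p) z ∂arc)
      (𝓝[cone M] 0) (𝓝 (Q h / π)) := by
  set C₁ := C * ((2 + M) ^ 2 + M * (2 + M)) with hC₁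
  have hC := hf.nonneg
  have hC₁0 : 0 ≤ C₁ := by positivity
  have hcont : ∀ p ∈ cone M, Continuous (normPert h k p) := fun p hp =>
    continuous_normPert hf.cont_h hf.cont_k hp.1 (by linarith [hp.2.1])
  have e : Q h / π = ∫ x : Circle × Circle, ((h x.1 - h 1) / ‖(1 : ℂ) - x.1‖ ^ 2) *
      (greenKer (x.1 / x.2) * ((h x.2 - h 1) / ‖(1 : ℂ) - x.2‖ ^ 2)) ∂(arc.prod arc) := by
    rw [Q_eq, mul_div_cancel_left₀ _ Real.pi_ne_zero]
  rw [e]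
  have key : Tendsto (fun p => ∫ x : Circle × Circle,
      normPert h k p x.1 * (greenKer (x.1 / x.2) * normPert h k p x.2) ∂(arc.prod arc))
      (𝓝[cone M] 0) (𝓝 (∫ x : Circle × Circle, ((h x.1 - h 1) / ‖(1 : ℂ) - x.1‖ ^ 2) *
      (greenKer (x.1 / x.2) * ((h x.2 - h 1) / ‖(1 : ℂ) - x.2‖ ^ 2)) ∂(arc.prod arc))) := by
    refine tendsto_integral_filter_of_dominated_convergence
      (fun x => C₁ * (|greenKer (x.1 / x.2)| * C₁)) ?_ ?_ ?_ ?_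
    · filter_upwards [self_mem_nhdsWithin] with p hp
      exact (integrable_mul_kernel_mul integrable_greenKer (hcont p hp)).aestronglyMeasurable
    · filter_upwards [self_mem_nhdsWithin] with p hp
      refine Eventually.of_forall fun x => ?_
      rw [norm_mul, norm_mul, Real.norm_eq_abs, Real.norm_eq_abs, Real.norm_eq_abs]
      have h1 := hf.abs_normPert_le hM hp x.1
      have h2 := hf.abs_normPert_le hM hp x.2
      gcongr
    · exact (integrable_kernel_prod integrable_greenKer.abs (integrable_const C₁)).const_mul C₁
    · have h1 : ∀ᵐ x : Circle × Circle ∂(arc.prod arc), x.1 ≠ 1 :=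
        Measure.quasiMeasurePreserving_fst.ae ae_ne_one
      have h2 : ∀ᵐ x : Circle × Circle ∂(arc.prod arc), x.2 ≠ 1 :=
        Measure.quasiMeasurePreserving_snd.ae ae_ne_one
      filter_upwards [h1, h2] with x hx1 hx2
      exact ((tendsto_normPert h k hx1).mul ((tendsto_normPert h k hx2).const_mul _)).mono_left
        nhdsWithin_le_nhds
  refine key.congr' ?_
  filter_upwards [self_mem_nhdsWithin] with p hp
  exact (integral_mul_conv integrable_greenKer (hcont p hp)).symm

lemma abs_log_pker_le {δ : ℝ} {ξ : Circle} (h0 : 0 < δ) (h1 : δ < 1) (w : Circle) :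
    |Real.log (pker δ ξ w)| ≤ 4 * (√(√δ))⁻¹ := by
  set s := √(√δ) with hs
  have hs0 : 0 < s := by positivity
  have hs4 : s ^ 4 = δ := sqrt_sqrt_pow_four h0.le
  have hP := pker_pos (ξ := ξ) h0 h1 w
  have hd := norm_sub_ctr_pos (ξ := ξ) h0 h1 w
  have hδd := le_norm_sub_ctr (ξ := ξ) h1 w
  have hd2 : ‖(w : ℂ) - ctr δ ξ‖ ≤ 2 := by
    refine (norm_sub_le _ _).trans ?_
    rw [norm_ctr h1, Circle.norm_coe]; linarith
  have hup : pker δ ξ w ≤ 4 / δ := by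
    rw [pker, div_le_div_iff₀ (by positivity) h0]
    have := one_sub_sq_le δ
    nlinarith
  have hlow : (pker δ ξ w)⁻¹ ≤ 4 / δ := by
    rw [pker, inv_div, div_le_div_iff₀ (one_sub_sq_pos h0 h1) h0]
    have := le_one_sub_sq h0 h1
    have hsq : ‖(w : ℂ) - ctr δ ξ‖ ^ 2 ≤ 4 := by nlinarith
    nlinarith
  have hL : Real.log (4 / δ) ≤ 4 * s⁻¹ := by
    rw [Real.log_div (by norm_num) h0.ne', ← hs4, Real.log_pow]
    have a1 := Real.log_le_sub_one_of_pos (by norm_num : (0 : ℝ) < 4)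
    have a2 := Real.log_le_sub_one_of_pos (inv_pos.2 hs0)
    rw [Real.log_inv] at a2
    push_cast
    linarith
  refine abs_le.2 ⟨?_, (Real.log_le_log hP hup).trans hL⟩
  have := (Real.log_le_log (inv_pos.2 hP) hlow).trans hL
  rw [Real.log_inv] at this
  linarith

/-- The Green energy of the density, in the original frame. -/
lemma integral_dens_mul_conv (hh : Continuous h) (hk : Continuous k) (h0 : 0 < p.2.1)
    (h1 : p.2.1 < 1) :
    ∫ z, dens h k p z * conv greenKer (dens h k p) z ∂arc
      = ((1 - (1 - p.2.1) ^ 2) / h 1) ^ 2 *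
          (∫ z, normPert h k p z * conv greenKer (normPert h k p) z ∂arc)
        - 1 / π * (∫ z, dens h k p z ∂arc) * ((1 - (1 - p.2.1) ^ 2) / h 1 *
          ∫ v, Real.log (pker p.2.1 (Circle.exp p.2.2) v) * normPert h k p v ∂arc) := by
  have hη := continuous_dens (p := p) hh hk h0 h1
  have hn := continuous_normPert (p := p) hh hk h0 h1
  have hlP := continuous_log_pker (ξ := Circle.exp p.2.2) h0 h1
  set b := (1 - (1 - p.2.1) ^ 2) / h 1 with hb
  set m := ∫ z, dens h k p z ∂arc with hm
  set L := ∫ v, Real.log (pker p.2.1 (Circle.exp p.2.2) v) * normPert h k p v ∂arc with hL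
  have hG := continuous_conv integrable_greenKer hn
  have hmb : m = b * ∫ w, normPert h k p w ∂arc := by
    rw [hm, integral_inv_mobius h0 h1 (Circle.exp p.2.2), ← integral_const_mul]
    simp only [smul_eq_mul, pker_mul_dens h0 h1, ← hb]
  have hLb : ∫ v, Real.log (pker p.2.1 (Circle.exp p.2.2) v) * (b * normPert h k p v) ∂arc = b * L := by
    rw [hL, ← integral_const_mul]
    congr 1; funext v; ring
  have i1 : Integrable (fun w => -(1 / (2 * π)) * m * b *
      (Real.log (pker p.2.1 (Circle.exp p.2.2) w) * normPert h k p w)) arc :=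
    (hlP.mul hn).integrable_arc.const_mul _
  have i2 : Integrable (fun w => -(1 / (2 * π)) * (b * L) * b * normPert h k p w) arc :=
    hn.integrable_arc.const_mul _
  have i12 : Integrable (fun w => -(1 / (2 * π)) * m * b *
      (Real.log (pker p.2.1 (Circle.exp p.2.2) w) * normPert h k p w)
      + -(1 / (2 * π)) * (b * L) * b * normPert h k p w) arc := i1.add i2
  have i3 : Integrable (fun w => b ^ 2 * (normPert h k p w * conv greenKer (normPert h k p) w)) arc :=
    (hn.mul hG).integrable_arc.const_mul _
  have e : ∫ z, dens h k p z * conv greenKer (dens h k p) z ∂arc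
      = ∫ w, ((-(1 / (2 * π)) * m * b *
      (Real.log (pker p.2.1 (Circle.exp p.2.2) w) * normPert h k p w)
      + -(1 / (2 * π)) * (b * L) * b * normPert h k p w)
      + b ^ 2 * (normPert h k p w * conv greenKer (normPert h k p) w)) ∂arc := by
    rw [integral_inv_mobius h0 h1 (Circle.exp p.2.2)]
    congr 1; funext w
    rw [smul_eq_mul, ← mul_assoc, pker_mul_dens h0 h1, conv_greenKer_inv_mobius h0 h1 hη]
    simp only [pker_mul_dens h0 h1]
    rw [← hb, hLb, ← hm, conv_const_mul]
    ring
  rw [e, integral_add i12 i3, integral_add i1 i2, integral_const_mul, integral_const_mul,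
    integral_const_mul, ← hL]
  have : b * ∫ w, normPert h k p w ∂arc = m := hmb.symm
  have hpi := Real.pi_ne_zero
  field_simp
  linear_combination (-b * L) * this

lemma tendsto_sqrt_sqrt (M : ℝ) :
    Tendsto (fun p : ℝ × ℝ × ℝ => √(√p.2.1)) (𝓝[cone M] 0) (𝓝 0) := by
  have hc : Continuous fun p : ℝ × ℝ × ℝ => √(√p.2.1) := by fun_prop
  have := (hc.tendsto 0).mono_left (nhdsWithin_le_nhds (s := cone M))
  simpa using this

/-- Asymptotics of the Green energy of the density. The terms in which the conformal factor of the
Green kernel appears carry the mean of the density as a factor, and are therefore negligible. -/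
theorem Flat.energy_isLittleO {C M : ℝ} (hf : Flat C h k) (h_lap : HasHalfLap h 1 0) (hM : 0 ≤ M) :
    (fun p => ∫ z, dens h k p z * conv greenKer (dens h k p) z ∂arc
        - ((1 - (1 - p.2.1) ^ 2) / h 1) ^ 2 * (Q h / π))
      =o[𝓝[cone M] 0] fun p => p.2.1 ^ 2 := by
  have hc := hf.pos
  have hC := hf.nonneg
  obtain ⟨C', hC'⟩ := hf.exists_concentrated h_lap hM
  set C₁ := C * ((2 + M) ^ 2 + M * (2 + M)) with hC₁
  have hC₁0 : 0 ≤ C₁ := by positivity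
  have hb : (fun p : ℝ × ℝ × ℝ => ((1 - (1 - p.2.1) ^ 2) / h 1) ^ 2)
      =O[𝓝[cone M] 0] fun p => p.2.1 ^ 2 := by
    refine IsBigO.pow (IsBigO.of_bound (2 / h 1) ?_) 2
    filter_upwards [self_mem_nhdsWithin] with p hp
    have h1 : p.2.1 < 1 := by linarith [hp.2.1]
    rw [Real.norm_eq_abs, Real.norm_eq_abs, abs_of_pos hp.1,
      abs_of_pos (div_pos (one_sub_sq_pos hp.1 h1) hc), div_mul_eq_mul_div]
    gcongr
    exact one_sub_sq_le _
  have hE : (fun p => (∫ z, normPert h k p z * conv greenKer (normPert h k p) z ∂arc) - Q h / π)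
      =o[𝓝[cone M] 0] fun _ => (1 : ℝ) := by
    rw [isLittleO_one_iff]
    have := (hf.tendsto_energy hM).sub_const (Q h / π)
    rwa [sub_self] at this
  have h1 := hb.mul_isLittleO hE
  simp only [mul_one] at h1
  have h2 : (fun p => 1 / π * (∫ z, dens h k p z ∂arc) * ((1 - (1 - p.2.1) ^ 2) / h 1 *
          ∫ v, Real.log (pker p.2.1 (Circle.exp p.2.2) v) * normPert h k p v ∂arc))
      =o[𝓝[cone M] 0] fun p => p.2.1 ^ 2 := by
    have hs : (fun p : ℝ × ℝ × ℝ => p.2.1 ^ 2 * √(√p.2.1)) =o[𝓝[cone M] 0] fun p => p.2.1 ^ 2 := by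
      have := (isBigO_refl (fun p : ℝ × ℝ × ℝ => p.2.1 ^ 2) (𝓝[cone M] 0)).mul_isLittleO
        ((isLittleO_one_iff ℝ).2 (tendsto_sqrt_sqrt M))
      simpa using this
    refine IsBigO.trans_isLittleO (IsBigO.of_bound (1 / π * C' * (2 / h 1 * (2 * π * (4 * C₁)))) ?_) hs
    filter_upwards [self_mem_nhdsWithin] with p hp
    have hnp := hf.abs_normPert_le hM hp
    have hcp := hC' p hp
    have hC'0 := hcp.const_nonneg
    have hmean := hcp.mean
    obtain ⟨h0, h12, hε, hτ⟩ := hp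
    have h1 : p.2.1 < 1 := by linarith
    set s := √(√p.2.1) with hsdef
    have hs0 : 0 < s := by positivity
    have hs4 : s ^ 4 = p.2.1 := sqrt_sqrt_pow_four h0.le
    have hL : |∫ v, Real.log (pker p.2.1 (Circle.exp p.2.2) v) * normPert h k p v ∂arc|
        ≤ 2 * π * (4 * C₁) * s⁻¹ := by
      refine (norm_integral_le_of_norm_le
        (f := fun v => Real.log (pker p.2.1 (Circle.exp p.2.2) v) * normPert h k p v)
        (integrable_const (4 * s⁻¹ * C₁)) (Eventually.of_forall fun v => ?_)).trans_eq ?_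
      · rw [norm_mul, Real.norm_eq_abs, Real.norm_eq_abs]
        exact mul_le_mul (abs_log_pker_le h0 h1 v) (hnp v) (abs_nonneg _) (by positivity)
      · rw [integral_arc_const, smul_eq_mul]; ring
    have hfac : |(1 - (1 - p.2.1) ^ 2) / h 1| ≤ 2 / h 1 * p.2.1 := by
      rw [abs_of_pos (div_pos (one_sub_sq_pos h0 h1) hc), div_mul_eq_mul_div]
      gcongr; exact one_sub_sq_le _
    have hpi : |1 / π| = 1 / π := abs_of_pos (by positivity)
    rw [Real.norm_eq_abs, Real.norm_eq_abs, abs_mul, abs_mul, abs_mul, hpi,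
      abs_of_nonneg (by positivity : 0 ≤ p.2.1 ^ 2 * s)]
    calc _ ≤ 1 / π * (C' * s ^ 6) * ((2 / h 1 * p.2.1) * (2 * π * (4 * C₁) * s⁻¹)) := by gcongr
      _ = 1 / π * C' * (2 / h 1 * (2 * π * (4 * C₁))) * (p.2.1 * s ^ 4 * s) * (s * s⁻¹) := by ring
      _ = _ := by rw [mul_inv_cancel₀ hs0.ne', hs4]; ring
  refine (h1.sub h2).congr' ?_ EventuallyEq.rfl
  filter_upwards [self_mem_nhdsWithin] with p hp
  rw [integral_dens_mul_conv hf.cont_h hf.cont_k hp.1 (by linarith [hp.2.1])]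
  ring

end

/-! ### The reduced equation -/

section

variable {h k : Circle → ℝ}

/-- The density as a continuous map (with dummy value `0` for degenerate parameters). -/
def densMap (h k : Circle → ℝ) (p : ℝ × ℝ × ℝ) : C(Circle, ℝ) :=
  open scoped Classical in if hc : Continuous (dens h k p) then ⟨dens h k p, hc⟩ else 0

lemma coe_densMap {p : ℝ × ℝ × ℝ} (hh : Continuous h) (hk : Continuous k) (h0 : 0 < p.2.1)
    (h1 : p.2.1 < 1) : (densMap h k p : Circle → ℝ) = dens h k p := by
  rw [densMap, dif_pos (continuous_dens hh hk h0 h1)]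
  rfl

lemma continuousOn_densMap (hh : Continuous h) (hk : Continuous k) :
    ContinuousOn (densMap h k) {p | 0 < p.2.1 ∧ p.2.1 < 1} := by
  rw [continuousOn_iff_continuous_domRestrict]
  refine ContinuousMap.continuous_of_continuous_uncurry _ ?_
  have hF : Continuous fun x : {p : ℝ × ℝ × ℝ | 0 < p.2.1 ∧ p.2.1 < 1} × Circle =>
      circleMobius x.1.1.2.1 (Circle.exp x.1.1.2.2) x.2 := by
    rw [continuous_circle_iff]
    have e : (fun x : {p : ℝ × ℝ × ℝ | 0 < p.2.1 ∧ p.2.1 < 1} × Circle =>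
        (circleMobius x.1.1.2.1 (Circle.exp x.1.1.2.2) x.2 : ℂ))
        = fun x => mobius x.1.1.2.1 (Circle.exp x.1.1.2.2) x.2 :=
      funext fun x => coe_circleMobius x.1.2.1 x.1.2.2 _ _
    rw [e]
    unfold mobius
    refine Continuous.div (by fun_prop) ?_ fun x => mobius_denom_ne_zero x.1.2.1 x.1.2.2 _ _
    refine continuous_const.add (Continuous.mul (Continuous.mul (by fun_prop) ?_) (by fun_prop))
    exact Complex.continuous_conj.comp (by fun_prop)
  have e : (Function.uncurry fun (x : {p : ℝ × ℝ × ℝ | 0 < p.2.1 ∧ p.2.1 < 1}) (z : Circle) =>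
      ({p : ℝ × ℝ × ℝ | 0 < p.2.1 ∧ p.2.1 < 1}.domRestrict (densMap h k) x) z)
      = fun x => (h (circleMobius x.1.1.2.1 (Circle.exp x.1.1.2.2) x.2)
        + x.1.1.1 * k (circleMobius x.1.1.2.1 (Circle.exp x.1.1.2.2) x.2) - h 1) / h 1 := by
    funext x
    simp only [Function.uncurry, domRestrict_apply]
    rw [coe_densMap hh hk x.1.2.1 x.1.2.2]
    rfl
  rw [e]
  fun_prop

lemma Concentrated.mono {C C' s : ℝ} {ξ : Circle} {η : Circle → ℝ} (h : Concentrated C s ξ η)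
    (hC : C ≤ C') : Concentrated C' s ξ η :=
  ⟨fun z => (h.bdd z).trans hC, h.mass.trans (by gcongr), h.mean.trans (by gcongr),
    h.moment.trans (by gcongr)⟩

/-- The family of solutions of the auxiliary equation. -/
theorem Flat.exists_aux_family {C M : ℝ} (hf : Flat C h k) (h_lap : HasHalfLap h 1 0) (hM : 0 ≤ M) :
    ∃ C' : ℝ, ∃ r > 0, ∃ Φ : ℝ × ℝ × ℝ → C(Circle, ℝ),
      (∀ p ∈ cone M, p.2.1 < r →
        AuxSolution C' (√(√p.2.1)) (Circle.exp p.2.2) (densMap h k p) (Φ p)) ∧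
      ContinuousOn Φ {p | p ∈ cone M ∧ p.2.1 < r} := by
  obtain ⟨x₀, hx₀, S, hS1, hS2, hS3⟩ := exists_aux_solution
  obtain ⟨C₁, hC₁⟩ := hf.exists_concentrated h_lap hM
  set K := ∫ w, |resolventKer w| ^ 4 ∂arc with hK
  have hK0 : 0 ≤ K := integral_nonneg fun w => by positivity
  set C' := |C₁| + |C₁| * K with hC'
  have hC'0 : 0 ≤ C' := by positivity
  set y := min 1 (x₀ / (C' + 1)) with hy
  have hy0 : 0 < y := lt_min one_pos (by positivity)
  have hpot : ∀ p ∈ cone M, p.2.1 < y ^ 4 →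
      Concentrated C' (√(√p.2.1)) (Circle.exp p.2.2) (densMap h k p) ∧
      (∀ z, potential (densMap h k p) z ≤ C' * √(√p.2.1) ^ 3) ∧ C' * √(√p.2.1) ^ 3 ≤ x₀ ∧
      0 < √(√p.2.1) ∧ √(√p.2.1) ≤ 1 := by
    intro p hp hpy
    have h1 : p.2.1 < 1 := by linarith [hp.2.1]
    have h0 := hp.1
    set s := √(√p.2.1) with hs
    have hs0 : 0 < s := by positivity
    have hsy : s ≤ y := by
      have : s ^ 4 ≤ y ^ 4 := by rw [sqrt_sqrt_pow_four h0.le]; exact hpy.le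
      exact le_of_pow_le_pow_left₀ (by norm_num) hy0.le this
    have hs1 : s ≤ 1 := hsy.trans (min_le_left _ _)
    have hc := hC₁ p hp
    rw [← coe_densMap hf.cont_h hf.cont_k h0 h1] at hc
    have hc1 := hc.mono (le_abs_self C₁)
    have hc2 := hc1.mono (C' := C') (by rw [hC']; nlinarith [abs_nonneg C₁])
    refine ⟨hc2, hc1.potential_le (densMap h k p).continuous hs0, ?_, hs0, hs1⟩
    have h3 : s ^ 3 ≤ s := pow_le_of_le_one hs0.le hs1 (by norm_num)
    have h4 : s ≤ x₀ / (C' + 1) := hsy.trans (min_le_right _ _)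
    rw [le_div_iff₀ (by positivity)] at h4
    nlinarith
  refine ⟨C', y ^ 4, by positivity, fun p => S (densMap h k p), fun p hp hpy => ?_, ?_⟩
  · obtain ⟨h1, h2, h3, h4, h5⟩ := hpot p hp hpy
    have h6 := hS1 _ fun z => (h2 z).trans h3
    exact ⟨h1, h4, h5, h6.1, h6.2, h2, hS2 _ _ h3 h2⟩
  · refine hS3.comp ((continuousOn_densMap hf.cont_h hf.cont_k).mono ?_) ?_
    · exact fun p hp => ⟨hp.1.1, by linarith [hp.1.2.1]⟩
    · intro p hp z
      obtain ⟨h1, h2, h3, -⟩ := hpot p hp.1 hp.2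
      exact (h2 z).trans h3

/-- The normalised first harmonic of the nonlinearity; its zeros are the solutions. -/
def redMap (h k : Circle → ℝ) (Φ : ℝ × ℝ × ℝ → C(Circle, ℝ)) (p : ℝ × ℝ × ℝ) : ℂ :=
  (((1 - (1 - p.2.1) ^ 2) / h 1 * π : ℝ) : ℂ)⁻¹ * rfour (nonlin (densMap h k p) (Φ p)) 1

lemma continuous_rfour_nonlin :
    Continuous fun x : C(Circle, ℝ) × C(Circle, ℝ) => rfour (nonlin x.1 x.2) 1 := by
  have h1 : Continuous fun x : C(Circle, ℝ) × C(Circle, ℝ) => 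
      (⟨nonlin x.1 x.2, continuous_nonlin x.1.continuous x.2.continuous⟩ : C(Circle, ℝ)) := by
    refine ContinuousMap.continuous_of_continuous_uncurry _ ?_
    have : (Function.uncurry fun (x : C(Circle, ℝ) × C(Circle, ℝ)) (z : Circle) =>
        (⟨nonlin x.1 x.2, continuous_nonlin x.1.continuous x.2.continuous⟩ : C(Circle, ℝ)) z)
        = fun x => (1 + x.1.1 x.2) * Real.exp (x.1.2 x.2) - 1 := rfl
    rw [this]
    fun_prop
  have h2 : Continuous fun f : C(Circle, ℝ) => rfour f 1 := by
    refine continuous_iff_continuousAt.2 fun f => ?_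
    rw [ContinuousAt, tendsto_iff_norm_sub_tendsto_zero]
    have hb : ∀ g : C(Circle, ℝ), ‖rfour g 1 - rfour f 1‖ ≤ 2 * π * ‖g - f‖ := by
      intro g
      rw [← rfour_sub g.continuous.integrable_arc f.continuous.integrable_arc]
      refine (norm_four_le 1).trans ?_
      have hi : Integrable (fun w => ‖((g w - f w : ℝ) : ℂ)‖) arc :=
        (by fun_prop : Continuous fun w => ‖((g w - f w : ℝ) : ℂ)‖).integrable_arc
      refine (integral_mono hi (integrable_const ‖g - f‖) fun w => ?_).trans_eq ?_
      · simp only [Complex.norm_real]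
        exact (g - f).norm_coe_le_norm w
      · rw [integral_arc_const, smul_eq_mul]
    refine squeeze_zero (fun _ => norm_nonneg _) hb ?_
    have hc : Continuous fun g : C(Circle, ℝ) => 2 * π * ‖g - f‖ := by fun_prop
    have := hc.tendsto f
    rwa [sub_self, norm_zero, mul_zero] at this
  exact h2.comp h1

lemma continuousOn_rfour_nonlin {X : Type*} [TopologicalSpace X] {η φ : X → C(Circle, ℝ)} {D : Set X}
    (hη : ContinuousOn η D) (hφ : ContinuousOn φ D) :
    ContinuousOn (fun p => rfour (nonlin (η p) (φ p)) 1) D := by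
  have h1 : ContinuousOn (fun p => (η p, φ p)) D := hη.prodMk hφ
  have h2 := continuous_rfour_nonlin.comp_continuousOn h1
  simpa only [Function.comp_def] using h2

lemma continuousOn_redMap (hh : Continuous h) (hk : Continuous k) (hpos : 0 < h 1) {M r : ℝ}
    {Φ : ℝ × ℝ × ℝ → C(Circle, ℝ)} (hΦ : ContinuousOn Φ {p | p ∈ cone M ∧ p.2.1 < r}) :
    ContinuousOn (redMap h k Φ) {p | p ∈ cone M ∧ p.2.1 < r} := by
  set D : Set (ℝ × ℝ × ℝ) := {p | p ∈ cone M ∧ p.2.1 < r} with hD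
  have hmem : ∀ p ∈ D, 0 < p.2.1 ∧ p.2.1 < 1 := fun p hp => ⟨hp.1.1, by linarith [hp.1.2.1]⟩
  clear_value D
  have hd : ContinuousOn (densMap h k) D := (continuousOn_densMap hh hk).mono hmem
  have hN : ContinuousOn (fun p => rfour (nonlin (densMap h k p) (Φ p)) 1) D :=
    continuousOn_rfour_nonlin hd hΦ
  have hb : ContinuousOn (fun p : ℝ × ℝ × ℝ => (((1 - (1 - p.2.1) ^ 2) / h 1 * π : ℝ) : ℂ)) D :=
    Continuous.continuousOn (by fun_prop)
  have hb0 : ∀ p ∈ D, (((1 - (1 - p.2.1) ^ 2) / h 1 * π : ℝ) : ℂ) ≠ 0 := by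
    intro p hp
    have h1 := one_sub_sq_pos (hmem p hp).1 (hmem p hp).2
    rw [Complex.ofReal_ne_zero]
    positivity
  unfold redMap
  exact (hb.inv₀ hb0).mul hN

section asymptotics

variable {M : ℝ}

lemma tendsto_ctr (M : ℝ) : Tendsto (fun p : ℝ × ℝ × ℝ => ctr p.2.1 (Circle.exp p.2.2))
    (𝓝[cone M] 0) (𝓝[stolz (1 + M)] 1) := by
  refine tendsto_nhdsWithin_iff.2 ⟨?_, ?_⟩
  · have hc : Continuous fun p : ℝ × ℝ × ℝ => ctr p.2.1 (Circle.exp p.2.2) := by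
      unfold ctr; fun_prop
    have := (hc.tendsto 0).mono_left (nhdsWithin_le_nhds (s := cone M))
    simpa [ctr] using this
  · filter_upwards [self_mem_nhdsWithin] with p hp
    exact ctr_mem_stolz hp.1 (by linarith [hp.2.1]) hp.2.2.2

lemma tendsto_delta (M : ℝ) : Tendsto (fun p : ℝ × ℝ × ℝ => p.2.1) (𝓝[cone M] 0) (𝓝 0) := by
  have hc : Continuous fun p : ℝ × ℝ × ℝ => p.2.1 := by fun_prop
  exact (hc.tendsto 0).mono_left nhdsWithin_le_nhds

lemma ctr_sub_one_isBigO (M : ℝ) : (fun p : ℝ × ℝ × ℝ => ctr p.2.1 (Circle.exp p.2.2) - 1)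
    =O[𝓝[cone M] 0] fun p => p.2.1 := by
  refine IsBigO.of_bound (1 + M) ?_
  filter_upwards [self_mem_nhdsWithin] with p hp
  rw [norm_sub_rev, Real.norm_eq_abs, abs_of_pos hp.1]
  exact norm_one_sub_ctr_le hp.1 hp.2.2.2

lemma delta_sq_isLittleO (M : ℝ) : (fun p : ℝ × ℝ × ℝ => p.2.1 ^ 2)
    =o[𝓝[cone M] 0] fun p => p.2.1 := by
  have := ((isLittleO_one_iff ℝ).2 (tendsto_delta M)).mul_isBigO
    (isBigO_refl (fun p : ℝ × ℝ × ℝ => p.2.1) (𝓝[cone M] 0))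
  simpa [sq] using this

lemma ctr_sub_one_isLittleO (M : ℝ) :
    (fun p : ℝ × ℝ × ℝ => ctr p.2.1 (Circle.exp p.2.2) - 1 + (p.2.1 - p.2.2 * Complex.I))
    =o[𝓝[cone M] 0] fun p => p.2.1 := by
  refine IsBigO.trans_isLittleO (IsBigO.of_bound (M ^ 2 + M) ?_) (delta_sq_isLittleO M)
  have hδ : ∀ᶠ p : ℝ × ℝ × ℝ in 𝓝[cone M] 0, M * p.2.1 < 1 := by
    have := (tendsto_delta M).const_mul M
    rw [mul_zero] at this
    exact this.eventually_lt_const one_pos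
  filter_upwards [self_mem_nhdsWithin, hδ] with p hp hp1
  obtain ⟨h0, -, -, hτ⟩ := hp
  have e : ctr p.2.1 (Circle.exp p.2.2) - 1 + (p.2.1 - p.2.2 * Complex.I)
      = (Complex.exp (p.2.2 * Complex.I) - 1 - p.2.2 * Complex.I)
        + ((p.2.1 : ℝ) : ℂ) * (1 - Circle.exp p.2.2) := by
    rw [ctr, Circle.coe_exp]; ring
  have hn : ‖(p.2.2 * Complex.I : ℂ)‖ = |p.2.2| := by
    rw [norm_mul, Complex.norm_I, mul_one, Complex.norm_real, Real.norm_eq_abs]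
  have h1 := Complex.norm_exp_sub_one_sub_id_le (x := p.2.2 * Complex.I) (by rw [hn]; linarith)
  rw [hn] at h1
  rw [e]
  refine (norm_add_le _ _).trans ?_
  rw [norm_mul, Complex.norm_real, Real.norm_eq_abs, Real.norm_eq_abs, abs_of_pos h0,
    abs_of_nonneg (by positivity : 0 ≤ p.2.1 ^ 2)]
  have h2 := norm_one_sub_exp_le p.2.2
  calc _ ≤ (M * p.2.1) ^ 2 + p.2.1 * (M * p.2.1) := by
        gcongr
        · exact h1.trans (by gcongr)
        · exact h2.trans hτ
    _ = _ := by ring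

lemma isBigO_inv_factor (hc : 0 < h 1) (M : ℝ) :
    (fun p : ℝ × ℝ × ℝ => ((1 - (1 - p.2.1) ^ 2) / h 1 * π)⁻¹) =O[𝓝[cone M] 0] fun p => p.2.1⁻¹ := by
  refine IsBigO.of_bound (h 1 / π) ?_
  filter_upwards [self_mem_nhdsWithin] with p hp
  have h1 : p.2.1 < 1 := by linarith [hp.2.1]
  have h2 := one_sub_sq_pos hp.1 h1
  have h3 := le_one_sub_sq hp.1 h1
  have h0 := hp.1
  rw [Real.norm_eq_abs, Real.norm_eq_abs, abs_of_pos (by positivity), abs_of_pos (by positivity)]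
  have e : ((1 - (1 - p.2.1) ^ 2) / h 1 * π)⁻¹ = h 1 / π * (1 - (1 - p.2.1) ^ 2)⁻¹ := by
    field_simp
  rw [e]
  gcongr

/-- First-order expansion of the reduced equation. The linear terms come from the boundary expansion of
Cauchy-type integrals, and the term with `Q h` from the Green energy of the density. -/
theorem Flat.redMap_isLittleO {C : ℝ} (hf : Flat C h k) (hh : IsC 2 h) (hk : IsC 1 k)
    (h_crit : tder h 1 = 0) (h_lap : HasHalfLap h 1 0) {A B : ℝ} (hA : HasHalfLap (tder h) 1 A)
    (hB : HasHalfLap k 1 B) (hM : 0 ≤ M) {C' r : ℝ} (hr : 0 < r) {Φ : ℝ × ℝ × ℝ → C(Circle, ℝ)}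
    (hΦ : ∀ p ∈ cone M, p.2.1 < r →
        AuxSolution C' (√(√p.2.1)) (Circle.exp p.2.2) (densMap h k p) (Φ p)) :
    (fun p : ℝ × ℝ × ℝ => redMap h k Φ p - ((tder (tder h) 1 + A * Complex.I) * (p.2.1 - p.2.2 * Complex.I)
        + p.1 * (B - tder k 1 * Complex.I) - ((2 / π ^ 2 * Q h * (1 / h 1) : ℝ) : ℂ) * p.2.1))
      =o[𝓝[cone M] 0] fun p => p.2.1 := by
  have hc := hf.pos
  have hpi : (π : ℂ) ≠ 0 := by exact_mod_cast Real.pi_ne_zero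
  have hM1 : 0 ≤ 1 + M := by linarith
  set l := 𝓝[cone M] (0 : ℝ × ℝ × ℝ) with hl
  set κ : ℂ := tder (tder h) 1 + A * Complex.I with hκ
  set a : ℝ × ℝ × ℝ → ℂ := fun p => ctr p.2.1 (Circle.exp p.2.2) with ha
  set E : ℝ × ℝ × ℝ → ℝ := fun p => ∫ z, dens h k p z * conv greenKer (dens h k p) z ∂arc with hE
  set b : ℝ × ℝ × ℝ → ℝ := fun p => (1 - (1 - p.2.1) ^ 2) / h 1 with hb
  -- the contribution of `h`
  have t1 : (fun p => (π : ℂ)⁻¹ * cauchyD h (a p) - κ * (p.2.1 - p.2.2 * Complex.I)) =o[l] fun p => p.2.1 := by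
    have h1 : (fun p => cauchyD h (a p) + π * κ * (a p - 1)) =o[l] fun p => p.2.1 :=
      ((cauchyD_isLittleO hh h_crit h_lap hA hM1).comp_tendsto (tendsto_ctr M)).trans_isBigO
        (ctr_sub_one_isBigO M)
    have h2 := (h1.const_mul_left (π : ℂ)⁻¹).sub ((ctr_sub_one_isLittleO M).const_mul_left κ)
    refine h2.congr_left fun p => ?_
    simp only [ha]
    field_simp
    ring
  -- the contribution of `k`
  have hε : (fun p : ℝ × ℝ × ℝ => (p.1 : ℂ)) =O[l] fun p => p.2.1 := by
    refine IsBigO.of_bound M ?_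
    filter_upwards [self_mem_nhdsWithin] with p hp
    rw [Complex.norm_real, Real.norm_eq_abs, Real.norm_eq_abs, abs_of_pos hp.1]
    exact hp.2.2.1
  have t2 : (fun p => (p.1 : ℂ) * ((π : ℂ)⁻¹ * cauchyD k (a p) - (B - tder k 1 * Complex.I))) =o[l]
      fun p => p.2.1 := by
    have h1 : Tendsto (fun p => (π : ℂ)⁻¹ * cauchyD k (a p) - (B - tder k 1 * Complex.I)) l (𝓝 0) := by
      have := (((tendsto_cauchyD hk hB hM1).comp (tendsto_ctr M)).const_mul (π : ℂ)⁻¹).sub_const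
        (B - tder k 1 * Complex.I)
      rwa [inv_mul_cancel_left₀ hpi, sub_self] at this
    have := hε.mul_isLittleO ((isLittleO_one_iff ℝ).2 h1)
    simpa using this
  -- the energy
  have hinv := isBigO_inv_factor hc M
  have hδ0 : ∀ᶠ p : ℝ × ℝ × ℝ in l, p.2.1 ≠ 0 := by
    filter_upwards [self_mem_nhdsWithin] with p hp using hp.1.ne'
  have t3 : (fun p => (b p * π)⁻¹ * E p - 2 / π ^ 2 * Q h * (1 / h 1) * p.2.1) =o[l] fun p => p.2.1 := by
    have h1 : (fun p => (b p * π)⁻¹ * (E p - b p ^ 2 * (Q h / π))) =o[l] fun p => p.2.1 := by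
      refine (hinv.mul_isLittleO (hf.energy_isLittleO h_lap hM)).congr' EventuallyEq.rfl ?_
      filter_upwards [hδ0] with p hp
      field_simp
    have h2 := h1.sub ((delta_sq_isLittleO M).const_mul_left (Q h / (π ^ 2 * h 1)))
    refine h2.congr' ?_ EventuallyEq.rfl
    filter_upwards [self_mem_nhdsWithin] with p hp
    have hbp : 0 < b p := div_pos (one_sub_sq_pos hp.1 (by linarith [hp.2.1])) hc
    have hbe : b p * h 1 = 2 * p.2.1 - p.2.1 ^ 2 := by
      simp only [hb]; field_simp; ring
    have e1 : (b p * π)⁻¹ * (E p - b p ^ 2 * (Q h / π)) = (b p * π)⁻¹ * E p - b p * Q h / π ^ 2 := by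
      have := Real.pi_ne_zero
      field_simp
    have e2 : b p = (2 * p.2.1 - p.2.1 ^ 2) / h 1 := by rw [← hbe]; field_simp
    rw [e1]
    have e3 : b p * Q h / π ^ 2 = 2 / π ^ 2 * Q h * (1 / h 1) * p.2.1 - Q h / (π ^ 2 * h 1) * p.2.1 ^ 2 := by
      rw [e2]
      have := Real.pi_ne_zero
      field_simp
    rw [e3]; ring
  have t3O : (fun p => (b p * π)⁻¹ * E p) =O[l] fun p => p.2.1 := by
    have h1 := t3.isBigO.add ((isBigO_refl (fun p : ℝ × ℝ × ℝ => p.2.1) l).const_mul_left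
      (2 / π ^ 2 * Q h * (1 / h 1)))
    refine h1.congr_left fun p => ?_
    ring
  have t4 : (fun p : ℝ × ℝ × ℝ => conj ((Circle.exp p.2.2 : Circle) : ℂ) * (((b p * π)⁻¹ * E p : ℝ) : ℂ)
      - ((2 / π ^ 2 * Q h * (1 / h 1) * p.2.1 : ℝ) : ℂ)) =o[l] fun p => p.2.1 := by
    have h1 : Tendsto (fun p : ℝ × ℝ × ℝ => conj ((Circle.exp p.2.2 : Circle) : ℂ) - 1) l (𝓝 0) := by
      have hcont : Continuous fun p : ℝ × ℝ × ℝ => conj ((Circle.exp p.2.2 : Circle) : ℂ) - 1 :=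
        (Complex.continuous_conj.comp (by fun_prop)).sub continuous_const
      have := (hcont.tendsto 0).mono_left (nhdsWithin_le_nhds (s := cone M))
      simpa using this
    have t3O' : (fun p => (((b p * π)⁻¹ * E p : ℝ) : ℂ)) =O[l] fun p => p.2.1 :=
      (IsBigO.of_norm_left (by simpa only [Complex.norm_real] using t3O.norm_left))
    have t3' : (fun p : ℝ × ℝ × ℝ => (((b p * π)⁻¹ * E p - 2 / π ^ 2 * Q h * (1 / h 1) * p.2.1 : ℝ) : ℂ))
        =o[l] fun p => p.2.1 :=
      (IsLittleO.of_norm_left (by simpa only [Complex.norm_real] using t3.norm_left))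
    have h2 := ((isLittleO_one_iff ℝ).2 h1).mul_isBigO t3O'
    simp only [one_mul] at h2
    refine (h2.add t3').congr_left fun p => ?_
    push_cast
    ring
  -- the remainder
  obtain ⟨C₂, hC₂⟩ := exists_norm_rfour_nonlin_sub_le C'
  set R : ℝ × ℝ × ℝ → ℂ := fun p => rfour (nonlin (densMap h k p) (Φ p)) 1 - rfour (densMap h k p) 1
      + conj ((Circle.exp p.2.2 : Circle) : ℂ)
        * ((∫ z, densMap h k p z * conv greenKer (densMap h k p) z ∂arc : ℝ) : ℂ) with hR
  have hRO : R =O[l] fun p => p.2.1 ^ 2 * √(√p.2.1) := by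
    refine IsBigO.of_bound C₂ ?_
    have hlt : ∀ᶠ p : ℝ × ℝ × ℝ in l, p.2.1 < r := (tendsto_delta M).eventually_lt_const hr
    filter_upwards [self_mem_nhdsWithin, hlt] with p hp hpr
    refine (hC₂ _ _ _ _ (hΦ p hp hpr)).trans_eq ?_
    rw [Real.norm_eq_abs, abs_of_nonneg (by have := hp.1; positivity)]
    have hs := sqrt_sqrt_pow_four hp.1.le
    calc _ = C₂ * (((√(√p.2.1)) ^ 4) ^ 2 * √(√p.2.1)) := by ring
      _ = _ := by rw [hs]
  have t5 : (fun p => (((b p * π)⁻¹ : ℝ) : ℂ) * R p) =o[l] fun p => p.2.1 := by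
    have h1 : (fun p => (((b p * π)⁻¹ : ℝ) : ℂ)) =O[l] fun p => p.2.1⁻¹ :=
      (IsBigO.of_norm_left (by simpa only [Complex.norm_real] using hinv.norm_left))
    have h2 : (fun p : ℝ × ℝ × ℝ => p.2.1 * √(√p.2.1)) =o[l] fun p => p.2.1 := by
      have := (isBigO_refl (fun p : ℝ × ℝ × ℝ => p.2.1) l).mul_isLittleO
        ((isLittleO_one_iff ℝ).2 (tendsto_sqrt_sqrt M))
      simpa using this
    refine ((h1.mul hRO).congr' EventuallyEq.rfl ?_).trans_isLittleO h2
    filter_upwards [hδ0] with p hp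
    field_simp
  refine (((t1.add t2).sub t4).add t5).congr' ?_ EventuallyEq.rfl
  filter_upwards [self_mem_nhdsWithin] with p hp
  have h1 : p.2.1 < 1 := by linarith [hp.2.1]
  have hbp : 0 < b p := div_pos (one_sub_sq_pos hp.1 h1) hc
  have hbp' : ((b p : ℝ) : ℂ) ≠ 0 := by exact_mod_cast hbp.ne'
  have hR' : rfour (nonlin (densMap h k p) (Φ p)) 1 = R p + (b p : ℂ) * (cauchyD h (a p) + p.1 * cauchyD k (a p))
      - conj ((Circle.exp p.2.2 : Circle) : ℂ) * (E p : ℂ) := by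
    simp only [hR, coe_densMap hf.cont_h hf.cont_k hp.1 h1, hE]
    rw [rfour_dens_one hf.cont_h hf.cont_k hp.1 h1]
    ring
  rw [redMap, hR']
  change _ = (((b p * π : ℝ) : ℂ))⁻¹ * _ - _
  push_cast
  field_simp
  ring

end asymptotics

end

/-! ### A planar degree argument -/

/-- Radial retraction of the plane onto the closed disc of radius `ρ`. -/
def discRetract (ρ : ℝ) (y : ℂ) : ℂ := ((ρ / max ρ ‖y‖ : ℝ) : ℂ) * y

lemma continuous_discRetract {ρ : ℝ} (hρ : 0 < ρ) : Continuous (discRetract ρ) := by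
  refine (Complex.continuous_ofReal.comp (Continuous.div continuous_const (by fun_prop)
    fun y => ?_)).mul continuous_id
  exact (hρ.trans_le (le_max_left _ _)).ne'

lemma norm_discRetract_le {ρ : ℝ} (hρ : 0 < ρ) (y : ℂ) : ‖discRetract ρ y‖ ≤ ρ := by
  have h := hρ.trans_le (le_max_left ρ ‖y‖)
  rw [discRetract, norm_mul, Complex.norm_real, Real.norm_eq_abs, abs_of_pos (div_pos hρ h),
    div_mul_eq_mul_div, div_le_iff₀ h]
  exact mul_le_mul_of_nonneg_left (le_max_right _ _) hρ.le

lemma discRetract_of_norm_eq {ρ : ℝ} (hρ : 0 < ρ) {y : ℂ} (hy : ‖y‖ = ρ) : discRetract ρ y = y := by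
  rw [discRetract, hy, max_self, div_self hρ.ne', Complex.ofReal_one, one_mul]

/-- A nowhere vanishing continuous function on the plane has a continuous logarithm. -/
lemma exists_continuous_log {G : ℂ → ℂ} (hG : Continuous G) (h0 : ∀ y, G y ≠ 0) :
    ∃ g : ℂ → ℂ, Continuous g ∧ ∀ y, Complex.exp (g y) = G y := by
  obtain ⟨F, ⟨-, hF⟩, -⟩ := Complex.isCoveringMap_exp.existsUnique_continuousMap_lifts
    (A := ℂ) ⟨fun y => (⟨G y, h0 y⟩ : {z : ℂ // z ≠ 0}), hG.subtype_mk _⟩ 0 (Complex.log (G 0))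
    (Subtype.ext (Complex.exp_log (h0 0)))
  exact ⟨F, F.continuous, fun y => congrArg Subtype.val (congrFun hF y)⟩

/-- A continuous map of a closed disc into the plane that moves each point by less than the radius
has a zero. -/
theorem exists_zero_of_near_id {G : ℂ → ℂ} {ρ : ℝ} (hρ : 0 < ρ)
    (hG : ContinuousOn G (Metric.closedBall 0 ρ))
    (hlt : ∀ y ∈ Metric.closedBall (0 : ℂ) ρ, ‖G y - y‖ < ρ) :
    ∃ y ∈ Metric.closedBall (0 : ℂ) ρ, G y = 0 := by
  by_contra! hne
  have hmem : ∀ y, discRetract ρ y ∈ Metric.closedBall (0 : ℂ) ρ := fun y =>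
    mem_closedBall_zero_iff.2 (norm_discRetract_le hρ y)
  obtain ⟨g, hg, hgG⟩ := exists_continuous_log
    (hG.comp_continuous (continuous_discRetract hρ) hmem) fun y => hne _ (hmem y)
  -- On the boundary circle, `g` is a continuous logarithm of `ρ e^{iθ}(1 + small)`.
  set c : ℝ → ℂ := fun θ => ρ * Complex.exp (θ * Complex.I) with hc
  have hcn : ∀ θ, ‖c θ‖ = ρ := fun θ => by
    rw [hc, norm_mul, Complex.norm_exp_ofReal_mul_I, mul_one, Complex.norm_real,
      Real.norm_eq_abs, abs_of_pos hρ]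
  have hc0 : ∀ θ, c θ ≠ 0 := fun θ => norm_pos_iff.1 (by rw [hcn]; exact hρ)
  have hcc : Continuous c := by fun_prop
  have hgc : ∀ θ, Complex.exp (g (c θ)) = G (c θ) := fun θ => by
    rw [hgG, Function.comp_apply, discRetract_of_norm_eq hρ (hcn θ)]
  have hcmem : ∀ θ, c θ ∈ Metric.closedBall (0 : ℂ) ρ := fun θ => mem_closedBall_zero_iff.2 (hcn θ).le
  set q : ℝ → ℂ := fun θ => G (c θ) / c θ with hq
  have hslit : ∀ θ, q θ ∈ Complex.slitPlane := fun θ => by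
    have e : q θ = 1 + (G (c θ) - c θ) / c θ := by
      have := hc0 θ
      simp only [hq]; field_simp; ring
    rw [e]
    refine Complex.mem_slitPlane_of_norm_lt_one ?_
    rw [norm_div, hcn, div_lt_one hρ]
    exact hlt _ (hcmem θ)
  have hqc : Continuous q := (hG.comp_continuous hcc hcmem).div hcc hc0
  set m : ℝ → ℂ := fun θ => g (c θ) - θ * Complex.I - Complex.log (q θ) with hm
  have hmc : Continuous m :=
    ((hg.comp hcc).sub (by fun_prop)).sub (continuous_iff_continuousAt.2 fun θ =>
      (continuousAt_clog (hslit θ)).comp hqc.continuousAt)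
  have hexp : ∀ θ, Complex.exp (m θ) = ρ := fun θ => by
    have h1 := hc0 θ
    have h2 : G (c θ) ≠ 0 := hne _ (hcmem θ)
    simp only [hm]
    rw [Complex.exp_sub, Complex.exp_sub, hgc, Complex.exp_log (Complex.slitPlane_ne_zero (hslit θ))]
    have h3 := Complex.exp_ne_zero (θ * Complex.I)
    simp only [hq, hc]
    simp only [hc] at h1 h2
    field_simp
  have hconst : ∀ θ, m θ = m 0 := by
    have hd : ∀ θ, ∃ n : ℤ, m θ = m 0 + n * (2 * π * Complex.I) := fun θ =>
      Complex.exp_eq_exp_iff_exists_int.1 ((hexp θ).trans (hexp 0).symm)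
    choose n hn using hd
    have hnr : ∀ θ, ((n θ : ℤ) : ℝ) = ((m θ - m 0).im) / (2 * π) := fun θ => by
      rw [hn θ, add_sub_cancel_left]
      have : ((n θ : ℂ) * (2 * π * Complex.I)).im = n θ * (2 * π) := by simp
      rw [this]
      field_simp
    have hnc : Continuous n := by
      refine Int.isClosedEmbedding_coe_real.isInducing.continuous_iff.2 ?_
      have : (Int.cast ∘ n : ℝ → ℝ) = fun θ => ((m θ - m 0).im) / (2 * π) := funext hnr
      rw [this]
      exact (Complex.continuous_im.comp (hmc.sub continuous_const)).div_const _
    intro θ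
    have := PreconnectedSpace.constant (inferInstance : PreconnectedSpace ℝ) hnc (x := θ) (y := 0)
    have h0 : n 0 = 0 := by
      have := hnr 0
      simpa using this
    rw [hn θ, this, h0]; simp
  have h2π := hconst (2 * π)
  have hper : c (2 * π) = c 0 := by
    simp only [hc]; push_cast; rw [Complex.exp_two_pi_mul_I]; simp
  simp only [hm, hq, hper] at h2π
  have := congrArg Complex.im h2π
  simp at this

/-! ### Solving the reduced equation -/

section

/-- A map with a nondegenerate first-order expansion on a cone has zeros there, for all small values
of the first parameter of one sign. The zeros are followed by a degree argument, as the error is only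
assumed continuous and not small in `C¹`. -/
theorem exists_zero_of_expansion {m q A B k₁ : ℝ} (hD : (m - q) * m + A ^ 2 ≠ 0)
    (hT : m * B - k₁ * A ≠ 0) :
    ∃ σ : ℝ, (σ = 1 ∨ σ = -1) ∧ ∃ M : ℝ, 0 ≤ M ∧ ∃ c₀ : ℝ, ∀ (E : ℝ × ℝ × ℝ → ℂ) (r : ℝ), 0 < r →
      ContinuousOn E {p | p ∈ cone M ∧ p.2.1 < r} →
      ((fun p : ℝ × ℝ × ℝ => E p - ((m + A * Complex.I) * (p.2.1 - p.2.2 * Complex.I)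
        + p.1 * (B - k₁ * Complex.I) - (q : ℂ) * p.2.1)) =o[𝓝[cone M] 0] fun p => p.2.1) →
      ∀ᶠ s in 𝓝[>] (0 : ℝ), ∃ δ τ : ℝ, (σ * s, δ, τ) ∈ cone M ∧ δ < r ∧ δ ≤ c₀ * s ∧ |τ| ≤ c₀ * s ∧
        E (σ * s, δ, τ) = 0 := by
  set D := (m - q) * m + A ^ 2 with hDdef
  set T := m * B - k₁ * A with hTdef
  -- the sign of `ε` is the one for which `δ` comes out positive
  obtain ⟨σ, hσ, hd₀⟩ : ∃ σ : ℝ, (σ = 1 ∨ σ = -1) ∧ 0 < -σ * T / D := by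
    rcases (div_ne_zero hT hD).lt_or_gt with h | h
    · exact ⟨1, Or.inl rfl, by rw [neg_one_mul, neg_div]; linarith⟩
    · exact ⟨-1, Or.inr rfl, by rw [neg_neg, one_mul]; exact h⟩
  have hσ1 : |σ| = 1 := by rcases hσ with rfl | rfl <;> simp
  -- `s (d₀, t₀)` solves the linearised equation for `ε = σ s`, by Cramer's rule; `ρ` is so small that
  -- `δ` stays above `s d₀ / 2` when the equation is perturbed by `s y` with `|y| ≤ ρ`
  set d₀ := -σ * T / D with hd₀def
  set t₀ := -σ * (A * B + (m - q) * k₁) / D with ht₀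
  set N := |m| + |A| + |m - q| + 1 with hN
  have hm0 := abs_nonneg m
  have hA0 := abs_nonneg A
  have hq0 := abs_nonneg (m - q)
  have hN0 : 0 < N := by positivity
  have hD0 : 0 < |D| := abs_pos.2 hD
  set ρ := d₀ * |D| / (2 * N) with hρ
  have hρ0 : 0 < ρ := by positivity
  have hρN : N * ρ / |D| = d₀ / 2 := by rw [hρ]; field_simp
  set c₀ := 1 + 2 * d₀ + |t₀| with hc₀
  have hc₀0 : 0 < c₀ := by positivity
  refine ⟨σ, hσ, 2 / d₀ * c₀, by positivity, c₀, fun E r hr hE hexp => ?_⟩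
  set M := 2 / d₀ * c₀ with hM
  -- the solution of the linearised equation with right-hand side `s y`
  set δ : ℝ → ℂ → ℝ := fun s y => s * (d₀ + (m * y.re + A * y.im) / D) with hδ
  set τ : ℝ → ℂ → ℝ := fun s y => s * (t₀ + (A * y.re - (m - q) * y.im) / D) with hτ
  have hlin : ∀ x₁ x₂ : ℝ, |x₁| + |x₂| ≤ N → ∀ y ∈ Metric.closedBall (0 : ℂ) ρ,
      |(x₁ * y.re + x₂ * y.im) / D| ≤ d₀ / 2 := by
    intro x₁ x₂ hx y hy
    rw [mem_closedBall_zero_iff] at hy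
    rw [← hρN, abs_div]
    refine div_le_div_of_nonneg_right ?_ (abs_nonneg _)
    refine (abs_add_le _ _).trans ?_
    rw [abs_mul, abs_mul]
    have h1 := (Complex.abs_re_le_norm y).trans hy
    have h2 := (Complex.abs_im_le_norm y).trans hy
    calc _ ≤ |x₁| * ρ + |x₂| * ρ := by gcongr
      _ = (|x₁| + |x₂|) * ρ := by ring
      _ ≤ N * ρ := by gcongr
  have hb : ∀ s, 0 < s → ∀ y ∈ Metric.closedBall (0 : ℂ) ρ,
      s * (d₀ / 2) ≤ δ s y ∧ δ s y ≤ c₀ * s ∧ |τ s y| ≤ c₀ * s := by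
    intro s hs y hy
    have h1 := abs_le.1 (hlin m A (by linarith) y hy)
    have h2 := hlin A (-(m - q)) (by rw [abs_neg]; linarith) y hy
    have ht := abs_nonneg t₀
    refine ⟨mul_le_mul_of_nonneg_left (by linarith) hs.le, ?_, ?_⟩
    · rw [mul_comm c₀]
      exact mul_le_mul_of_nonneg_left (by linarith) hs.le
    · rw [mul_comm c₀, hτ, abs_mul, abs_of_pos hs]
      refine mul_le_mul_of_nonneg_left ((abs_add_le _ _).trans ?_) hs.le
      rw [neg_mul, ← sub_eq_add_neg] at h2
      linarith
  have hcone : ∀ s, 0 < s → c₀ * s ≤ 1 / 2 → ∀ y ∈ Metric.closedBall (0 : ℂ) ρ,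
      (σ * s, δ s y, τ s y) ∈ cone M := by
    intro s hs hs2 y hy
    obtain ⟨h1, h2, h3⟩ := hb s hs y hy
    have h4 : c₀ * s ≤ M * δ s y := by
      calc c₀ * s = M * (s * (d₀ / 2)) := by rw [hM]; field_simp
        _ ≤ M * δ s y := by gcongr
    have h5 : s ≤ c₀ * s := by
      have : 1 ≤ c₀ := by rw [hc₀]; linarith [abs_nonneg t₀]
      nlinarith
    refine ⟨lt_of_lt_of_le (by positivity) h1, h2.trans hs2, ?_, h3.trans h4⟩
    change |σ * s| ≤ M * δ s y
    rw [abs_mul, hσ1, one_mul, abs_of_pos hs]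
    exact h5.trans h4
  -- the linear part is inverted exactly
  have hexact : ∀ (s : ℝ) (y : ℂ), ((m : ℂ) + A * Complex.I) * ((δ s y : ℂ) - (τ s y : ℂ) * Complex.I)
      + ((σ * s : ℝ) : ℂ) * (B - k₁ * Complex.I) - (q : ℂ) * (δ s y : ℂ) = s * y := by
    intro s y
    apply Complex.ext
    · simp [hδ, hτ, hd₀def, ht₀]
      field_simp
      rw [hTdef, hDdef]
      ring
    · simp [hδ, hτ, hd₀def, ht₀]
      field_simp
      rw [hTdef, hDdef]
      ring
  have hev := hexp.bound (show 0 < ρ / (2 * c₀) by positivity)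
  obtain ⟨r₁, hr₁, hball⟩ := Metric.mem_nhdsWithin_iff.1 hev
  set s₁ := min (1 / 2) (min r r₁) / c₀ with hs₁
  have hs₁0 : 0 < s₁ := by positivity
  filter_upwards [Ioo_mem_nhdsGT hs₁0] with s hs
  obtain ⟨hs0, hs1⟩ := hs
  have hcs : c₀ * s < min (1 / 2) (min r r₁) := by
    rw [hs₁, lt_div_iff₀ hc₀0] at hs1; linarith
  have hcs2 : c₀ * s ≤ 1 / 2 := hcs.le.trans (min_le_left _ _)
  have hcsr : c₀ * s < r := hcs.trans_le ((min_le_right _ _).trans (min_le_left _ _))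
  have hcsr₁ : c₀ * s < r₁ := hcs.trans_le ((min_le_right _ _).trans (min_le_right _ _))
  have hEs : ContinuousOn (fun y => (s : ℂ)⁻¹ * E (σ * s, δ s y, τ s y)) (Metric.closedBall 0 ρ) := by
    refine continuousOn_const.mul (hE.comp (f := fun y : ℂ => (σ * s, δ s y, τ s y)) ?_ ?_)
    · refine Continuous.continuousOn ?_
      have h1 : Continuous (δ s) := by simp only [hδ]; fun_prop
      have h2 : Continuous (τ s) := by simp only [hτ]; fun_prop
      fun_prop
    · exact fun y hy => ⟨hcone s hs0 hcs2 y hy, (hb s hs0 y hy).2.1.trans_lt hcsr⟩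
  have hsc : (s : ℂ) ≠ 0 := by exact_mod_cast hs0.ne'
  obtain ⟨y, hy, hy0⟩ := exists_zero_of_near_id hρ0 hEs (by
    intro y hy
    obtain ⟨h1, h2, h3⟩ := hb s hs0 y hy
    have hc := hcone s hs0 hcs2 y hy
    have h5 : s ≤ c₀ * s := by
      have : 1 ≤ c₀ := by rw [hc₀]; linarith [abs_nonneg t₀]
      nlinarith
    have hmem : (σ * s, δ s y, τ s y) ∈ Metric.ball (0 : ℝ × ℝ × ℝ) r₁ := by
      rw [mem_ball_zero_iff, Prod.norm_def, Prod.norm_def]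
      refine max_lt ?_ (max_lt ?_ (h3.trans_lt hcsr₁))
      · rw [Real.norm_eq_abs, abs_mul, hσ1, one_mul, abs_of_pos hs0]
        exact h5.trans_lt hcsr₁
      · rw [Real.norm_eq_abs, abs_of_pos hc.1]
        exact h2.trans_lt hcsr₁
    have hle := hball ⟨hmem, hc⟩
    simp only [mem_ofPred_eq] at hle
    rw [hexact, Real.norm_eq_abs, abs_of_pos hc.1] at hle
    have e : (s : ℂ)⁻¹ * E (σ * s, δ s y, τ s y) - y = (s : ℂ)⁻¹ * (E (σ * s, δ s y, τ s y) - s * y) := by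
      field_simp
    rw [e, norm_mul, norm_inv, Complex.norm_real, Real.norm_eq_abs, abs_of_pos hs0,
      inv_mul_lt_iff₀ hs0]
    calc _ ≤ ρ / (2 * c₀) * (c₀ * s) := hle.trans (by gcongr)
      _ = s * ρ / 2 := by field_simp
      _ < s * ρ := by linarith [mul_pos hs0 hρ0])
  obtain ⟨-, h2, h3⟩ := hb s hs0 y hy
  refine ⟨δ s y, τ s y, hcone s hs0 hcs2 y hy, h2.trans_lt hcsr, h2, h3, ?_⟩
  exact (mul_eq_zero.1 hy0).resolve_left (inv_ne_zero hsc)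

/-! ### Blow-up -/

variable {δ : ℝ}

lemma le_pullBack (h0 : 0 < δ) (h1 : δ < 1) (c : ℝ) (ξ : Circle) {φ : Circle → ℝ}
    (hφ : ∀ z, |φ z| ≤ 1) : -1 - Real.log c - Real.log δ ≤ pullBack c δ ξ φ ξ := by
  have h2 := (abs_le.1 (hφ (circleMobius δ (-ξ) ξ))).1
  have hd : ‖(ξ : ℂ) - ctr δ ξ‖ = δ := by
    have e : (ξ : ℂ) - ctr δ ξ = ((δ : ℝ) : ℂ) * ξ := by rw [ctr]; ring
    rw [e, norm_mul, Circle.norm_coe, mul_one, Complex.norm_real, Real.norm_eq_abs, abs_of_pos h0]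
  have h3 : δ⁻¹ ≤ pker δ ξ ξ := by
    rw [pker, hd, le_div_iff₀ (by positivity)]
    have := le_one_sub_sq h0 h1
    calc δ⁻¹ * δ ^ 2 = δ := by field_simp
      _ ≤ _ := this
  have h4 := Real.log_le_log (by positivity) h3
  rw [Real.log_inv] at h4
  rw [pullBack]
  linarith

lemma pullBack_le {M τ r : ℝ} (hM : 0 ≤ M) (h0 : 0 < δ) (h1 : δ < 1) (hτ : |τ| ≤ M * δ) (c : ℝ)
    {φ : Circle → ℝ} (hφ : ∀ z, |φ z| ≤ 1) (hr : 0 < r) {z : Circle} (hz : r ≤ ‖(1 : ℂ) - z‖) :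
    pullBack c δ (Circle.exp τ) φ z ≤ 1 - Real.log c + Real.log (2 * (2 + M) ^ 2 / r ^ 2) + Real.log δ := by
  have h2 := (abs_le.1 (hφ (circleMobius δ (-Circle.exp τ) z))).2
  have hx := norm_one_sub_le_mul hM h0 h1 hτ z
  have hd := norm_sub_ctr_pos (ξ := Circle.exp τ) h0 h1 z
  have h3 : pker δ (Circle.exp τ) z ≤ 2 * (2 + M) ^ 2 / r ^ 2 * δ := by
    rw [pker, div_mul_eq_mul_div, div_le_div_iff₀ (by positivity) (by positivity)]
    have h5 : r ^ 2 ≤ ((2 + M) * ‖(z : ℂ) - ctr δ (Circle.exp τ)‖) ^ 2 := by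
      gcongr; exact hz.trans hx
    calc _ ≤ (2 * δ) * ((2 + M) * ‖(z : ℂ) - ctr δ (Circle.exp τ)‖) ^ 2 := by
          have := one_sub_sq_le δ
          gcongr
      _ = _ := by ring
  have h4 := Real.log_le_log (pker_pos h0 h1 z) h3
  rw [Real.log_mul (by positivity) h0.ne'] at h4
  rw [pullBack]
  linarith

/-- Blow-up of a family of pulled-back functions whose parameters degenerate linearly. -/
lemma blowsUpAt_pullBack {l : Filter ℝ} {M c : ℝ} (hM : 0 ≤ M) {δ τ : ℝ → ℝ} {φ : ℝ → Circle → ℝ}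
    (hev : ∀ᶠ ε in l, 0 < δ ε ∧ δ ε < 1 ∧ |τ ε| ≤ M * δ ε ∧ ∀ z, |φ ε z| ≤ 1)
    (hδ : Tendsto δ l (𝓝 0)) :
    BlowsUpAt l (fun ε => pullBack c (δ ε) (Circle.exp (τ ε)) (φ ε)) 1 := by
  have hlog : Tendsto (fun ε => Real.log (δ ε)) l atBot := by
    refine Real.tendsto_log_nhdsGT_zero.comp (tendsto_nhdsWithin_iff.2 ⟨hδ, ?_⟩)
    filter_upwards [hev] with ε hε using hε.1
  intro U hU K
  constructor
  · have hτ : Tendsto τ l (𝓝 0) := by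
      refine squeeze_zero_norm' (a := fun ε => M * δ ε) ?_ (by simpa using hδ.const_mul M)
      filter_upwards [hev] with ε hε using hε.2.2.1
    have hξ : Tendsto (fun ε => Circle.exp (τ ε)) l (𝓝 1) := by
      have := (Circle.exp.continuous.tendsto 0).comp hτ
      simpa [Function.comp_def] using this
    filter_upwards [hev, hξ.eventually_mem hU, hlog.eventually_lt_atBot (-1 - Real.log c - K)]
      with ε hε hU' hl
    exact ⟨_, hU', lt_of_lt_of_le (by linarith) (le_pullBack hε.1 hε.2.1 c _ hε.2.2.2)⟩
  · have hU2 : ∃ r > 0, ∀ z : Circle, z ∉ U → r ≤ ‖(1 : ℂ) - z‖ := by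
      obtain ⟨r, hr, hrU⟩ := Metric.mem_nhds_iff.1 hU
      refine ⟨r, hr, fun z hz => ?_⟩
      by_contra! hlt
      refine hz (hrU ?_)
      change dist (z : ℂ) ((1 : Circle) : ℂ) < r
      rw [dist_eq_norm, norm_sub_rev, Circle.coe_one]
      exact hlt
    obtain ⟨r, hr, hrU⟩ := hU2
    filter_upwards [hev, hlog.eventually_lt_atBot
      (K - (1 - Real.log c + Real.log (2 * (2 + M) ^ 2 / r ^ 2)))] with ε hε hl z hz
    exact (pullBack_le hM hε.1 hε.2.1 hε.2.2.1 c hε.2.2.2 hr (hrU z hz)).trans_lt (by linarith)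

end

end HalfLiouville

end

theorem theorem1p1 (α : ℝ≥0) (hα : 0 < α) (h k : Circle → ℝ)
    (hh : HalfLiouville.IsC2Holder α h)
    (hk : HalfLiouville.IsC 1 k)
    (hk1 : k 1 = 0)
    (h_pos : 0 < h 1)
    (h_crit : HalfLiouville.tder h 1 = 0)
    (h_lap : HalfLiouville.HasHalfLap h 1 0)
    -- `A` is the value `(-Δ)^{1/2} h'(1)` and `B` is the value `(-Δ)^{1/2} k(1)`
    (A B : ℝ)
    (hA : HalfLiouville.HasHalfLap (HalfLiouville.tder h) 1 A)
    (hB : HalfLiouville.HasHalfLap k 1 B)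
    (h_nondeg :
      (HalfLiouville.tder (HalfLiouville.tder h) 1
          - 2 / π ^ 2 * HalfLiouville.Q h * (1 / h 1))
        * HalfLiouville.tder (HalfLiouville.tder h) 1 + A ^ 2 ≠ 0)
    (h_transv :
      HalfLiouville.tder (HalfLiouville.tder h) 1 * B - HalfLiouville.tder k 1 * A ≠ 0) :
    ∃ ε₀ : ℝ, 0 < ε₀ ∧ ∃ I : Set ℝ, (I = Ioo 0 ε₀ ∨ I = Ioo (-ε₀) 0) ∧
      ∃ (u : ℝ → Circle → ℝ) (δ : ℝ → ℝ) (ξ : ℝ → Circle),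
        (∀ ε ∈ I, HalfLiouville.IsSolution (fun z => h z + ε * k z) (u ε)) ∧
        HalfLiouville.BlowsUpAt (𝓝[I] 0) u 1 ∧
        (∀ ε ∈ I, 0 < δ ε ∧ δ ε < 1) ∧
        δ =O[𝓝[I] 0] (fun ε => ε) ∧
        (fun ε => (ξ ε : ℂ) - 1) =O[𝓝[I] 0] (fun ε => ε) ∧
        ∀ p : ℝ≥0∞, 1 ≤ p → p ≠ ∞ →
          ∃ C : ℝ, ∀ᶠ ε in 𝓝[I] 0,
            eLpNorm
              (fun z : Circle =>
                u ε (HalfLiouville.circleMobius (δ ε) (ξ ε) z)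
                  + Real.log ‖deriv (HalfLiouville.mobius (δ ε) (ξ ε)) (z : ℂ)‖
                  + Real.log (h 1))
              p HalfLiouville.arc ≤ ENNReal.ofReal (C * |ε|) := by
  obtain ⟨hh2, -⟩ := hh
  obtain ⟨C₁, hC₁, hb₁⟩ := HalfLiouville.exists_abs_sub_le_sq hh2 h_crit
  obtain ⟨C₂, hC₂, hb₂⟩ := HalfLiouville.exists_abs_sub_le hk
  have hf : HalfLiouville.Flat (max C₁ C₂) h k := by
    refine ⟨hh2.continuous, hk.continuous, le_max_of_le_left hC₁, h_pos, fun w => ?_, fun w => ?_⟩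
    · exact (hb₁ w).trans (by gcongr; exact le_max_left _ _)
    · have := hb₂ w
      rw [hk1, sub_zero] at this
      exact this.trans (by gcongr; exact le_max_right _ _)
  obtain ⟨σ, hσ, M, hM, c₀, hsolve⟩ := HalfLiouville.exists_zero_of_expansion h_nondeg h_transv
  obtain ⟨C', r, hr, Φ, hΦ, hΦc⟩ := hf.exists_aux_family h_lap hM
  have hev := hsolve (HalfLiouville.redMap h k Φ) r hr
    (HalfLiouville.continuousOn_redMap hf.cont_h hf.cont_k h_pos hΦc)
    (hf.redMap_isLittleO hh2 hk h_crit h_lap hA hB hM hr hΦ)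
  obtain ⟨ε₀, hε₀, hsub⟩ := mem_nhdsGT_iff_exists_Ioo_subset.1 hev
  -- `I` is the interval of the parameters with the sign of `σ`
  obtain ⟨I, hI, hIσ⟩ : ∃ I : Set ℝ, (I = Ioo 0 ε₀ ∨ I = Ioo (-ε₀) 0) ∧
      ∀ ε ∈ I, |ε| ∈ Ioo 0 ε₀ ∧ σ * |ε| = ε := by
    rcases hσ with rfl | rfl
    · refine ⟨Ioo 0 ε₀, Or.inl rfl, fun ε hε => ?_⟩
      rw [abs_of_pos hε.1, one_mul]
      exact ⟨hε, rfl⟩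
    · refine ⟨Ioo (-ε₀) 0, Or.inr rfl, fun ε hε => ?_⟩
      rw [abs_of_neg hε.2, neg_one_mul, neg_neg]
      exact ⟨⟨by linarith [hε.2], by linarith [hε.1]⟩, rfl⟩
  have hex : ∀ ε : ℝ, ∃ x : ℝ × ℝ, ε ∈ I → (ε, x) ∈ HalfLiouville.cone M ∧ x.1 < r ∧
      x.1 ≤ c₀ * |ε| ∧ |x.2| ≤ c₀ * |ε| ∧ HalfLiouville.redMap h k Φ (ε, x) = 0 := by
    intro ε
    by_cases hε : ε ∈ I
    · obtain ⟨h1, h2⟩ := hIσ ε hε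
      obtain ⟨δ, τ, hx⟩ := hsub h1
      rw [h2] at hx
      exact ⟨(δ, τ), fun _ => hx⟩
    · exact ⟨0, fun h => absurd h hε⟩
  choose x hx using hex
  have hδ1 : ∀ ε ∈ I, 0 < (x ε).1 ∧ (x ε).1 < 1 := fun ε hε =>
    ⟨(hx ε hε).1.1, by have h2 := (hx ε hε).1.2.1; simp only at h2; linarith⟩
  have haux : ∀ ε ∈ I, HalfLiouville.AuxSolution C' (√(√(x ε).1)) (Circle.exp (x ε).2)
      (HalfLiouville.densMap h k (ε, x ε)) (Φ (ε, x ε)) := fun ε hε =>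
    hΦ (ε, x ε) (hx ε hε).1 (hx ε hε).2.1
  have hδO : (fun ε => (x ε).1) =O[𝓝[I] 0] fun ε => ε := by
    refine IsBigO.of_bound c₀ ?_
    filter_upwards [self_mem_nhdsWithin] with ε hε
    rw [Real.norm_eq_abs, Real.norm_eq_abs, abs_of_pos (hδ1 ε hε).1]
    exact (hx ε hε).2.2.1
  have hid : Tendsto (fun ε : ℝ => ε) (𝓝[I] 0) (𝓝 0) := tendsto_id.mono_left nhdsWithin_le_nhds
  refine ⟨ε₀, hε₀, I, hI, fun ε => HalfLiouville.pullBack (h 1) (x ε).1 (Circle.exp (x ε).2)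
    (Φ (ε, x ε)), fun ε => (x ε).1, fun ε => Circle.exp (x ε).2, fun ε hε => ?_, ?_, hδ1, hδO, ?_, ?_⟩
  · have hκ : HalfLiouville.IsC 1 fun z => h z + ε * k z :=
      ContDiff.add hh2.one_of_two (contDiff_const.mul hk)
    obtain ⟨h0, h1⟩ := hδ1 ε hε
    refine HalfLiouville.isSolution_pullBack hκ h_pos h0 h1 (fun z => ?_) (haux ε hε).fixed ?_
    · exact congrFun (HalfLiouville.coe_densMap (p := (ε, x ε)) hf.cont_h hf.cont_k h0 h1) z
    · refine (mul_eq_zero.1 (hx ε hε).2.2.2.2).resolve_left (inv_ne_zero ?_)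
      have := HalfLiouville.one_sub_sq_pos h0 h1
      rw [Complex.ofReal_ne_zero]
      positivity
  · refine HalfLiouville.blowsUpAt_pullBack hM ?_ (hδO.trans_tendsto hid)
    filter_upwards [self_mem_nhdsWithin] with ε hε
    exact ⟨(hδ1 ε hε).1, (hδ1 ε hε).2, (hx ε hε).1.2.2.2, (haux ε hε).abs_le_one⟩
  · refine IsBigO.of_bound c₀ ?_
    filter_upwards [self_mem_nhdsWithin] with ε hε
    rw [norm_sub_rev, Real.norm_eq_abs]
    exact (HalfLiouville.norm_one_sub_exp_le _).trans (hx ε hε).2.2.2.1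
  · intro p _ hp
    obtain ⟨C'', hC''⟩ := HalfLiouville.exists_eLpNorm_le C' hp
    refine ⟨|C''| * c₀, ?_⟩
    filter_upwards [self_mem_nhdsWithin] with ε hε
    obtain ⟨h0, h1⟩ := hδ1 ε hε
    simp only [HalfLiouville.pullBack_circleMobius h0 h1]
    refine (hC'' _ _ _ _ (haux ε hε)).trans (ENNReal.ofReal_le_ofReal ?_)
    rw [HalfLiouville.sqrt_sqrt_pow_four h0.le, mul_assoc]
    exact mul_le_mul (le_abs_self C'') (hx ε hε).2.2.1 h0.le (abs_nonneg _)
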